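/- Let $\mathcal H,\mathcal H'$ be separable complex Hilbert spaces, let $\mathfrak T(\mathcal H)$ be the Banach space of trace-class operators with the trace norm (continuity below refers to this norm), $\mathfrak T_+(\mathcal H)$ its cone of positive operators, $\mathfrak T_+^k(\mathcal H)$ the set of operators in $\mathfrak T_+(\mathcal H)$ of rank $\le k$, $\mathfrak S(\mathcal H)=\{\rho\in\mathfrak T_+(\mathcal H):\mathrm{Tr}\rho=1\}$, and $\mathrm{extr}\,\mathfrak S(\mathcal H)$ the set of pure states (extreme points of $\mathfrak S(\mathcal H)$). The quantum entropy is $H(A)=\mathrm{Tr}\,\eta(A)-\eta(\mathrm{Tr}A)\in[0,+\infty]$, $A\in\mathfrak T_+(\mathcal H)$, with $\eta(x)=-x\log x$. Continuity of a $[0,+\infty]$-valued function on a set is understood to include its finiteness on this set. Let $\Phi:\mathfrak T(\mathcal H)\to\mathfrak T(\mathcal H')$ be a positive linear trace-non-increasing map (that is, $\Phi(A)\ge0$ and $\mathrm{Tr}\,\Phi(A)\le\mathrm{Tr}A$ for $A\ge 0$), $H_\Phi(A)=H(\Phi(A))$, and for $k\ge1$ let $$H_\Phi^k(A)=\sup\sum_i\pi_iH_\Phi(A_i),\qquad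 A\in\mathfrak T_+(\mathcal H),$$ where the supremum is over all decompositions $A=\sum_i\pi_iA_i$ into countable convex combinations of operators $A_i\in\mathfrak T_+^k(\mathcal H)$ (the $k$-order approximator of $H_\Phi$). The following properties are equivalent: (i) the function $A\mapsto H_\Phi(A)$ is continuous on $\mathfrak T_+^1(\mathcal H)$; (ii) the function $A\mapsto H_\Phi^k(A)$ is continuous on $\mathfrak T_+(\mathcal H)$ for each $k\ge1$; (iii) the function $A\mapsto H_\Phi(A)$ is continuous on every subset of $\mathfrak T_+(\mathcal H)$ on which the quantum entropy is continuous. Property (i) is equivalent to continuity and boundedness of the function $\rho\mapsto H_\Phi(\rho)$ on the set $\mathrm{extr}\,\mathfrak S(\mathcal H)$. Property (i) follows from the UA-property of the set $\Phi(\mathrm{extr}\,\mathfrak S(\mathcal H))$. Here a set $\mathcal A\subseteq\mathfrak T_+(\mathcal H')$ has the UA-property if $\lim_{k\to\infty}\sup_{A\in\mathcal A}\Delta_k(A)=0$, where $\Delta_k(A)=\inf\sum_i\pi_iH(A_i\|A)$, the infimum being over all decompositions $A=\sum_i\pi_iA_i$ into countable convex combinations of operators $A_i\in\mathfrak T_+^k(\mathcal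 H')$, and $H(A\|B)=\sum_i\langle i|(A\log A-A\log B+B-A)|i\rangle$ is the relative entropy ($\{|i\rangle\}$ an orthonormal basis of eigenvectors of $A$; $H(A\|B)=+\infty$ if $\mathrm{supp}A\not\subseteq\mathrm{supp}B$). -/

import Mathlib

open Filter Topology
open scoped ENNReal InnerProductSpace

noncomputable section

section TraceClassOperators

variable {H : Type*} [NormedAddCommGroup H] [InnerProductSpace ℂ H]

/-- The trace norm of a bounded operator with values in `[0, ∞]`, in its variational form: the
supremum of `∑ i, |⟨f i, T (e i)⟩|` over all pairs of finite orthonormal families `e`, `f`. -/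
def traceENorm (T : H →L[ℂ] H) : ℝ≥0∞ :=
  ⨆ (n : ℕ) (e : Fin n → H) (f : Fin n → H) (_ : Orthonormal ℂ e) (_ : Orthonormal ℂ f),
    ∑ i, ‖⟪f i, T (e i)⟫_ℂ‖ₑ

theorem le_traceENorm (T : H →L[ℂ] H) {n : ℕ} {e f : Fin n → H} (he : Orthonormal ℂ e)
    (hf : Orthonormal ℂ f) : ∑ i, ‖⟪f i, T (e i)⟫_ℂ‖ₑ ≤ traceENorm T :=
  le_iSup_of_le n <| le_iSup_of_le e <| le_iSup_of_le f <| le_iSup_of_le he <|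
    le_iSup_of_le hf le_rfl

theorem traceENorm_le {T : H →L[ℂ] H} {C : ℝ≥0∞}
    (h : ∀ (n : ℕ) (e f : Fin n → H), Orthonormal ℂ e → Orthonormal ℂ f →
      ∑ i, ‖⟪f i, T (e i)⟫_ℂ‖ₑ ≤ C) : traceENorm T ≤ C :=
  iSup_le fun n => iSup_le fun e => iSup_le fun f => iSup_le fun he => iSup_le fun hf =>
    h n e f he hf

theorem traceENorm_zero : traceENorm (0 : H →L[ℂ] H) = 0 :=
  le_antisymm (traceENorm_le fun n e f _ _ => by simp) bot_le

theorem traceENorm_add_le (S T : H →L[ℂ] H) :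
    traceENorm (S + T) ≤ traceENorm S + traceENorm T := by
  refine traceENorm_le fun n e f he hf => ?_
  calc ∑ i, ‖⟪f i, (S + T) (e i)⟫_ℂ‖ₑ
      ≤ ∑ i, (‖⟪f i, S (e i)⟫_ℂ‖ₑ + ‖⟪f i, T (e i)⟫_ℂ‖ₑ) := by
        refine Finset.sum_le_sum fun i _ => ?_
        rw [_root_.add_apply, inner_add_right]
        exact enorm_add_le _ _
    _ ≤ traceENorm S + traceENorm T := by
        rw [Finset.sum_add_distrib]
        exact add_le_add (le_traceENorm S he hf) (le_traceENorm T he hf)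

theorem traceENorm_smul_le (c : ℂ) (T : H →L[ℂ] H) :
    traceENorm (c • T) ≤ ‖c‖ₑ * traceENorm T := by
  refine traceENorm_le fun n e f he hf => ?_
  calc ∑ i, ‖⟪f i, (c • T) (e i)⟫_ℂ‖ₑ
      = ‖c‖ₑ * ∑ i, ‖⟪f i, T (e i)⟫_ℂ‖ₑ := by
        rw [Finset.mul_sum]
        refine Finset.sum_congr rfl fun i _ => ?_
        rw [_root_.smul_apply, inner_smul_right, enorm_mul]
    _ ≤ ‖c‖ₑ * traceENorm T := by
        gcongr
        exact le_traceENorm T he hf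

theorem traceENorm_smul (c : ℂ) (T : H →L[ℂ] H) :
    traceENorm (c • T) = ‖c‖ₑ * traceENorm T := by
  refine le_antisymm (traceENorm_smul_le c T) ?_
  by_cases hc : c = 0
  · simp [hc]
  · have h := traceENorm_smul_le c⁻¹ (c • T)
    rw [inv_smul_smul₀ hc] at h
    calc ‖c‖ₑ * traceENorm T ≤ ‖c‖ₑ * (‖c⁻¹‖ₑ * traceENorm (c • T)) := by gcongr
      _ = traceENorm (c • T) := by
        rw [← mul_assoc, ← enorm_mul, mul_inv_cancel₀ hc]
        simp

theorem eq_zero_of_traceENorm_eq_zero {T : H →L[ℂ] H} (h : traceENorm T = 0) : T = 0 := by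
  ext x
  by_contra hTx
  have hTx' : T x ≠ 0 := by simpa using hTx
  have hx : x ≠ 0 := by
    rintro rfl
    exact hTx' (map_zero T)
  have key : ∀ y : H, y ≠ 0 →
      Orthonormal ℂ (fun _ : Fin 1 => ((‖y‖ : ℂ)⁻¹) • y) := by
    intro y hy
    refine ⟨fun _ => ?_, fun i j hij => absurd (Subsingleton.elim i j) hij⟩
    rw [norm_smul, norm_inv, Complex.norm_real, norm_norm,
      inv_mul_cancel₀ (norm_ne_zero_iff.2 hy)]
  have h1 := le_traceENorm T (key x hx) (key (T x) hTx')
  rw [h, nonpos_iff_eq_zero] at h1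
  simp [hx, hTx'] at h1

variable (H) in
/-- The trace-class operators: the bounded operators of finite trace norm. -/
def traceClassSubmodule : Submodule ℂ (H →L[ℂ] H) where
  carrier := {T | traceENorm T < ∞}
  zero_mem' := by simp [traceENorm_zero]
  add_mem' := fun {S T} hS hT =>
    lt_of_le_of_lt (traceENorm_add_le S T) (ENNReal.add_lt_top.2 ⟨hS, hT⟩)
  smul_mem' := fun c T hT =>
    lt_of_le_of_lt (traceENorm_smul_le c T) (ENNReal.mul_lt_top (by simp) hT)

variable (H) in
/-- The space `𝔗(H)` of trace-class operators; it carries the trace norm (and not the operator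
norm that it would inherit as a subspace). -/
def TraceClass : Type _ := traceClassSubmodule H

namespace TraceClass

instance : AddCommGroup (TraceClass H) := inferInstanceAs (AddCommGroup (traceClassSubmodule H))

instance : Module ℂ (TraceClass H) := inferInstanceAs (Module ℂ (traceClassSubmodule H))

/-- The bounded operator underlying a trace-class operator. -/
def op (A : TraceClass H) : H →L[ℂ] H := Subtype.val (p := (· ∈ traceClassSubmodule H)) A

theorem traceENorm_op_lt_top (A : TraceClass H) : traceENorm A.op < ∞ :=
  Subtype.property (p := (· ∈ traceClassSubmodule H)) A

theorem op_add (A B : TraceClass H) : (A + B).op = A.op + B.op := rfl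

theorem op_smul (c : ℂ) (A : TraceClass H) : (c • A).op = c • A.op := rfl

theorem op_zero : (0 : TraceClass H).op = 0 := rfl

theorem op_injective : Function.Injective (op : TraceClass H → H →L[ℂ] H) :=
  Subtype.val_injective

/-- The trace norm. -/
instance : Norm (TraceClass H) := ⟨fun A => (traceENorm A.op).toReal⟩

theorem norm_def (A : TraceClass H) : ‖A‖ = (traceENorm A.op).toReal := rfl

theorem normCore : NormedSpace.Core ℂ (TraceClass H) where
  norm_nonneg A := ENNReal.toReal_nonneg
  norm_smul c A := by
    rw [norm_def, op_smul, traceENorm_smul, ENNReal.toReal_mul, toReal_enorm, norm_def]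
  norm_triangle A B := by
    rw [norm_def, norm_def, norm_def, op_add,
      ← ENNReal.toReal_add A.traceENorm_op_lt_top.ne B.traceENorm_op_lt_top.ne]
    exact ENNReal.toReal_mono
      (ENNReal.add_lt_top.2 ⟨A.traceENorm_op_lt_top, B.traceENorm_op_lt_top⟩).ne
      (traceENorm_add_le _ _)
  norm_eq_zero_iff A := by
    constructor
    · intro h
      rw [norm_def, ENNReal.toReal_eq_zero_iff] at h
      exact op_injective (eq_zero_of_traceENorm_eq_zero
        (h.resolve_right A.traceENorm_op_lt_top.ne))
    · rintro rfl
      rw [norm_def, op_zero, traceENorm_zero, ENNReal.toReal_zero]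

instance : NormedAddCommGroup (TraceClass H) := NormedAddCommGroup.ofCore normCore

instance : NormedSpace ℂ (TraceClass H) := NormedSpace.ofCore normCore

end TraceClass

variable [CompleteSpace H]

/-- The trace of a positive bounded operator, with values in `[0, ∞]`: the sum of its diagonal
values in an orthonormal basis (the sum is the same for every orthonormal basis). -/
def posTrace (T : H →L[ℂ] H) : ℝ≥0∞ :=
  ∑' i, ENNReal.ofReal (RCLike.re
    ⟪(exists_hilbertBasis ℂ H).choose_spec.choose i,
      T ((exists_hilbertBasis ℂ H).choose_spec.choose i)⟫_ℂ)

variable (H) in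
/-- The cone `𝔗₊(H)` of positive trace-class operators. -/
def posCone : Set (TraceClass H) := {A | A.op.IsPositive}

variable (H) in
/-- The set `𝔗₊ᵏ(H)` of positive trace-class operators of rank at most `k`. -/
def posConeRank (k : ℕ) : Set (TraceClass H) :=
  {A | A ∈ posCone H ∧ Module.rank ℂ (LinearMap.range (A.op : H →ₗ[ℂ] H)) ≤ k}

variable (H) in
/-- The set `𝔖(H)` of states (density operators). -/
def states : Set (TraceClass H) := {A | A ∈ posCone H ∧ posTrace A.op = 1}

variable (H) in
/-- The set of pure states: the extreme points of the set of states. -/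
def pureStates : Set (TraceClass H) := Set.extremePoints ℝ (states H)

/-- `Tr η(A)` for a positive trace-class operator `A`, where `η x = -x log x`: the trace of the
positive part of `η(A)` minus the trace of its negative part (the latter is finite, because only
finitely many eigenvalues of `A` exceed `1`). -/
def traceEta (A : TraceClass H) : EReal :=
  (posTrace (cfc (fun x : ℝ => max (Real.negMulLog x) 0) A.op) : EReal) -
    (posTrace (cfc (fun x : ℝ => max (-Real.negMulLog x) 0) A.op) : EReal)

/-- The quantum entropy `H(A) = Tr η(A) - η(Tr A)` of a positive trace-class operator. It is
nonnegative and possibly infinite, so it is taken in `[0, ∞]`. -/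
def entropy (A : TraceClass H) : ℝ≥0∞ :=
  (traceEta A - ((Real.negMulLog (posTrace A.op).toReal : ℝ) : EReal)).toENNReal

/-- The support of a positive operator, i.e. the closure of its range. -/
def supp (A : TraceClass H) : Submodule ℂ H := (LinearMap.ker (A.op : H →ₗ[ℂ] H))ᗮ

/-- `e` is an orthonormal basis of eigenvectors of `A` with the eigenvalues `a`. -/
def IsEigenbasis {ι : Type*} (A : TraceClass H) (e : HilbertBasis ι ℂ H) (a : ι → ℝ) : Prop :=
  ∀ i, A.op (e i) = (a i : ℂ) • e i

open Classical in
/-- The relative entropy `H(A‖B) = ∑ i, ⟨e i| (A log A - A log B + B - A) |e i⟩` of positive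
trace-class operators, where `e` is an orthonormal basis of eigenvectors of `A`; it is `∞` unless
`supp A ⊆ supp B`. The diagonal values are expanded in an orthonormal basis `f` of eigenvectors
of `B`, in which all summands are nonnegative. The value is the same for all eigenbases, so the
infimum merely picks this common value. -/
def relEntropy (A B : TraceClass H) : ℝ≥0∞ :=
  if supp A ≤ supp B then
    ⨅ (u : Set H) (e : HilbertBasis u ℂ H) (a : u → ℝ) (_ : IsEigenbasis A e a)
      (v : Set H) (f : HilbertBasis v ℂ H) (b : v → ℝ) (_ : IsEigenbasis B f b),
      ∑' i, ∑' j, ENNReal.ofReal (‖⟪f j, e i⟫_ℂ‖ ^ 2 *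
        (a i * Real.log (a i) - a i * Real.log (b j) + b j - a i))
  else ∞

/-- `{π i, A i}` is a decomposition of `A` into a countable convex combination of operators from
`𝒮` (finite combinations have `π i = 0` for all but finitely many `i`). -/
structure IsDecomposition (𝒮 : Set (TraceClass H)) (A : TraceClass H)
    (π : ℕ → ℝ) (D : ℕ → TraceClass H) : Prop where
  nonneg : ∀ i, 0 ≤ π i
  hasSum_one : HasSum π 1
  mem : ∀ i, D i ∈ 𝒮
  hasSum : HasSum (fun i => π i • D i) A

/-- `Δ_k(A)`: the infimum of `∑ π i * H(A i ‖ A)` over all decompositions of `A` into countable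
convex combinations of positive operators of rank at most `k`. -/
def approxGap (k : ℕ) (A : TraceClass H) : ℝ≥0∞ :=
  ⨅ (π : ℕ → ℝ) (D : ℕ → TraceClass H) (_ : IsDecomposition (posConeRank H k) A π D),
    ∑' i, ENNReal.ofReal (π i) * relEntropy (D i) A

/-- The uniform approximation property (UA-property) of a set of positive trace-class
operators. -/
def HasUAProperty (𝒜 : Set (TraceClass H)) : Prop :=
  Tendsto (fun k : ℕ => ⨆ A ∈ 𝒜, approxGap k A) atTop (𝓝 0)

variable {K : Type*} [NormedAddCommGroup K] [InnerProductSpace ℂ K] [CompleteSpace K]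

/-- Positive trace-non-increasing linear maps `𝔗(H) → 𝔗(K)`. -/
structure IsPositiveTraceNonincreasing (Φ : TraceClass H →ₗ[ℂ] TraceClass K) : Prop where
  map_pos : ∀ A ∈ posCone H, Φ A ∈ posCone K
  trace_le : ∀ A ∈ posCone H, posTrace (Φ A).op ≤ posTrace A.op

/-- The output entropy `H_Φ = H ∘ Φ`. -/
def outputEntropy (Φ : TraceClass H →ₗ[ℂ] TraceClass K) (A : TraceClass H) : ℝ≥0∞ :=
  entropy (Φ A)

/-- The `k`-order approximator `H_Φ^k` of the output entropy: the supremum of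
`∑ π i * H_Φ(A i)` over all decompositions of `A` into countable convex combinations of positive
operators of rank at most `k`. -/
def approximator (Φ : TraceClass H →ₗ[ℂ] TraceClass K) (k : ℕ) (A : TraceClass H) : ℝ≥0∞ :=
  ⨆ (π : ℕ → ℝ) (D : ℕ → TraceClass H) (_ : IsDecomposition (posConeRank H k) A π D),
    ∑' i, ENNReal.ofReal (π i) * outputEntropy Φ (D i)

end TraceClassOperators

/-- Continuity of a `[0, ∞]`-valued function on a set, which by convention includes finiteness
on this set. -/
def FiniteContinuousOn {X : Type*} [TopologicalSpace X] (f : X → ℝ≥0∞) (S : Set X) : Prop :=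
  (∀ x ∈ S, f x < ∞) ∧ ContinuousOn f S

end

/-! All the properties come down to one estimate: there is a finite `C` with `H_Φ(|v⟩⟨v|) ≤ C ‖v‖²`
for every vector `v`. Since `H_Φ` is homogeneous of degree one, continuity at `0` on rank-one
operators, of `H_Φ` or of a function dominating it such as `H_Φ^1`, yields such a `C`
(`exists_bound_of_finiteContinuousOn`). A bound on pure states is the same estimate after
normalization. It remains to deduce everything from `C`.

The entropy is studied through `Tr A log (θ / A)` with `θ ≥ Tr A`. For fixed `θ` this is
subadditive, by operator monotonicity of the logarithm (`scaledEntropy_subadditive`), whereas the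
entropy itself is superadditive, by Jensen's inequality in an eigenbasis of the sum and the log-sum
inequality (`opEntropy_superadditive`). Summing over a spectral decomposition of `A` gives `H_Φ(A) ≤
H(A) + (C + 1) Tr A` (`outputEntropy_le_entropy_add`).

For (iii), replace `A` by `√A P √A` with `P` a finite-rank projection. By superadditivity the
remainder has entropy at most `H(A) - H(√A P √A)`, which is uniformly small near a point where `H`
is continuous, so the output entropy of the remainder is small too. The truncation is a finite sum
of rank-one operators that vary continuously with `A`; its output entropy is controlled by
`outputEntropy_sum_ket_le_add`, which rests on `|v⟩⟨v| ≤ (1 + δ)|w⟩⟨w| + (1 + δ⁻¹)|v - w⟩⟨v - w|`.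
Property (i) is a special case of (iii), because `H` vanishes on rank-one operators.

For (ii), the vectors of any decomposition of `A` into operators of rank at most `k` have the form
`√A c` with `c` running over a Bessel family. Replacing `√A` by `√B` gives part of a decomposition
of `B`, at a total cost governed by the Hilbert–Schmidt distance of `√A` and `√B`, uniformly in the
decomposition (`approximator_le_add`).

For the UA-property, `H(A) ≤ Δ_k(A) + k + 2` whenever `Tr A ≤ 1` (`entropy_le_approxGap_add`), so a
finite supremum of `Δ_k` for a single `k` produces `C`. -/

noncomputable section

/-! ### Trace and trace norm of positive operators. -/

section TraceTheory

variable {H : Type*} [NormedAddCommGroup H] [InnerProductSpace ℂ H]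

theorem HilbertBasis.tsum_enorm_inner_sq {ι : Type*} (e : HilbertBasis ι ℂ H) (x : H) :
    ∑' i, ‖⟪e i, x⟫_ℂ‖ₑ ^ 2 = ‖x‖ₑ ^ 2 := by
  have h2 : HasSum (fun i => ‖⟪e i, x⟫_ℂ‖ ^ 2) (‖x‖ ^ 2) := by
    have h := (e.hasSum_inner_mul_inner x x).mapL Complex.reCLM
    have h' : ∀ i, ⟪x, e i⟫_ℂ * ⟪e i, x⟫_ℂ = ((‖⟪e i, x⟫_ℂ‖ ^ 2 : ℝ) : ℂ) := fun i => by
      rw [← inner_conj_symm x (e i), RCLike.conj_mul]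
      norm_cast
    have h'' : ⟪x, x⟫_ℂ = ((‖x‖ ^ 2 : ℝ) : ℂ) := by
      rw [inner_self_eq_norm_sq_to_K]
      norm_cast
    simp_rw [h', h''] at h
    exact h
  have h3 := h2.tsum_eq
  have : ∀ y : ℂ, ‖y‖ₑ ^ 2 = ENNReal.ofReal (‖y‖ ^ 2) := fun y => by
    rw [ENNReal.ofReal_pow (norm_nonneg _), ofReal_norm]
  simp_rw [this]
  rw [← ENNReal.ofReal_tsum_of_nonneg (fun i => by positivity) h2.summable, h3,
    ENNReal.ofReal_pow (norm_nonneg _), ofReal_norm]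

theorem Orthonormal.sum_enorm_inner_sq_le {ι : Type*} [Fintype ι] {e : ι → H}
    (he : Orthonormal ℂ e) (x : H) : ∑ i, ‖⟪e i, x⟫_ℂ‖ₑ ^ 2 ≤ ‖x‖ₑ ^ 2 := by
  have h := he.sum_inner_products_le x (s := Finset.univ)
  have h2 := ENNReal.ofReal_le_ofReal h
  rw [ENNReal.ofReal_sum_of_nonneg (fun i _ => by positivity)] at h2
  simpa only [ENNReal.ofReal_pow (norm_nonneg _), ofReal_norm] using h2

variable [CompleteSpace H]

theorem tsum_enorm_sq_apply_eq_star {ι κ : Type*} (S : H →L[ℂ] H) (e : HilbertBasis ι ℂ H)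
    (f : HilbertBasis κ ℂ H) : ∑' i, ‖S (e i)‖ₑ ^ 2 = ∑' j, ‖(star S) (f j)‖ₑ ^ 2 := by
  simp_rw [← f.tsum_enorm_inner_sq (S _), ← e.tsum_enorm_inner_sq ((star S) _)]
  rw [ENNReal.tsum_comm]
  congr! 4 with j i
  rw [ContinuousLinearMap.star_eq_adjoint, ContinuousLinearMap.adjoint_inner_right,
    ← inner_conj_symm, RCLike.enorm_conj]

/-- Basis independence of the Hilbert–Schmidt norm: passing to the adjoint trades one basis for the
other. -/
theorem tsum_enorm_sq_apply_eq {ι κ : Type*} (S : H →L[ℂ] H) (e : HilbertBasis ι ℂ H)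
    (f : HilbertBasis κ ℂ H) : ∑' i, ‖S (e i)‖ₑ ^ 2 = ∑' j, ‖S (f j)‖ₑ ^ 2 := by
  rw [tsum_enorm_sq_apply_eq_star S e f, tsum_enorm_sq_apply_eq_star S f f]

theorem ofReal_re_inner_star_mul_self (S : H →L[ℂ] H) (x : H) :
    ENNReal.ofReal (RCLike.re ⟪x, (star S * S) x⟫_ℂ) = ‖S x‖ₑ ^ 2 := by
  rw [mul_apply_eq_comp, ContinuousLinearMap.star_eq_adjoint,
    ContinuousLinearMap.adjoint_inner_right, inner_self_eq_norm_sq,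
    ENNReal.ofReal_pow (norm_nonneg _), ofReal_norm]

theorem posTrace_star_mul_self {ι : Type*} (S : H →L[ℂ] H) (e : HilbertBasis ι ℂ H) :
    posTrace (star S * S) = ∑' i, ‖S (e i)‖ₑ ^ 2 := by
  rw [posTrace, tsum_enorm_sq_apply_eq S e (exists_hilbertBasis ℂ H).choose_spec.choose]
  simp_rw [ofReal_re_inner_star_mul_self]

theorem posTrace_star_mul_self_comm (S : H →L[ℂ] H) :
    posTrace (star S * S) = posTrace (S * star S) := by
  obtain ⟨w, e, -⟩ := exists_hilbertBasis ℂ H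
  have h := posTrace_star_mul_self (star S) e
  rw [star_star] at h
  rw [posTrace_star_mul_self S e, h, tsum_enorm_sq_apply_eq_star S e e]

theorem star_sqrt (T : H →L[ℂ] H) : star (CFC.sqrt T) = CFC.sqrt T :=
  (CFC.sqrt_nonneg T).isSelfAdjoint.star_eq

theorem star_sqrt_mul_sqrt {T : H →L[ℂ] H} (hT : 0 ≤ T) :
    star (CFC.sqrt T) * CFC.sqrt T = T := by
  rw [star_sqrt, CFC.sqrt_mul_sqrt_self T hT]

theorem ofReal_re_inner {T : H →L[ℂ] H} (hT : 0 ≤ T) (x : H) :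
    ENNReal.ofReal (RCLike.re ⟪x, T x⟫_ℂ) = ‖CFC.sqrt T x‖ₑ ^ 2 := by
  conv_lhs => rw [← star_sqrt_mul_sqrt hT]
  exact ofReal_re_inner_star_mul_self _ _

theorem re_inner_eq_norm_sqrt {T : H →L[ℂ] H} (hT : 0 ≤ T) (x : H) :
    RCLike.re ⟪x, T x⟫_ℂ = ‖CFC.sqrt T x‖ ^ 2 := by
  conv_lhs => rw [← star_sqrt_mul_sqrt hT]
  rw [mul_apply_eq_comp, ContinuousLinearMap.star_eq_adjoint,
    ContinuousLinearMap.adjoint_inner_right, inner_self_eq_norm_sq]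

theorem posTrace_eq_tsum_sqrt {ι : Type*} {T : H →L[ℂ] H} (hT : 0 ≤ T)
    (e : HilbertBasis ι ℂ H) : posTrace T = ∑' i, ‖CFC.sqrt T (e i)‖ₑ ^ 2 := by
  conv_lhs => rw [← star_sqrt_mul_sqrt hT]
  exact posTrace_star_mul_self _ _

theorem posTrace_eq_tsum {ι : Type*} {T : H →L[ℂ] H} (hT : 0 ≤ T) (e : HilbertBasis ι ℂ H) :
    posTrace T = ∑' i, ENNReal.ofReal (RCLike.re ⟪e i, T (e i)⟫_ℂ) := by
  rw [posTrace_eq_tsum_sqrt hT e]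
  simp_rw [ofReal_re_inner hT]

theorem re_inner_nonneg {T : H →L[ℂ] H} (hT : 0 ≤ T) (x : H) : 0 ≤ RCLike.re ⟪x, T x⟫_ℂ := by
  rw [re_inner_eq_norm_sqrt hT]; positivity

theorem re_inner_mono {S T : H →L[ℂ] H} (h : S ≤ T) (x : H) :
    RCLike.re ⟪x, S x⟫_ℂ ≤ RCLike.re ⟪x, T x⟫_ℂ := by
  have := re_inner_nonneg (sub_nonneg.2 h) x
  rw [_root_.sub_apply, inner_sub_right, map_sub] at this
  linarith

theorem posTrace_mono {S T : H →L[ℂ] H} (h : S ≤ T) : posTrace S ≤ posTrace T :=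
  ENNReal.tsum_le_tsum fun _ => ENNReal.ofReal_le_ofReal (re_inner_mono h _)

theorem posTrace_add {S T : H →L[ℂ] H} (hS : 0 ≤ S) (hT : 0 ≤ T) :
    posTrace (S + T) = posTrace S + posTrace T := by
  rw [posTrace, posTrace, posTrace, ← ENNReal.tsum_add]
  congr! 2 with i
  rw [_root_.add_apply, inner_add_right, map_add,
    ENNReal.ofReal_add (re_inner_nonneg hS _) (re_inner_nonneg hT _)]

theorem posTrace_zero : posTrace (0 : H →L[ℂ] H) = 0 := by simp [posTrace]

theorem posTrace_smul {c : ℝ} (hc : 0 ≤ c) (T : H →L[ℂ] H) :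
    posTrace (c • T) = ENNReal.ofReal c * posTrace T := by
  rw [posTrace, posTrace, ← ENNReal.tsum_mul_left]
  congr! 2 with i
  rw [_root_.smul_apply, inner_smul_right_eq_smul, RCLike.smul_re, ENNReal.ofReal_mul hc]

theorem posTrace_sum {ι : Type*} (s : Finset ι) {T : ι → H →L[ℂ] H} (hT : ∀ i ∈ s, 0 ≤ T i) :
    posTrace (∑ i ∈ s, T i) = ∑ i ∈ s, posTrace (T i) := by
  classical
  induction s using Finset.induction_on with
  | empty => simp [posTrace_zero]
  | insert a s ha ih =>
    rw [Finset.sum_insert ha, Finset.sum_insert ha, posTrace_add (hT a (by simp))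
      (Finset.sum_nonneg fun i hi => hT i (by simp [hi])), ih fun i hi => hT i (by simp [hi])]

theorem hasSum_re_inner {ι : Type*} {T : ι → H →L[ℂ] H} {S : H →L[ℂ] H} (h : HasSum T S) (x : H) :
    HasSum (fun i => RCLike.re ⟪x, T i x⟫_ℂ) (RCLike.re ⟪x, S x⟫_ℂ) := by
  have h1 := h.mapL (ContinuousLinearMap.apply ℂ H x)
  have h2 := h1.mapL (innerSL ℂ x)
  exact h2.mapL (RCLike.reCLM (K := ℂ))

theorem posTrace_hasSum {ι : Type*} {T : ι → H →L[ℂ] H} {S : H →L[ℂ] H} (hT : ∀ i, 0 ≤ T i)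
    (h : HasSum T S) : posTrace S = ∑' i, posTrace (T i) := by
  simp_rw [posTrace]
  rw [ENNReal.tsum_comm]
  congr! 2 with j
  have h2 := hasSum_re_inner h ((exists_hilbertBasis ℂ H).choose_spec.choose j)
  rw [← h2.tsum_eq, ENNReal.ofReal_tsum_of_nonneg (fun i => re_inner_nonneg (hT i) _) h2.summable]

theorem tendsto_re_inner {α : Type*} {l : Filter α} {T : α → H →L[ℂ] H} {S : H →L[ℂ] H}
    (h : Tendsto T l (𝓝 S)) (x : H) :
    Tendsto (fun i => RCLike.re ⟪x, T i x⟫_ℂ) l (𝓝 (RCLike.re ⟪x, S x⟫_ℂ)) := by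
  have h1 := ((ContinuousLinearMap.apply ℂ H x).continuous.tendsto S).comp h
  exact (RCLike.continuous_re.tendsto _).comp (((innerSL ℂ x).continuous.tendsto _).comp h1)

/-- Lower semicontinuity of the trace: each finite sum of diagonal values converges and stays below
`M`. -/
theorem posTrace_le_of_tendsto {α : Type*} {l : Filter α} [l.NeBot] {T : α → H →L[ℂ] H}
    {S : H →L[ℂ] H} (h : Tendsto T l (𝓝 S)) {M : ℝ≥0∞} (hM : ∀ᶠ i in l, posTrace (T i) ≤ M) :
    posTrace S ≤ M := by
  rw [posTrace, ENNReal.tsum_eq_iSup_sum]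
  refine iSup_le fun s => ?_
  have h2 : Tendsto (fun a => ∑ i ∈ s, ENNReal.ofReal (RCLike.re
      ⟪(exists_hilbertBasis ℂ H).choose_spec.choose i,
        T a ((exists_hilbertBasis ℂ H).choose_spec.choose i)⟫_ℂ)) l (𝓝 _) :=
    tendsto_finsetSum s fun i _ => ENNReal.tendsto_ofReal (tendsto_re_inner h _)
  refine le_of_tendsto h2 (hM.mono fun a ha => le_trans ?_ ha)
  exact ENNReal.sum_le_tsum s

theorem enorm_inner_le_of_nonneg {T : H →L[ℂ] H} (hT : 0 ≤ T) (x y : H) :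
    ‖⟪y, T x⟫_ℂ‖ₑ ≤ ‖CFC.sqrt T y‖ₑ * ‖CFC.sqrt T x‖ₑ := by
  conv_lhs => rw [← star_sqrt_mul_sqrt hT]
  rw [mul_apply_eq_comp, ContinuousLinearMap.star_eq_adjoint,
    ContinuousLinearMap.adjoint_inner_right]
  rw [← ofReal_norm, ← ofReal_norm, ← ofReal_norm, ← ENNReal.ofReal_mul (norm_nonneg _)]
  exact ENNReal.ofReal_le_ofReal (norm_inner_le_norm _ _)

theorem sum_enorm_sq_apply_le {ι κ : Type*} [Fintype κ] (S : H →L[ℂ] H) {e : κ → H}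
    (he : Orthonormal ℂ e) (f : HilbertBasis ι ℂ H) :
    ∑ i, ‖S (e i)‖ₑ ^ 2 ≤ ∑' j, ‖(star S) (f j)‖ₑ ^ 2 := by
  simp_rw [← f.tsum_enorm_inner_sq (S _)]
  rw [← Summable.tsum_finsetSum fun i _ => ENNReal.summable]
  refine ENNReal.tsum_le_tsum fun j => ?_
  refine le_trans (le_of_eq ?_) (he.sum_enorm_inner_sq_le _)
  congr! 2 with i
  rw [ContinuousLinearMap.star_eq_adjoint, ContinuousLinearMap.adjoint_inner_right,
    ← inner_conj_symm, RCLike.enorm_conj]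

theorem sum_enorm_sq_sqrt_le {κ : Type*} [Fintype κ] {T : H →L[ℂ] H} (hT : 0 ≤ T) {e : κ → H}
    (he : Orthonormal ℂ e) : ∑ i, ‖CFC.sqrt T (e i)‖ₑ ^ 2 ≤ posTrace T := by
  obtain ⟨w, f, -⟩ := exists_hilbertBasis ℂ H
  have h := sum_enorm_sq_apply_le (CFC.sqrt T) he f
  rwa [star_sqrt, ← posTrace_eq_tsum_sqrt hT f] at h

theorem ENNReal.mul_le_half_sq_add (a b : ℝ≥0∞) : 2 * (a * b) ≤ a ^ 2 + b ^ 2 := by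
  rcases eq_or_ne a ∞ with rfl | ha
  · simp
  rcases eq_or_ne b ∞ with rfl | hb
  · simp
  lift a to NNReal using ha
  lift b to NNReal using hb
  norm_cast
  rw [← mul_assoc]
  exact two_mul_le_add_sq a b

/-- The bound `|⟨f, T e⟩| ≤ ‖√T f‖ ‖√T e‖` and the arithmetic-geometric mean inequality reduce the
upper estimate to Bessel sums of `√T`. The lower estimate takes both families equal to part of a
basis. -/
theorem traceENorm_eq_posTrace {T : H →L[ℂ] H} (hT : 0 ≤ T) : traceENorm T = posTrace T := by
  apply le_antisymm
  · refine traceENorm_le fun n e f he hf => ?_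
    have h2 : 2 * ∑ i, ‖⟪f i, T (e i)⟫_ℂ‖ₑ ≤ 2 * posTrace T := by
      calc 2 * ∑ i, ‖⟪f i, T (e i)⟫_ℂ‖ₑ
          ≤ ∑ i, (‖CFC.sqrt T (f i)‖ₑ ^ 2 + ‖CFC.sqrt T (e i)‖ₑ ^ 2) := by
            rw [Finset.mul_sum]
            refine Finset.sum_le_sum fun i _ => ?_
            exact (mul_le_mul_right (enorm_inner_le_of_nonneg hT _ _) _).trans
              (ENNReal.mul_le_half_sq_add _ _)
        _ ≤ posTrace T + posTrace T := by
            rw [Finset.sum_add_distrib]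
            exact add_le_add (sum_enorm_sq_sqrt_le hT hf) (sum_enorm_sq_sqrt_le hT he)
        _ = 2 * posTrace T := (two_mul _).symm
    exact (ENNReal.mul_le_mul_iff_right (by simp) (by simp)).1 h2
  · obtain ⟨w, e, -⟩ := exists_hilbertBasis ℂ H
    rw [posTrace_eq_tsum hT e, ENNReal.tsum_eq_iSup_sum]
    refine iSup_le fun s => ?_
    have hs : Orthonormal ℂ (fun i : Fin s.card => e (s.equivFin.symm i)) :=
      e.orthonormal.comp _ (Subtype.val_injective.comp s.equivFin.symm.injective)
    refine le_trans ?_ (le_traceENorm T hs hs)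
    rw [← Finset.sum_coe_sort, ← s.equivFin.symm.sum_comp]
    refine Finset.sum_le_sum fun i _ => ?_
    rw [← ofReal_norm]
    exact ENNReal.ofReal_le_ofReal (RCLike.re_le_norm _)

theorem enorm_le_traceENorm (T : H →L[ℂ] H) : ‖T‖ₑ ≤ traceENorm T := by
  by_cases hfin : traceENorm T = ∞
  · simp [hfin]
  have key : ∀ y : H, y ≠ 0 → Orthonormal ℂ (fun _ : Fin 1 => ((‖y‖ : ℂ)⁻¹) • y) := by
    intro y hy
    refine ⟨fun _ => ?_, fun i j hij => absurd (Subsingleton.elim i j) hij⟩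
    rw [norm_smul, norm_inv, Complex.norm_real, norm_norm,
      inv_mul_cancel₀ (norm_ne_zero_iff.2 hy)]
  rw [← ofReal_norm]
  refine ENNReal.ofReal_le_of_le_toReal (T.opNorm_le_bound ENNReal.toReal_nonneg fun x => ?_)
  by_cases hx : x = 0
  · simp [hx]
  by_cases hTx : T x = 0
  · rw [hTx, norm_zero]; positivity
  have h1 := ENNReal.toReal_mono hfin (le_traceENorm T (key x hx) (key (T x) hTx))
  have hx' := norm_pos_iff.2 hx
  have hTx' := norm_pos_iff.2 hTx
  simp only [Finset.univ_unique, Finset.sum_singleton, map_smul, inner_smul_left,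
    inner_smul_right, inner_self_eq_norm_sq_to_K, toReal_enorm, norm_mul, norm_pow, norm_inv,
    RCLike.norm_conj, Complex.norm_real, norm_norm, RCLike.norm_ofReal, abs_norm] at h1
  rw [show ‖x‖⁻¹ * (‖T x‖⁻¹ * ‖T x‖ ^ 2) = ‖T x‖ / ‖x‖ by field_simp] at h1
  rwa [div_le_iff₀ hx'] at h1

theorem enorm_le_posTrace {T : H →L[ℂ] H} (hT : 0 ≤ T) : ‖T‖ₑ ≤ posTrace T :=
  (enorm_le_traceENorm T).trans (traceENorm_eq_posTrace hT).le

theorem norm_le_posTrace {T : H →L[ℂ] H} (hT : 0 ≤ T) (hfin : posTrace T ≠ ∞) :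
    ‖T‖ ≤ (posTrace T).toReal := by
  have := ENNReal.toReal_mono hfin (enorm_le_posTrace hT)
  simpa using this

theorem eq_zero_of_posTrace_eq_zero {T : H →L[ℂ] H} (hT : 0 ≤ T) (h : posTrace T = 0) :
    T = 0 := by
  have := enorm_le_posTrace hT
  simpa [h] using this

end TraceTheory

/-! ### Scalar inequalities for `x log (θ / x)`. -/

section ScaledEta

open Real

/-- The function `x ↦ x log (θ / x)`, which is nonnegative on `[0, θ]`. -/
def scaledEta (θ x : ℝ) : ℝ := x * log θ + negMulLog x

theorem continuous_scaledEta (θ : ℝ) : Continuous (scaledEta θ) := by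
  unfold scaledEta; fun_prop

theorem scaledEta_zero (θ : ℝ) : scaledEta θ 0 = 0 := by simp [scaledEta]

theorem scaledEta_self (θ : ℝ) : scaledEta θ θ = 0 := by simp [scaledEta, negMulLog]

theorem scaledEta_eq (θ x : ℝ) : scaledEta θ x = x * (log θ - log x) := by
  simp only [scaledEta, negMulLog]; ring

theorem scaledEta_nonneg {θ x : ℝ} (hx : 0 ≤ x) (h : x ≤ θ) : 0 ≤ scaledEta θ x := by
  rcases hx.eq_or_lt with rfl | hx
  · simp [scaledEta_zero]
  · rw [scaledEta_eq]
    exact mul_nonneg hx.le (sub_nonneg.2 (log_le_log hx h))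

theorem scaledEta_smul {c : ℝ} (hc : 0 < c) {θ x : ℝ} (hx : 0 ≤ x) (h : x ≤ θ) :
    scaledEta (c * θ) (c * x) = c * scaledEta θ x := by
  rcases hx.eq_or_lt with rfl | hx
  · simp [scaledEta_zero]
  · rw [scaledEta_eq, scaledEta_eq, log_mul hc.ne' (hx.trans_le h).ne', log_mul hc.ne' hx.ne']
    ring

theorem mul_log_div_le {x y : ℝ} (hx : 0 ≤ x) (hy : 0 < y) : x * (log y - log x) ≤ y - x := by
  rcases hx.eq_or_lt with rfl | hx
  · simp [hy.le]
  · have h := log_le_sub_one_of_pos (div_pos hy hx)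
    rw [log_div hy.ne' hx.ne'] at h
    calc x * (log y - log x) ≤ x * (y / x - 1) := by gcongr
      _ = y - x := by field_simp

theorem scaledEta_le_tangent (θ : ℝ) {x y : ℝ} (hx : 0 ≤ x) (hy : 0 < y) :
    scaledEta θ x ≤ scaledEta θ y + (log θ - log y - 1) * (x - y) := by
  have h := mul_log_div_le hx hy
  rw [scaledEta_eq, scaledEta_eq]
  nlinarith

/-- The derivative `log θ - log x - 1` is nonnegative exactly up to `θ / e`, which explains the
factor `exp 1`. -/
theorem scaledEta_mono {θ x y : ℝ} (hx : 0 ≤ x) (hxy : x ≤ y) (h : exp 1 * y ≤ θ) :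
    scaledEta θ x ≤ scaledEta θ y := by
  rcases (hx.trans hxy).eq_or_lt with rfl | hy
  · rw [le_antisymm hxy hx]
  · have h1 := scaledEta_le_tangent θ hx hy
    have h2 : log y + 1 ≤ log θ := by
      rw [← log_exp 1, ← log_mul hy.ne' (exp_pos _).ne', mul_comm]
      exact log_le_log (by positivity) h
    nlinarith

/-- This is the log-sum inequality. The main case adds `x log (z / x) ≤ z - x` at `z = s(x+y)/(s+t)`
and its analogue for `y`; the right-hand sides cancel. -/
theorem scaledEta_superadditive {x y s t : ℝ} (hx : 0 ≤ x) (hy : 0 ≤ y) (hxs : x ≤ s)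
    (hyt : y ≤ t) : scaledEta s x + scaledEta t y ≤ scaledEta (s + t) (x + y) := by
  rcases hx.eq_or_lt with rfl | hx
  · rcases hy.eq_or_lt with rfl | hy
    · simp [scaledEta_zero]
    · rw [scaledEta_zero, zero_add, zero_add, scaledEta_eq, scaledEta_eq]
      have := log_le_log (hy.trans_le hyt) (show t ≤ s + t by linarith)
      gcongr
  rcases hy.eq_or_lt with rfl | hy
  · rw [scaledEta_zero, add_zero, add_zero, scaledEta_eq, scaledEta_eq]
    have := log_le_log (hx.trans_le hxs) (show s ≤ s + t by linarith)
    gcongr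
  have hs := hx.trans_le hxs
  have ht := hy.trans_le hyt
  have h1 := mul_log_div_le hx.le (y := s * (x + y) / (s + t)) (by positivity)
  have h2 := mul_log_div_le hy.le (y := t * (x + y) / (s + t)) (by positivity)
  rw [log_div (by positivity) (by positivity), log_mul (by positivity) (by positivity)] at h1 h2
  have h3 : s * (x + y) / (s + t) + t * (x + y) / (s + t) = x + y := by field_simp
  rw [scaledEta_eq, scaledEta_eq, scaledEta_eq]
  nlinarith

/-- The left side is the binary entropy of `x` and `y`. The free parameter `s` gives a bound linear
in `x + y` and `y`: choosing `s` small first and then `y` small makes it small, with no modulus of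
continuity of `η` involved. -/
theorem scaledEta_add_le {x y s : ℝ} (hx : 0 ≤ x) (hy : 0 ≤ y) (hs : 0 < s) (hs1 : s ≤ 1) :
    scaledEta (x + y) x + scaledEta (x + y) y ≤ s * (x + y) + log (1 / s) * y := by
  have hl : 0 ≤ log (1 / s) := log_nonneg (by rw [le_div_iff₀ hs]; linarith)
  rcases (add_nonneg hx hy).eq_or_lt with h | h
  · have hx0 : x = 0 := by linarith
    have hy0 : y = 0 := by linarith
    simp [hx0, hy0, scaledEta_zero]
  have h1 := mul_log_div_le hx h
  have h2 := mul_log_div_le hy (y := s * (x + y)) (by positivity)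
  rw [log_mul hs.ne' h.ne'] at h2
  rw [scaledEta_eq, scaledEta_eq, one_div, log_inv]
  nlinarith

/-- The regularization `x ↦ x log ((θ + ε) / (x + ε))` of `scaledEta θ`. -/
theorem mul_log_add_le {θ ε x : ℝ} (hε : 0 < ε) (hx : 0 ≤ x) (h : x ≤ θ) :
    x * (log (θ + ε) - log (x + ε)) ≤ scaledEta θ x := by
  rcases hx.eq_or_lt with rfl | hx
  · simp [scaledEta_zero]
  rw [scaledEta_eq, ← log_div (by linarith) (by linarith), ← log_div (by linarith) hx.ne']
  have : (θ + ε) / (x + ε) ≤ θ / x := by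
    rw [div_le_div_iff₀ (by linarith) hx]
    nlinarith
  have h3 : log ((θ + ε) / (x + ε)) ≤ log (θ / x) :=
    log_le_log (div_pos (by linarith) (by linarith)) this
  gcongr

/-- Because `x log ((x + ε) / x) ≤ ε`, the regularization error is uniform in `x`. -/
theorem scaledEta_le_mul_log_add {θ ε x : ℝ} (hε : 0 < ε) (hx : 0 ≤ x) (h : x ≤ θ) :
    scaledEta θ x ≤ x * (log (θ + ε) - log (x + ε)) + ε := by
  rcases hx.eq_or_lt with rfl | hx
  · simp [scaledEta_zero, hε.le]
  have h1 := mul_log_div_le hx.le (y := x + ε) (by linarith)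
  have h2 : log θ ≤ log (θ + ε) := log_le_log (by linarith) (by linarith)
  rw [scaledEta_eq]
  nlinarith

end ScaledEta

/-! ### Functional calculus on eigenvectors and Jensen's inequality. -/

section FunctionalCalculus

variable {H : Type*} [NormedAddCommGroup H] [InnerProductSpace ℂ H] [CompleteSpace H]

theorem spectrum_subset_Icc_norm {T : H →L[ℂ] H} (hT : 0 ≤ T) :
    spectrum ℝ T ⊆ Set.Icc 0 ‖T‖ := by
  intro x hx
  have h0 := spectrum_nonneg_of_nonneg hT hx
  refine ⟨h0, ?_⟩
  have h1 := spectrum.subset_closedBall_norm_mul (𝕜 := ℝ) T hx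
  rw [mem_closedBall_zero_iff, Real.norm_of_nonneg h0] at h1
  exact h1.trans (mul_le_of_le_one_right (norm_nonneg _) ContinuousLinearMap.norm_id_le)

theorem spectrum_subset_Icc {T : H →L[ℂ] H} (hT : 0 ≤ T) {θ : ℝ} (hθ : 0 ≤ θ)
    (h : posTrace T ≤ ENNReal.ofReal θ) : spectrum ℝ T ⊆ Set.Icc 0 θ := by
  refine (spectrum_subset_Icc_norm hT).trans (Set.Icc_subset_Icc_right ?_)
  refine (norm_le_posTrace hT (h.trans_lt ENNReal.ofReal_lt_top).ne).trans ?_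
  exact ENNReal.toReal_le_of_le_ofReal hθ h

theorem aeval_apply_of_eigenvector {T : H →L[ℂ] H} {f : H} {b : ℝ} (h : T f = (b : ℂ) • f)
    (p : Polynomial ℝ) : Polynomial.aeval T p f = ((p.eval b : ℝ) : ℂ) • f := by
  induction p using Polynomial.induction_on' with
  | add p q hp hq =>
    rw [map_add, _root_.add_apply, hp, hq, Polynomial.eval_add, Complex.ofReal_add, add_smul]
  | monomial n a =>
    rw [Polynomial.aeval_monomial, Polynomial.eval_monomial]
    have hn : (T ^ n) f = ((b ^ n : ℝ) : ℂ) • f := by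
      induction n with
      | zero => simp
      | succ n ih =>
        rw [pow_succ, mul_apply_eq_comp, h, map_smul, ih, smul_smul, pow_succ,
          mul_comm (b ^ n), Complex.ofReal_mul]
    rw [mul_apply_eq_comp, hn, Algebra.algebraMap_eq_smul_one, _root_.smul_apply,
      one_apply_eq_self, Complex.ofReal_mul, mul_smul]
    rfl

/-- Functional calculus acts on eigenvectors by evaluation at the eigenvalue. -/
theorem cfc_apply_of_eigenvector {T : H →L[ℂ] H} (hT : IsSelfAdjoint T) {f : H} {b : ℝ}
    (h : T f = (b : ℂ) • f) {φ : ℝ → ℝ} (hφ : Continuous φ) :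
    cfc φ T f = (φ b : ℂ) • f := by
  have key : ∀ ε > 0, ‖cfc φ T f - (φ b : ℂ) • f‖ ≤ 2 * ε * ‖f‖ := by
    intro ε hε
    -- The interval `[-R, R]` contains both the spectrum and `b`, so one polynomial approximates `φ`
    -- on the operator side and at the eigenvalue.
    set R := max ‖T‖ |b|
    have hR : 0 ≤ R := (norm_nonneg T).trans (le_max_left _ _)
    obtain ⟨p, hp⟩ := exists_polynomial_near_of_continuousOn (-R) R φ hφ.continuousOn ε hε
    have h1 : ‖cfc φ T - Polynomial.aeval T p‖ ≤ ε := by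
      rw [← cfc_polynomial p T hT, ← cfc_sub φ p.eval T hφ.continuousOn (by fun_prop)]
      refine norm_cfc_le hε.le fun x hx => ?_
      have hx' := spectrum.subset_closedBall_norm_mul (𝕜 := ℝ) T hx
      rw [mem_closedBall_zero_iff, Real.norm_eq_abs] at hx'
      have hx2 : |x| ≤ R := (hx'.trans (mul_le_of_le_one_right (norm_nonneg _)
        ContinuousLinearMap.norm_id_le)).trans (le_max_left _ _)
      rw [Real.norm_eq_abs, abs_sub_comm]
      exact (hp x (abs_le.1 hx2)).le
    have h2 := (hp b (abs_le.1 (le_max_right _ _))).le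
    calc ‖cfc φ T f - (φ b : ℂ) • f‖
        = ‖(cfc φ T - Polynomial.aeval T p) f + ((p.eval b - φ b : ℝ) : ℂ) • f‖ := by
          rw [_root_.sub_apply, aeval_apply_of_eigenvector h p, Complex.ofReal_sub, sub_smul]
          congr 1; abel
      _ ≤ ε * ‖f‖ + ε * ‖f‖ := by
          refine (norm_add_le _ _).trans (add_le_add ?_ ?_)
          · exact (ContinuousLinearMap.le_opNorm _ _).trans (by gcongr)
          · rw [norm_smul, Complex.norm_real, Real.norm_eq_abs]; gcongr
      _ = 2 * ε * ‖f‖ := by ring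
  rw [← sub_eq_zero, ← norm_le_zero_iff]
  refine le_of_forall_pos_le_add fun ε hε => ?_
  refine (key (ε / (2 * (‖f‖ + 1))) (by positivity)).trans ?_
  rw [zero_add]
  have : ‖f‖ / (‖f‖ + 1) ≤ 1 := by rw [div_le_one (by positivity)]; linarith
  calc 2 * (ε / (2 * (‖f‖ + 1))) * ‖f‖ = ε * (‖f‖ / (‖f‖ + 1)) := by field_simp
    _ ≤ ε := mul_le_of_le_one_right hε.le this

theorem re_inner_cfc_of_eigenvector {T : H →L[ℂ] H} (hT : IsSelfAdjoint T) {f : H}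
    (hf : ‖f‖ = 1) {b : ℝ} (h : T f = (b : ℂ) • f) {φ : ℝ → ℝ} (hφ : Continuous φ) :
    RCLike.re ⟪f, cfc φ T f⟫_ℂ = φ b := by
  rw [cfc_apply_of_eigenvector hT h hφ, inner_smul_right, inner_self_eq_norm_sq_to_K, hf]
  simp

/-- Jensen's inequality for the diagonal values of `scaledEta θ (T)`. -/
theorem re_inner_cfc_scaledEta_le {T : H →L[ℂ] H} (hT : 0 ≤ T) {f : H} (hf : ‖f‖ = 1) (θ : ℝ) :
    RCLike.re ⟪f, cfc (scaledEta θ) T f⟫_ℂ ≤ scaledEta θ (RCLike.re ⟪f, T f⟫_ℂ) := by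
  -- There is no finite tangent slope at `0`; but a zero diagonal value puts `f` in the kernel of
  -- `T`, where the functional calculus is explicit.
  rcases (re_inner_nonneg hT f).eq_or_lt with h0 | h0
  · have hs : CFC.sqrt T f = 0 := by
      rw [re_inner_eq_norm_sqrt hT] at h0
      simpa using h0.symm
    have hTf : T f = ((0 : ℝ) : ℂ) • f := by
      rw [← star_sqrt_mul_sqrt hT, mul_apply_eq_comp, hs]; simp
    rw [re_inner_cfc_of_eigenvector hT.isSelfAdjoint hf hTf (continuous_scaledEta θ), ← h0]
  · set y := RCLike.re ⟪f, T f⟫_ℂ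
    set d := Real.log θ - Real.log y - 1
    have hle : cfc (scaledEta θ) T ≤ cfc (fun x => (scaledEta θ y - d * y) + d * x) T := by
      refine cfc_mono (fun x hx => ?_) (continuous_scaledEta θ).continuousOn (by fun_prop)
      have := scaledEta_le_tangent θ (spectrum_nonneg_of_nonneg hT hx) h0
      simp only [d]; linarith
    refine (re_inner_mono hle f).trans (le_of_eq ?_)
    rw [cfc_const_add _ _ _ (by fun_prop) hT.isSelfAdjoint, cfc_const_mul_id _ _ hT.isSelfAdjoint,
      Algebra.algebraMap_eq_smul_one, _root_.add_apply, _root_.smul_apply, _root_.smul_apply,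
      one_apply_eq_self, inner_add_right, inner_smul_right_eq_smul, inner_smul_right_eq_smul,
      map_add, RCLike.smul_re, RCLike.smul_re, inner_self_eq_norm_sq, hf]
    simp only [y]
    ring

end FunctionalCalculus

/-! ### Rank-one operators and series of them. -/

section KetBra

variable {H : Type*} [NormedAddCommGroup H] [InnerProductSpace ℂ H]

/-- The rank-one operator `|v⟩⟨v|`. -/
def ketBra (v : H) : H →L[ℂ] H := InnerProductSpace.rankOne ℂ v v

theorem ketBra_apply (v x : H) : ketBra v x = ⟪v, x⟫_ℂ • v := rfl

theorem re_inner_ketBra (v x : H) : RCLike.re ⟪x, ketBra v x⟫_ℂ = ‖⟪v, x⟫_ℂ‖ ^ 2 := by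
  rw [ketBra_apply, inner_smul_right, ← inner_conj_symm x v, RCLike.mul_conj]
  norm_cast

theorem ketBra_nonneg (v : H) : 0 ≤ ketBra v := by
  rw [ContinuousLinearMap.nonneg_iff_isPositive]
  exact InnerProductSpace.isPositive_rankOne_self v

theorem ketBra_zero : ketBra (0 : H) = 0 := by
  ext x; simp [ketBra_apply]

theorem ketBra_smul (c : ℂ) (v : H) : ketBra (c • v) = (‖c‖ ^ 2 : ℝ) • ketBra v := by
  ext x
  rw [_root_.smul_apply, ketBra_apply, ketBra_apply, inner_smul_left, smul_smul,
    mul_right_comm, RCLike.conj_mul, ← smul_smul]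
  norm_cast

variable [CompleteSpace H]

theorem le_of_re_inner_le {S T : H →L[ℂ] H} (hS : IsSelfAdjoint S) (hT : IsSelfAdjoint T)
    (h : ∀ x, RCLike.re ⟪x, S x⟫_ℂ ≤ RCLike.re ⟪x, T x⟫_ℂ) : S ≤ T := by
  rw [ContinuousLinearMap.le_def, ContinuousLinearMap.isPositive_def']
  refine ⟨hT.sub hS, fun x => ?_⟩
  rw [ContinuousLinearMap.reApplyInnerSelf_apply, ← inner_conj_symm, RCLike.conj_re,
    _root_.sub_apply, inner_sub_right, map_sub]
  linarith [h x]

theorem real_smul_nonneg {c : ℝ} (hc : 0 ≤ c) {T : H →L[ℂ] H} (hT : 0 ≤ T) : 0 ≤ c • T := by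
  rw [ContinuousLinearMap.nonneg_iff_isPositive] at hT ⊢
  have h := hT.smul_of_nonneg (c := (c : ℂ)) (by exact_mod_cast hc)
  rwa [Complex.coe_smul] at h

theorem posTrace_ketBra (v : H) : posTrace (ketBra v) = ‖v‖ₑ ^ 2 := by
  obtain ⟨w, e, -⟩ := exists_hilbertBasis ℂ H
  rw [posTrace_eq_tsum (ketBra_nonneg v) e, ← e.tsum_enorm_inner_sq]
  congr! 2 with i
  rw [re_inner_ketBra, ENNReal.ofReal_pow (norm_nonneg _), ofReal_norm, ← inner_conj_symm,
    RCLike.enorm_conj]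

theorem posTrace_sum_ketBra {ι : Type*} (s : Finset ι) (v : ι → H) :
    posTrace (∑ i ∈ s, ketBra (v i)) = ∑ i ∈ s, ‖v i‖ₑ ^ 2 := by
  rw [posTrace_sum s fun i _ => ketBra_nonneg _]
  simp_rw [posTrace_ketBra]

theorem sum_ketBra_nonneg {ι : Type*} (s : Finset ι) (v : ι → H) :
    0 ≤ ∑ i ∈ s, ketBra (v i) := Finset.sum_nonneg fun _ _ => ketBra_nonneg _

theorem re_inner_sum_ketBra {ι : Type*} (s : Finset ι) (v : ι → H) (x : H) :
    RCLike.re ⟪x, (∑ i ∈ s, ketBra (v i)) x⟫_ℂ = ∑ i ∈ s, ‖⟪v i, x⟫_ℂ‖ ^ 2 := by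
  rw [_root_.sum_apply, inner_sum, map_sum]
  simp_rw [re_inner_ketBra]

theorem norm_add_sq_le_weighted {E : Type*} [SeminormedAddCommGroup E] {δ : ℝ} (hδ : 0 < δ)
    (a b : E) : ‖a + b‖ ^ 2 ≤ (1 + δ) * ‖a‖ ^ 2 + (1 + δ⁻¹) * ‖b‖ ^ 2 := by
  have h1 : ‖a + b‖ ^ 2 ≤ (‖a‖ + ‖b‖) ^ 2 := by gcongr; exact norm_add_le a b
  have h2 : 0 ≤ δ⁻¹ * (δ * ‖a‖ - ‖b‖) ^ 2 := by positivity
  have h3 : δ⁻¹ * (δ * ‖a‖ - ‖b‖) ^ 2 = δ * ‖a‖ ^ 2 - 2 * (‖a‖ * ‖b‖) + δ⁻¹ * ‖b‖ ^ 2 := by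
    field_simp
    ring
  nlinarith

/-- Young's inequality for the quadratic forms. The coefficient of `ketBra v` tends to `1` with `δ`,
at the price of a large coefficient on the perturbation `w`. -/
theorem ketBra_add_le {δ : ℝ} (hδ : 0 < δ) (v w : H) :
    ketBra (v + w) ≤ (1 + δ) • ketBra v + (1 + δ⁻¹) • ketBra w := by
  refine le_of_re_inner_le (ketBra_nonneg _).isSelfAdjoint ?_ fun x => ?_
  · have h1 : 0 ≤ (1 + δ) • ketBra v := real_smul_nonneg (by positivity) (ketBra_nonneg v)
    have h2 : 0 ≤ (1 + δ⁻¹) • ketBra w := real_smul_nonneg (by positivity) (ketBra_nonneg w)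
    exact h1.isSelfAdjoint.add h2.isSelfAdjoint
  · rw [_root_.add_apply, _root_.smul_apply, _root_.smul_apply, inner_add_right,
      inner_smul_right_eq_smul, inner_smul_right_eq_smul, map_add, RCLike.smul_re, RCLike.smul_re,
      re_inner_ketBra, re_inner_ketBra, re_inner_ketBra, inner_add_left]
    exact norm_add_sq_le_weighted hδ _ _

/-- As a quadratic form at `x`, this is Bessel's inequality for the vector `√T x`. -/
theorem sum_ketBra_sqrt_le {ι : Type*} {T : H →L[ℂ] H} (hT : 0 ≤ T) {e : ι → H}
    (he : Orthonormal ℂ e) (s : Finset ι) : ∑ i ∈ s, ketBra (CFC.sqrt T (e i)) ≤ T := by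
  refine le_of_re_inner_le (sum_ketBra_nonneg _ _).isSelfAdjoint hT.isSelfAdjoint fun x => ?_
  rw [re_inner_sum_ketBra, re_inner_eq_norm_sqrt hT]
  refine le_trans (le_of_eq ?_) (he.sum_inner_products_le (CFC.sqrt T x) (s := s))
  refine Finset.sum_congr rfl fun i _ => ?_
  conv_rhs => rw [← star_sqrt T, ContinuousLinearMap.star_eq_adjoint,
    ContinuousLinearMap.adjoint_inner_right]

/-- If a series of positive operators is dominated by `T` and has the same trace, then its
remainders tend to zero in trace. -/
theorem tendsto_posTrace_sub_sum {ι : Type*} {T : H →L[ℂ] H} (hfin : posTrace T ≠ ∞)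
    {B : ι → H →L[ℂ] H} (hB : ∀ i, 0 ≤ B i) (hle : ∀ s : Finset ι, ∑ i ∈ s, B i ≤ T)
    (htr : posTrace T = ∑' i, posTrace (B i)) :
    Tendsto (fun s : Finset ι => posTrace (T - ∑ i ∈ s, B i)) atTop (𝓝 0) := by
  have hs : ∀ s : Finset ι, posTrace (T - ∑ i ∈ s, B i) = posTrace T - ∑ i ∈ s, posTrace (B i) := by
    intro s
    have h1 := posTrace_add (sub_nonneg.2 (hle s)) (Finset.sum_nonneg fun i _ => hB i : 0 ≤ ∑ i ∈ s, B i)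
    rw [sub_add_cancel, posTrace_sum s fun i _ => hB i] at h1
    rw [h1, ENNReal.add_sub_cancel_right]
    rw [h1] at hfin
    exact (ENNReal.add_ne_top.1 hfin).2
  simp_rw [hs]
  have h2 : Tendsto (fun s : Finset ι => ∑ i ∈ s, posTrace (B i)) atTop (𝓝 (posTrace T)) := by
    rw [htr]; exact ENNReal.summable.hasSum
  have h3 := ENNReal.Tendsto.sub (tendsto_const_nhds (x := posTrace T)) h2 (Or.inl hfin)
  rwa [tsub_self] at h3

theorem hasSum_of_posTrace {ι : Type*} {T : H →L[ℂ] H} (hfin : posTrace T ≠ ∞)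
    {B : ι → H →L[ℂ] H} (hB : ∀ i, 0 ≤ B i) (hle : ∀ s : Finset ι, ∑ i ∈ s, B i ≤ T)
    (htr : posTrace T = ∑' i, posTrace (B i)) : HasSum B T := by
  have h := tendsto_posTrace_sub_sum hfin hB hle htr
  rw [HasSum, tendsto_iff_edist_tendsto_0]
  refine tendsto_of_tendsto_of_tendsto_of_le_of_le tendsto_const_nhds h (fun _ => bot_le)
    fun s => ?_
  rw [edist_comm, edist_eq_enorm_sub]
  exact enorm_le_posTrace (sub_nonneg.2 (hle s))

theorem posTrace_eq_tsum_ketBra_sqrt {ι : Type*} {T : H →L[ℂ] H} (hT : 0 ≤ T)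
    (e : HilbertBasis ι ℂ H) : posTrace T = ∑' i, posTrace (ketBra (CFC.sqrt T (e i))) := by
  simp_rw [posTrace_ketBra]
  exact posTrace_eq_tsum_sqrt hT e

theorem hasSum_ketBra_sqrt {ι : Type*} {T : H →L[ℂ] H} (hT : 0 ≤ T) (hfin : posTrace T ≠ ∞)
    (e : HilbertBasis ι ℂ H) : HasSum (fun i => ketBra (CFC.sqrt T (e i))) T :=
  hasSum_of_posTrace hfin (fun _ => ketBra_nonneg _)
    (fun s => sum_ketBra_sqrt_le hT e.orthonormal s) (posTrace_eq_tsum_ketBra_sqrt hT e)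

theorem isCompactOperator_ketBra (v : H) : IsCompactOperator (ketBra v) := by
  have h : IsCompactOperator (ContinuousLinearMap.toSpanSingleton ℂ v) :=
    isCompactOperator_of_locallyCompactSpace_rng (ContinuousLinearMap.toSpanSingleton ℂ v)
  exact h.comp_clm (innerSL ℂ v)

theorem isCompactOperator_of_posTrace {T : H →L[ℂ] H} (hT : 0 ≤ T) (hfin : posTrace T ≠ ∞) :
    IsCompactOperator T := by
  classical
  obtain ⟨w, e, -⟩ := exists_hilbertBasis ℂ H
  refine isCompactOperator_of_tendsto (hasSum_ketBra_sqrt hT hfin e) (.of_forall fun s => ?_)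
  induction s using Finset.induction_on with
  | empty => simpa using isCompactOperator_zero
  | insert a s ha ih =>
    rw [Finset.sum_insert ha]
    exact (isCompactOperator_ketBra _).add ih

end KetBra

/-! ### Spectral decomposition of positive operators of finite trace. -/

section Eigenbasis

universe u

variable {H : Type u} [NormedAddCommGroup H] [InnerProductSpace ℂ H] [CompleteSpace H]

/-- Finite trace makes `T` compact, so its eigenspaces have no common orthogonal complement; Hilbert
bases of the eigenspaces, kernel included, are glued together. -/
theorem exists_hilbertBasis_eigenvectors {T : H →L[ℂ] H} (hT : 0 ≤ T) (hfin : posTrace T ≠ ∞) :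
    ∃ (ι : Type u) (e : HilbertBasis ι ℂ H) (a : ι → ℝ), ∀ i, T (e i) = (a i : ℂ) • e i := by
  have hpos := (ContinuousLinearMap.nonneg_iff_isPositive T).1 hT
  have hsymm := hpos.isSymmetric
  have hbot := ContinuousLinearMap.orthogonalComplement_iSup_eigenspaces_eq_bot
    (isCompactOperator_of_posTrace hT hfin) hsymm
  have hcomplete : ∀ μ : ℂ, CompleteSpace (Module.End.eigenspace (T : Module.End ℂ H) μ) := by
    intro μ
    have : IsClosed (Module.End.eigenspace (T : Module.End ℂ H) μ : Set H) := by
      have : (Module.End.eigenspace (T : Module.End ℂ H) μ : Set H) = {x | T x = μ • x} := by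
        ext x; exact Module.End.mem_eigenspace_iff
      rw [this]
      exact isClosed_eq T.continuous (continuous_const_smul μ)
    exact this.completeSpace_coe
  choose w b hb using fun μ : ℂ =>
    exists_hilbertBasis ℂ (Module.End.eigenspace (T : Module.End ℂ H) μ)
  have hon := hsymm.orthogonalFamily_eigenspaces.orthonormal_sigma_orthonormal
    (fun μ => (b μ).orthonormal)
  have hspan : (Submodule.span ℂ (Set.range fun a : Σ μ : ℂ, w μ =>
      (Module.End.eigenspace (T : Module.End ℂ H) a.1).subtypeₗᵢ (b a.1 a.2)))ᗮ = ⊥ := by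
    rw [eq_bot_iff, ← hbot]
    intro x hx
    rw [Submodule.mem_orthogonal] at hx ⊢
    have hμ : ∀ μ : ℂ, ∀ y ∈ Module.End.eigenspace (T : Module.End ℂ H) μ, ⟪y, x⟫_ℂ = 0 := by
      intro μ y hy
      have h1 : ∀ z : Module.End.eigenspace (T : Module.End ℂ H) μ,
          z ∈ closure (Submodule.span ℂ (Set.range (b μ)) :
            Set (Module.End.eigenspace (T : Module.End ℂ H) μ)) := fun z => by
        have := (b μ).dense_span
        rw [← Submodule.topologicalClosure_coe, this]
        trivial
      have h2 : IsClosed {z : Module.End.eigenspace (T : Module.End ℂ H) μ |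
          ⟪(z : H), x⟫_ℂ = 0} := isClosed_eq (by fun_prop) continuous_const
      refine closure_minimal ?_ h2 (h1 ⟨y, hy⟩)
      intro z hz
      induction hz using Submodule.span_induction with
      | mem z hz =>
        obtain ⟨i, rfl⟩ := hz
        exact hx _ (Submodule.subset_span ⟨⟨μ, i⟩, rfl⟩)
      | zero => simp
      | add u v _ _ hu hv =>
        simp only [Set.mem_ofPred_eq] at hu hv ⊢
        rw [Submodule.coe_add, inner_add_left, hu, hv, add_zero]
      | smul c u _ hu =>
        simp only [Set.mem_ofPred_eq] at hu ⊢
        rw [Submodule.coe_smul, inner_smul_left, hu, mul_zero]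
    intro y hy
    induction hy using Submodule.iSup_induction' with
    | mem μ y hy => exact hμ μ y hy
    | zero => simp
    | add u v _ _ hu hv => rw [inner_add_left, hu, hv, add_zero]
  let e := HilbertBasis.mkOfOrthogonalEqBot hon hspan
  have he : ∀ i, T (e i) = i.1 • e i := by
    intro i
    have h1 : e i = b i.1 i.2 := by
      simp only [e, HilbertBasis.coe_mkOfOrthogonalEqBot]; rfl
    rw [h1]
    exact Module.End.mem_eigenspace_iff.1 (b i.1 i.2).2
  refine ⟨_, e, fun i => i.1.re, fun i => ?_⟩
  have hconj : (starRingEnd ℂ) i.1 = i.1 := by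
    refine hsymm.conj_eigenvalue_eq_self (Module.End.hasEigenvalue_of_hasEigenvector
      (x := e i) ⟨Module.End.mem_eigenspace_iff.2 (he i), ?_⟩)
    exact norm_ne_zero_iff.1 (by rw [e.orthonormal.1 i]; exact one_ne_zero)
  rw [he i, Complex.conj_eq_iff_re.1 hconj]

theorem re_inner_eigenvector {T : H →L[ℂ] H} {e : H} (he : ‖e‖ = 1) {a : ℝ}
    (h : T e = (a : ℂ) • e) : RCLike.re ⟪e, T e⟫_ℂ = a := by
  rw [h, inner_smul_right, inner_self_eq_norm_sq_to_K, he]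
  simp

theorem eigenvalue_nonneg {T : H →L[ℂ] H} (hT : 0 ≤ T) {e : H} (he : ‖e‖ = 1) {a : ℝ}
    (h : T e = (a : ℂ) • e) : 0 ≤ a :=
  re_inner_eigenvector he h ▸ re_inner_nonneg hT e

theorem re_inner_le_posTrace {T : H →L[ℂ] H} (hT : 0 ≤ T) (hfin : posTrace T ≠ ∞) {e : H}
    (he : ‖e‖ = 1) : RCLike.re ⟪e, T e⟫_ℂ ≤ (posTrace T).toReal := by
  refine (RCLike.re_le_norm _).trans ((norm_inner_le_norm _ _).trans ?_)
  rw [he, one_mul]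
  refine (T.le_opNorm e).trans ?_
  rw [he, mul_one]
  exact norm_le_posTrace hT hfin

end Eigenbasis

/-! ### The regularized logarithm of an operator. -/

section RegLog

open Real

/-- A continuous regularization of `x ↦ log (θ / x)`. -/
def regLog (θ ε x : ℝ) : ℝ := log (θ + ε) - log (max x 0 + ε)

theorem continuous_regLog (θ : ℝ) {ε : ℝ} (hε : 0 < ε) : Continuous (regLog θ ε) := by
  unfold regLog
  refine continuous_const.sub (Continuous.log (by fun_prop) fun x => ?_)
  have := le_max_right x 0
  linarith

theorem regLog_nonneg {θ ε x : ℝ} (hε : 0 < ε) (hθ : 0 ≤ θ) (hx : x ≤ θ) : 0 ≤ regLog θ ε x := by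
  have h0 := le_max_right x 0
  have := log_le_log (show 0 < max x 0 + ε by linarith)
    (show max x 0 + ε ≤ θ + ε by linarith [max_le hx hθ])
  simp only [regLog]; linarith

variable {H : Type*} [NormedAddCommGroup H] [InnerProductSpace ℂ H] [CompleteSpace H]

/-- On positive operators the functional calculus gives `log (θ + ε) - log (B + ε)`. The shift by
`ε` makes the argument strictly positive, so operator monotonicity of the logarithm applies. -/
theorem cfc_regLog_anti {A C : H →L[ℂ] H} (hA : 0 ≤ A) (h : A ≤ C) (θ : ℝ) {ε : ℝ} (hε : 0 < ε) :
    cfc (regLog θ ε) C ≤ cfc (regLog θ ε) A := by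
  have key : ∀ B : H →L[ℂ] H, 0 ≤ B → cfc (regLog θ ε) B =
      algebraMap ℝ (H →L[ℂ] H) (log (θ + ε)) - CFC.log (B + algebraMap ℝ (H →L[ℂ] H) ε) := by
    intro B hB
    have hsp : ∀ x ∈ spectrum ℝ B, 0 ≤ x := fun x hx => spectrum_nonneg_of_nonneg hB hx
    have h1 : cfc (regLog θ ε) B = cfc (fun x => log (θ + ε) - log (x + ε)) B := by
      refine cfc_congr fun x hx => ?_
      simp only [regLog, max_eq_left (hsp x hx)]
    have hc : ContinuousOn (fun x => log (x + ε)) (spectrum ℝ B) :=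
      ContinuousOn.log (by fun_prop) fun x hx => by have := hsp x hx; linarith
    rw [h1, cfc_sub (fun _ => log (θ + ε)) (fun x => log (x + ε)) B continuousOn_const hc,
      cfc_const _ B hB.isSelfAdjoint]
    congr 1
    rw [cfc_comp' log (fun x => x + ε) B ?_ (by fun_prop) hB.isSelfAdjoint,
      cfc_add_const ε (fun x => x) B (by fun_prop) hB.isSelfAdjoint, cfc_id' ℝ B hB.isSelfAdjoint]
    · rfl
    · rintro _ ⟨x, hx, rfl⟩
      have := hsp x hx
      exact (continuousAt_log (by simp only; linarith)).continuousWithinAt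
  have hs : IsStrictlyPositive (algebraMap ℝ (H →L[ℂ] H) ε) := isStrictlyPositive_algebraMap hε
  rw [key A hA, key C (hA.trans h)]
  refine sub_le_sub_left (CFC.log_le_log ?_ (hs.nonneg_add hA)) _
  exact add_le_add_left h _

/-- The square root of the regularized logarithm of an operator. -/
def sqrtRegLog (θ ε : ℝ) (C : H →L[ℂ] H) : H →L[ℂ] H := cfc (fun x => √(regLog θ ε x)) C

theorem continuous_sqrt_regLog (θ : ℝ) {ε : ℝ} (hε : 0 < ε) :
    Continuous fun x => √(regLog θ ε x) := (continuous_regLog θ hε).sqrt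

theorem star_sqrtRegLog (θ ε : ℝ) (C : H →L[ℂ] H) :
    star (sqrtRegLog θ ε C) = sqrtRegLog θ ε C :=
  (cfc_predicate (fun x => √(regLog θ ε x)) C : IsSelfAdjoint _).star_eq

theorem sqrtRegLog_mul_self {C : H →L[ℂ] H} {θ ε : ℝ} (hθ : 0 ≤ θ) (hε : 0 < ε)
    (hC : spectrum ℝ C ⊆ Set.Icc 0 θ) :
    sqrtRegLog θ ε C * sqrtRegLog θ ε C = cfc (regLog θ ε) C := by
  rw [sqrtRegLog, ← cfc_mul _ _ C (continuous_sqrt_regLog θ hε).continuousOn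
    (continuous_sqrt_regLog θ hε).continuousOn]
  exact cfc_congr fun x hx => mul_self_sqrt (regLog_nonneg hε hθ (hC hx).2)

theorem sqrtRegLog_conj_self {C : H →L[ℂ] H} (hC0 : 0 ≤ C) {θ ε : ℝ} (hθ : 0 ≤ θ) (hε : 0 < ε)
    (hC : spectrum ℝ C ⊆ Set.Icc 0 θ) :
    sqrtRegLog θ ε C * C * sqrtRegLog θ ε C = cfc (fun x => x * regLog θ ε x) C := by
  have hc := (continuous_sqrt_regLog θ hε).continuousOn (s := spectrum ℝ C)
  conv_lhs => enter [1, 2]; rw [← cfc_id' ℝ C hC0.isSelfAdjoint]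
  rw [sqrtRegLog, ← cfc_mul _ _ C hc (by fun_prop),
    ← cfc_mul (fun x => √(regLog θ ε x) * x) _ C (hc.mul continuousOn_id) hc]
  refine cfc_congr fun x hx => ?_
  have := mul_self_sqrt (regLog_nonneg hε hθ (hC hx).2)
  rw [mul_right_comm, this, mul_comm]

/-- Cyclicity of the trace, in the form `Tr X*X = Tr XX*` with `X = √A R`. -/
theorem posTrace_sqrtRegLog_conj {A : H →L[ℂ] H} (hA : 0 ≤ A) (θ ε : ℝ) (C : H →L[ℂ] H) :
    posTrace (sqrtRegLog θ ε C * A * sqrtRegLog θ ε C) =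
      posTrace (CFC.sqrt A * (sqrtRegLog θ ε C * sqrtRegLog θ ε C) * CFC.sqrt A) := by
  have h := posTrace_star_mul_self_comm (CFC.sqrt A * sqrtRegLog θ ε C)
  rw [star_mul, star_sqrt, star_sqrtRegLog] at h
  rw [← mul_assoc, mul_assoc _ (CFC.sqrt A) (CFC.sqrt A), CFC.sqrt_mul_sqrt_self A hA] at h
  rw [h]
  simp only [mul_assoc]

/-- A regularized form of `Tr A log (θ / C) ≤ Tr A log (θ / A)` for `A ≤ C`, the inequality behind
subadditivity. -/
theorem posTrace_sqrtRegLog_conj_le {A C : H →L[ℂ] H} (hA : 0 ≤ A) (h : A ≤ C) {θ ε : ℝ}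
    (hθ : 0 ≤ θ) (hε : 0 < ε) (hAs : spectrum ℝ A ⊆ Set.Icc 0 θ)
    (hCs : spectrum ℝ C ⊆ Set.Icc 0 θ) :
    posTrace (sqrtRegLog θ ε C * A * sqrtRegLog θ ε C) ≤
      posTrace (cfc (fun x => x * regLog θ ε x) A) := by
  rw [← sqrtRegLog_conj_self hA hθ hε hAs, posTrace_sqrtRegLog_conj hA,
    posTrace_sqrtRegLog_conj hA, sqrtRegLog_mul_self hθ hε hAs, sqrtRegLog_mul_self hθ hε hCs]
  refine posTrace_mono ?_
  exact (CFC.sqrt_nonneg A).isSelfAdjoint.conjugate_le_conjugate (cfc_regLog_anti hA h θ hε)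

end RegLog

/-! ### Super- and subadditivity and lower semicontinuity of the entropy. -/

section OperatorEntropy

variable {H : Type*} [NormedAddCommGroup H] [InnerProductSpace ℂ H] [CompleteSpace H]

/-- The trace of `A log (θ / A)`, for a positive operator `A` of norm at most `θ`. -/
def scaledEntropy (θ : ℝ) (A : H →L[ℂ] H) : ℝ≥0∞ := posTrace (cfc (scaledEta θ) A)

/-- The entropy of a positive bounded operator of finite trace. -/
def opEntropy (A : H →L[ℂ] H) : ℝ≥0∞ := scaledEntropy (posTrace A).toReal A

theorem cfc_scaledEta_nonneg {θ : ℝ} {A : H →L[ℂ] H} (hA : spectrum ℝ A ⊆ Set.Icc 0 θ) :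
    0 ≤ cfc (scaledEta θ) A :=
  cfc_nonneg fun _ hx => scaledEta_nonneg (hA hx).1 (hA hx).2

theorem spectrum_subset_posTrace {A : H →L[ℂ] H} (hA : 0 ≤ A) (hfin : posTrace A ≠ ∞) :
    spectrum ℝ A ⊆ Set.Icc 0 (posTrace A).toReal :=
  spectrum_subset_Icc hA ENNReal.toReal_nonneg (ENNReal.ofReal_toReal hfin).ge

theorem cfc_zero_op (φ : ℝ → ℝ) (h : φ 0 = 0) : cfc φ (0 : H →L[ℂ] H) = 0 := by
  rw [cfc_apply_zero, h, map_zero]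

theorem scaledEntropy_zero (θ : ℝ) : scaledEntropy θ (0 : H →L[ℂ] H) = 0 := by
  rw [scaledEntropy, cfc_zero_op _ (scaledEta_zero θ), posTrace_zero]

theorem opEntropy_zero : opEntropy (0 : H →L[ℂ] H) = 0 := scaledEntropy_zero _

theorem scaledEntropy_eq_opEntropy_add {A : H →L[ℂ] H} (hA : 0 ≤ A) (hfin : posTrace A ≠ ∞)
    {θ : ℝ} (h : (posTrace A).toReal ≤ θ) :
    scaledEntropy θ A = opEntropy A + ENNReal.ofReal (scaledEta θ (posTrace A).toReal) := by
  rcases (ENNReal.toReal_nonneg (a := posTrace A)).eq_or_lt with h0 | h0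
  · have : A = 0 := eq_zero_of_posTrace_eq_zero hA
      (((ENNReal.toReal_eq_zero_iff _).1 h0.symm).resolve_right hfin)
    rw [← h0, this, scaledEntropy_zero, opEntropy_zero, scaledEta_zero]; simp
  · set t := (posTrace A).toReal
    have hl : 0 ≤ Real.log θ - Real.log t := sub_nonneg.2 (Real.log_le_log h0 h)
    have hd : cfc (scaledEta θ) A = cfc (scaledEta t) A + (Real.log θ - Real.log t) • A := by
      rw [← cfc_const_mul_id _ A hA.isSelfAdjoint, ← cfc_add A _ _
        (continuous_scaledEta t).continuousOn (by fun_prop)]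
      refine cfc_congr fun x _ => ?_
      simp only [scaledEta]; ring
    rw [scaledEntropy, hd, posTrace_add (cfc_scaledEta_nonneg (spectrum_subset_posTrace hA hfin))
      (real_smul_nonneg hl hA), posTrace_smul hl, opEntropy, scaledEntropy, scaledEta_eq,
      mul_comm t, ENNReal.ofReal_mul hl, ENNReal.ofReal_toReal hfin]

theorem opEntropy_le_scaledEntropy {A : H →L[ℂ] H} (hA : 0 ≤ A) (hfin : posTrace A ≠ ∞)
    {θ : ℝ} (h : (posTrace A).toReal ≤ θ) : opEntropy A ≤ scaledEntropy θ A :=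
  (scaledEntropy_eq_opEntropy_add hA hfin h).symm ▸ le_self_add

theorem opEntropy_smul {c : ℝ} (hc : 0 ≤ c) {A : H →L[ℂ] H} (hA : 0 ≤ A)
    (hfin : posTrace A ≠ ∞) : opEntropy (c • A) = ENNReal.ofReal c * opEntropy A := by
  rcases hc.eq_or_lt with rfl | hc
  · simp [opEntropy_zero]
  have hsp := spectrum_subset_posTrace hA hfin
  rw [opEntropy, opEntropy, scaledEntropy, scaledEntropy, posTrace_smul hc.le,
    ENNReal.toReal_mul, ENNReal.toReal_ofReal hc.le, ← posTrace_smul hc.le,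
    ← cfc_comp_const_mul c _ A (continuous_scaledEta _).continuousOn hA.isSelfAdjoint,
    ← cfc_const_mul c _ A (continuous_scaledEta _).continuousOn]
  congr 1
  exact cfc_congr fun x hx => scaledEta_smul hc (hsp hx).1 (hsp hx).2

theorem scaledEntropy_eq_tsum {ι : Type*} {A : H →L[ℂ] H} {θ : ℝ}
    (hA : spectrum ℝ A ⊆ Set.Icc 0 θ) (e : HilbertBasis ι ℂ H) :
    scaledEntropy θ A =
      ∑' i, ENNReal.ofReal (RCLike.re ⟪e i, cfc (scaledEta θ) A (e i)⟫_ℂ) :=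
  posTrace_eq_tsum (cfc_scaledEta_nonneg hA) e

theorem scaledEntropy_eq_tsum_eigenvalues {ι : Type*} {A : H →L[ℂ] H} (hA0 : 0 ≤ A) {θ : ℝ}
    (hA : spectrum ℝ A ⊆ Set.Icc 0 θ) (e : HilbertBasis ι ℂ H) {a : ι → ℝ}
    (ha : ∀ i, A (e i) = (a i : ℂ) • e i) :
    scaledEntropy θ A = ∑' i, ENNReal.ofReal (scaledEta θ (a i)) := by
  rw [scaledEntropy_eq_tsum hA e]
  refine tsum_congr fun i => congrArg _ ?_
  exact re_inner_cfc_of_eigenvector hA0.isSelfAdjoint (e.orthonormal.1 i) (ha i)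
    (continuous_scaledEta θ)

/-- The entropy is at most the entropy of the diagonal in any orthonormal basis. -/
theorem scaledEntropy_le_tsum {ι : Type*} {A : H →L[ℂ] H} (hA0 : 0 ≤ A) {θ : ℝ}
    (hA : spectrum ℝ A ⊆ Set.Icc 0 θ) (e : HilbertBasis ι ℂ H) :
    scaledEntropy θ A ≤ ∑' i, ENNReal.ofReal (scaledEta θ (RCLike.re ⟪e i, A (e i)⟫_ℂ)) := by
  rw [scaledEntropy_eq_tsum hA e]
  exact ENNReal.tsum_le_tsum fun i => ENNReal.ofReal_le_ofReal
    (re_inner_cfc_scaledEta_le hA0 (e.orthonormal.1 i) θ)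

/-- In an eigenbasis of `A + B` the entropy of the sum is exactly that of its diagonal, while the
entropies of `A` and `B` are at most those of their diagonals. The log-sum inequality then compares
the series term by term. -/
theorem opEntropy_superadditive {A B : H →L[ℂ] H} (hA : 0 ≤ A) (hB : 0 ≤ B)
    (hfin : posTrace (A + B) ≠ ∞) : opEntropy A + opEntropy B ≤ opEntropy (A + B) := by
  have hAB : 0 ≤ A + B := add_nonneg hA hB
  obtain ⟨ι, e, c, hc⟩ := exists_hilbertBasis_eigenvectors hAB hfin
  have htr := posTrace_add hA hB
  have hfin' := hfin
  rw [htr] at hfin'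
  obtain ⟨hAf, hBf⟩ := ENNReal.add_ne_top.1 hfin'
  rw [opEntropy, opEntropy, opEntropy,
    scaledEntropy_eq_tsum_eigenvalues hAB (spectrum_subset_posTrace hAB hfin) e hc]
  refine (add_le_add (scaledEntropy_le_tsum hA (spectrum_subset_posTrace hA hAf) e)
    (scaledEntropy_le_tsum hB (spectrum_subset_posTrace hB hBf) e)).trans ?_
  rw [← ENNReal.tsum_add]
  refine ENNReal.tsum_le_tsum fun i => ?_
  have h1 := re_inner_nonneg hA (e i)
  have h2 := re_inner_nonneg hB (e i)
  have h3 := re_inner_le_posTrace hA hAf (e.orthonormal.1 i)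
  have h4 := re_inner_le_posTrace hB hBf (e.orthonormal.1 i)
  rw [← ENNReal.ofReal_add (scaledEta_nonneg h1 h3) (scaledEta_nonneg h2 h4)]
  refine ENNReal.ofReal_le_ofReal ((scaledEta_superadditive h1 h2 h3 h4).trans (le_of_eq ?_))
  rw [htr, ENNReal.toReal_add hAf hBf, ← re_inner_eigenvector (e.orthonormal.1 i) (hc i),
    _root_.add_apply, inner_add_right, map_add]

theorem opEntropy_add_sub_le {A C : H →L[ℂ] H} (hA : 0 ≤ A) (h : A ≤ C)
    (hfin : posTrace C ≠ ∞) : opEntropy A + opEntropy (C - A) ≤ opEntropy C := by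
  have := opEntropy_superadditive hA (sub_nonneg.2 h) (by rwa [add_sub_cancel])
  rwa [add_sub_cancel] at this

theorem norm_cfc_scaledEta_sub_le {A : H →L[ℂ] H} {θ ε : ℝ} (hε : 0 < ε)
    (hA : spectrum ℝ A ⊆ Set.Icc 0 θ) :
    ‖cfc (fun x => x * regLog θ ε x) A - cfc (scaledEta θ) A‖ ≤ ε := by
  have hc : Continuous fun x => x * regLog θ ε x := continuous_id.mul (continuous_regLog θ hε)
  rw [← cfc_sub _ _ A hc.continuousOn (continuous_scaledEta θ).continuousOn]
  refine norm_cfc_le hε.le fun x hx => ?_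
  have h1 := mul_log_add_le hε (hA hx).1 (hA hx).2
  have h2 := scaledEta_le_mul_log_add hε (hA hx).1 (hA hx).2
  simp only [regLog, max_eq_left (hA hx).1]
  rw [Real.norm_eq_abs, abs_le]
  constructor <;> linarith

/-- The regularizations converge in operator norm as `ε → 0`, and the trace is lower semicontinuous.
-/
theorem scaledEntropy_le_of_regLog {A : H →L[ℂ] H} {θ : ℝ} (hA : spectrum ℝ A ⊆ Set.Icc 0 θ)
    {M : ℝ≥0∞} (h : ∀ ε : ℝ, 0 < ε → posTrace (cfc (fun x => x * regLog θ ε x) A) ≤ M) :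
    scaledEntropy θ A ≤ M := by
  have h1 : Tendsto (fun ε : ℝ => cfc (fun x => x * regLog θ ε x) A) (𝓝[>] 0)
      (𝓝 (cfc (scaledEta θ) A)) := by
    rw [tendsto_iff_norm_sub_tendsto_zero]
    have h2 : Tendsto (fun ε : ℝ => ε) (𝓝[>] 0) (𝓝 0) := tendsto_id.mono_left nhdsWithin_le_nhds
    refine tendsto_of_tendsto_of_tendsto_of_le_of_le' tendsto_const_nhds h2
      (.of_forall fun _ => norm_nonneg _) ?_
    filter_upwards [self_mem_nhdsWithin] with ε hε
    exact norm_cfc_scaledEta_sub_le hε hA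
  refine posTrace_le_of_tendsto h1 ?_
  filter_upwards [self_mem_nhdsWithin] with ε hε
  exact h ε hε

theorem posTrace_regLog_le {A : H →L[ℂ] H} {θ ε : ℝ} (hε : 0 < ε)
    (hA : spectrum ℝ A ⊆ Set.Icc 0 θ) :
    posTrace (cfc (fun x => x * regLog θ ε x) A) ≤ scaledEntropy θ A := by
  have hc : Continuous fun x => x * regLog θ ε x := continuous_id.mul (continuous_regLog θ hε)
  refine posTrace_mono (cfc_mono (fun x hx => ?_) hc.continuousOn
    (continuous_scaledEta θ).continuousOn)
  have h1 := mul_log_add_le hε (hA hx).1 (hA hx).2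
  simpa only [regLog, max_eq_left (hA hx).1] using h1

/-- The regularized `Tr (A + B) log (θ / (A + B))` splits linearly into the parts of `A` and `B`. In
each part, replacing `A + B` under the logarithm by the smaller operator increases the trace. -/
theorem scaledEntropy_subadditive {A B : H →L[ℂ] H} (hA : 0 ≤ A) (hB : 0 ≤ B) {θ : ℝ}
    (hθ : 0 ≤ θ) (h : posTrace (A + B) ≤ ENNReal.ofReal θ) :
    scaledEntropy θ (A + B) ≤ scaledEntropy θ A + scaledEntropy θ B := by
  have hAB : 0 ≤ A + B := add_nonneg hA hB
  have htr := posTrace_add hA hB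
  have hCs := spectrum_subset_Icc hAB hθ h
  have hAs := spectrum_subset_Icc hA hθ ((le_self_add.trans htr.ge).trans h)
  have hBs := spectrum_subset_Icc hB hθ ((le_add_self.trans htr.ge).trans h)
  refine scaledEntropy_le_of_regLog hCs fun ε hε => ?_
  have hR : IsSelfAdjoint (sqrtRegLog θ ε (A + B)) := star_sqrtRegLog θ ε (A + B)
  rw [← sqrtRegLog_conj_self hAB hθ hε hCs, mul_add, add_mul,
    posTrace_add (hR.conjugate_nonneg hA) (hR.conjugate_nonneg hB)]
  refine add_le_add ?_ ?_
  · exact (posTrace_sqrtRegLog_conj_le hA (le_add_of_nonneg_right hB) hθ hε hAs hCs).trans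
      (posTrace_regLog_le hε hAs)
  · exact (posTrace_sqrtRegLog_conj_le hB (le_add_of_nonneg_left hA) hθ hε hBs hCs).trans
      (posTrace_regLog_le hε hBs)

theorem scaledEntropy_sum_le {ι : Type*} (s : Finset ι) {A : ι → H →L[ℂ] H} (hA : ∀ i, 0 ≤ A i)
    {θ : ℝ} (hθ : 0 ≤ θ) (h : posTrace (∑ i ∈ s, A i) ≤ ENNReal.ofReal θ) :
    scaledEntropy θ (∑ i ∈ s, A i) ≤ ∑ i ∈ s, scaledEntropy θ (A i) := by
  classical
  induction s using Finset.induction_on with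
  | empty => simp [scaledEntropy_zero]
  | insert a s ha ih =>
    rw [Finset.sum_insert ha] at h ⊢
    have hs : 0 ≤ ∑ i ∈ s, A i := Finset.sum_nonneg fun i _ => hA i
    rw [Finset.sum_insert ha]
    refine (scaledEntropy_subadditive (hA a) hs hθ h).trans (add_le_add le_rfl (ih ?_))
    exact (posTrace_mono (le_add_of_nonneg_left (hA a))).trans h

/-- Subadditivity holds at the common scale `θ = Tr (A + B)`; returning to the individual scales
costs the binary entropy of the two traces, estimated by `scaledEta_add_le`. -/
theorem opEntropy_add_le {A B : H →L[ℂ] H} (hA : 0 ≤ A) (hB : 0 ≤ B)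
    (hAf : posTrace A ≠ ∞) (hBf : posTrace B ≠ ∞) {s : ℝ} (hs : 0 < s) (hs1 : s ≤ 1) :
    opEntropy (A + B) ≤ opEntropy A + opEntropy B +
      (ENNReal.ofReal s * (posTrace A + posTrace B) +
        ENNReal.ofReal (Real.log (1 / s)) * posTrace B) := by
  have htr := posTrace_add hA hB
  have hfin : posTrace (A + B) ≠ ∞ := by rw [htr]; exact ENNReal.add_ne_top.2 ⟨hAf, hBf⟩
  set x := (posTrace A).toReal with hx
  set y := (posTrace B).toReal with hy
  have hx0 : 0 ≤ x := ENNReal.toReal_nonneg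
  have hy0 : 0 ≤ y := ENNReal.toReal_nonneg
  have hxy : (posTrace (A + B)).toReal = x + y := by rw [htr, ENNReal.toReal_add hAf hBf]
  have hl : 0 ≤ Real.log (1 / s) := Real.log_nonneg (by rw [le_div_iff₀ hs]; linarith)
  have h1 := scaledEntropy_subadditive hA hB (θ := x + y) (by positivity)
    (by rw [← hxy, ENNReal.ofReal_toReal hfin])
  rw [scaledEntropy_eq_opEntropy_add hA hAf (by linarith),
    scaledEntropy_eq_opEntropy_add hB hBf (by linarith)] at h1
  rw [opEntropy, hxy]
  refine h1.trans (le_of_eq_of_le (add_add_add_comm _ _ _ _) (add_le_add le_rfl ?_))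
  rw [← hx, ← hy, ← ENNReal.ofReal_add (scaledEta_nonneg hx0 (by linarith))
    (scaledEta_nonneg hy0 (by linarith)), ← ENNReal.ofReal_toReal hAf,
    ← ENNReal.ofReal_toReal hBf, ← hx, ← hy, ← ENNReal.ofReal_add hx0 hy0,
    ← ENNReal.ofReal_mul hs.le, ← ENNReal.ofReal_mul hl, ← ENNReal.ofReal_add
      (by positivity) (by positivity)]
  exact ENNReal.ofReal_le_ofReal (scaledEta_add_le hx0 hy0 hs hs1)

theorem tendsto_cfc_scaledEta {α : Type*} {l : Filter α} {A : α → H →L[ℂ] H} {S : H →L[ℂ] H}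
    (h : Tendsto A l (𝓝 S)) (hA : ∀ i, 0 ≤ A i) (hS : 0 ≤ S) {θ : α → ℝ} {τ : ℝ}
    (hθ : Tendsto θ l (𝓝 τ)) (hτ : τ ≠ 0) :
    Tendsto (fun i => cfc (scaledEta (θ i)) (A i)) l (𝓝 (cfc (scaledEta τ) S)) := by
  -- Separating `log t • B` leaves a function of the operator that no longer depends on the scale;
  -- `τ ≠ 0` is needed for continuity of the logarithm.
  have hsplit : ∀ (t : ℝ) (B : H →L[ℂ] H), 0 ≤ B →
      cfc (scaledEta t) B = Real.log t • B + cfc Real.negMulLog B := by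
    intro t B hB
    rw [← cfc_const_mul_id _ B hB.isSelfAdjoint, ← cfc_add B _ _ (by fun_prop)
      Real.continuous_negMulLog.continuousOn]
    refine cfc_congr fun x _ => ?_
    simp only [scaledEta]; ring
  rw [hsplit τ S hS]
  simp_rw [fun i => hsplit (θ i) (A i) (hA i)]
  refine ((hθ.log hτ).smul h).add ?_
  refine Filter.Tendsto.cfc (isCompact_Icc (a := (0 : ℝ)) (b := ‖S‖ + 1)) _ h ?_
    (.of_forall fun i => (hA i).isSelfAdjoint) ?_ hS.isSelfAdjoint
    Real.continuous_negMulLog.continuousOn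
  · filter_upwards [h.norm.eventually (eventually_le_nhds (show ‖S‖ < ‖S‖ + 1 by linarith))] with i hi
    exact (spectrum_subset_Icc_norm (hA i)).trans (Set.Icc_subset_Icc_right hi)
  · exact (spectrum_subset_Icc_norm hS).trans (Set.Icc_subset_Icc_right (by linarith))

theorem scaledEntropy_le_of_tendsto {α : Type*} {l : Filter α} [l.NeBot] {A : α → H →L[ℂ] H}
    {S : H →L[ℂ] H} (h : Tendsto A l (𝓝 S)) (hA : ∀ i, 0 ≤ A i) (hS : 0 ≤ S) {θ : ℝ} (hθ : θ ≠ 0)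
    {M : ℝ≥0∞} (hM : ∀ᶠ i in l, scaledEntropy θ (A i) ≤ M) : scaledEntropy θ S ≤ M :=
  posTrace_le_of_tendsto (tendsto_cfc_scaledEta h hA hS tendsto_const_nhds hθ) hM

/-- Lower semicontinuity of the entropy. -/
theorem opEntropy_le_of_tendsto {α : Type*} {l : Filter α} [l.NeBot] {A : α → H →L[ℂ] H}
    {S : H →L[ℂ] H} (h : Tendsto A l (𝓝 S)) (hA : ∀ i, 0 ≤ A i) (hS : 0 ≤ S)
    (hfin : posTrace S ≠ ∞) (htr : Tendsto (fun i => posTrace (A i)) l (𝓝 (posTrace S)))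
    {M : ℝ≥0∞} (hM : ∀ᶠ i in l, opEntropy (A i) ≤ M) : opEntropy S ≤ M := by
  rcases eq_or_ne (posTrace S) 0 with h0 | h0
  · rw [eq_zero_of_posTrace_eq_zero hS h0, opEntropy_zero]; exact bot_le
  · exact posTrace_le_of_tendsto (tendsto_cfc_scaledEta h hA hS
      ((ENNReal.tendsto_toReal hfin).comp htr) (ENNReal.toReal_ne_zero.2 ⟨h0, hfin⟩)) hM

/-- Rank-one operators have zero entropy. -/
theorem opEntropy_ketBra (v : H) : opEntropy (ketBra v) = 0 := by
  have hp := posTrace_ketBra v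
  have hfin : posTrace (ketBra v) ≠ ∞ := by rw [hp]; simp
  have ht : (posTrace (ketBra v)).toReal = ‖v‖ ^ 2 := by rw [hp]; simp
  have hsp := spectrum_subset_posTrace (ketBra_nonneg v) hfin
  have hz : cfc (scaledEta (posTrace (ketBra v)).toReal) (ketBra v) = 0 := by
    set t := (posTrace (ketBra v)).toReal
    have hsq : ketBra v * ketBra v = t • ketBra v := by
      ext x
      rw [mul_apply_eq_comp, _root_.smul_apply, ketBra_apply, ketBra_apply, inner_smul_right,
        inner_self_eq_norm_sq_to_K, mul_comm, mul_smul, ht]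
      norm_cast
    -- The relation `|v⟩⟨v|² = t |v⟩⟨v|` confines the spectrum to `{0, t}`, where `scaledEta t`
    -- vanishes.
    have hpoly : cfc (fun x => x * (t - x)) (ketBra v) = 0 := by
      have hsa := (ketBra_nonneg v).isSelfAdjoint
      have : (fun x : ℝ => x * (t - x)) = fun x => t * x - x * x := by ext x; ring
      rw [this, cfc_sub (fun x => t * x) (fun x => x * x) _ (by fun_prop) (by fun_prop),
        cfc_const_mul_id _ _ hsa, cfc_mul (fun x => x) (fun x => x) _ (by fun_prop) (by fun_prop),
        cfc_id' ℝ _ hsa, hsq, sub_self]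
    have hx : ∀ x ∈ spectrum ℝ (ketBra v), scaledEta t x = 0 := by
      intro x hx
      have h1 : x * (t - x) ∈ spectrum ℝ (0 : H →L[ℂ] H) := by
        rw [← hpoly, cfc_map_spectrum _ _ (ketBra_nonneg v).isSelfAdjoint (by fun_prop)]
        exact ⟨x, hx, rfl⟩
      have h2 := spectrum_subset_Icc_norm (le_refl (0 : H →L[ℂ] H)) h1
      rw [norm_zero, Set.Icc_self, Set.mem_singleton_iff, mul_eq_zero, sub_eq_zero] at h2
      rcases h2 with h2 | h2
      · rw [h2, scaledEta_zero]
      · rw [← h2, scaledEta_self]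
    rw [cfc_congr (g := fun _ => (0 : ℝ)) hx, cfc_const_zero]
  rw [opEntropy, scaledEntropy, hz, posTrace_zero]

end OperatorEntropy

/-! ### Positive trace-class operators and their entropy. -/

section PosTraceClass

variable {H : Type*} [NormedAddCommGroup H] [InnerProductSpace ℂ H] [CompleteSpace H]

namespace TraceClass

theorem op_sub (A B : TraceClass H) : (A - B).op = A.op - B.op := rfl

theorem op_real_smul (c : ℝ) (A : TraceClass H) : (c • A).op = c • A.op := rfl

theorem op_sum {ι : Type*} (s : Finset ι) (A : ι → TraceClass H) :
    (∑ i ∈ s, A i).op = ∑ i ∈ s, (A i).op :=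
  map_sum (AddMonoidHom.mk' (op : TraceClass H → H →L[ℂ] H) op_add) A s

theorem norm_op_le (A : TraceClass H) : ‖A.op‖ ≤ ‖A‖ := by
  rw [norm_def]
  have := ENNReal.toReal_mono A.traceENorm_op_lt_top.ne (enorm_le_traceENorm A.op)
  simpa using this

theorem continuous_op : Continuous (op : TraceClass H → H →L[ℂ] H) := by
  have h : LipschitzWith 1 (op : TraceClass H → H →L[ℂ] H) :=
    LipschitzWith.of_dist_le' (K := 1) (fun A B => by
      rw [dist_eq_norm, dist_eq_norm, one_mul, ← op_sub]; exact norm_op_le _) |>.weaken (by simp)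
  exact h.continuous

theorem hasSum_op {ι : Type*} {B : ι → TraceClass H} {A : TraceClass H} (h : HasSum B A) :
    HasSum (fun i => (B i).op) A.op := by
  have h2 := (continuous_op.tendsto A).comp h
  refine h2.congr fun s => op_sum s B

/-- A positive operator of finite trace, as a trace-class operator. -/
def ofPos (T : H →L[ℂ] H) (hT : 0 ≤ T) (hfin : posTrace T ≠ ∞) : TraceClass H :=
  (⟨T, by
    change traceENorm T < ∞
    rw [traceENorm_eq_posTrace hT]; exact hfin.lt_top⟩ : traceClassSubmodule H)

end TraceClass

open TraceClass

theorem mem_posCone_iff {A : TraceClass H} : A ∈ posCone H ↔ 0 ≤ A.op :=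
  (ContinuousLinearMap.nonneg_iff_isPositive A.op).symm

theorem posTrace_op_eq {A : TraceClass H} (hA : A ∈ posCone H) :
    posTrace A.op = ENNReal.ofReal ‖A‖ := by
  rw [norm_def, ENNReal.ofReal_toReal A.traceENorm_op_lt_top.ne,
    traceENorm_eq_posTrace (mem_posCone_iff.1 hA)]

theorem posTrace_op_ne_top {A : TraceClass H} (hA : A ∈ posCone H) : posTrace A.op ≠ ∞ := by
  rw [posTrace_op_eq hA]; exact ENNReal.ofReal_ne_top

theorem toReal_posTrace_op {A : TraceClass H} (hA : A ∈ posCone H) :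
    (posTrace A.op).toReal = ‖A‖ := by
  rw [posTrace_op_eq hA, ENNReal.toReal_ofReal (norm_nonneg _)]

theorem zero_mem_posCone : (0 : TraceClass H) ∈ posCone H :=
  mem_posCone_iff.2 le_rfl

theorem add_mem_posCone {A B : TraceClass H} (hA : A ∈ posCone H) (hB : B ∈ posCone H) :
    A + B ∈ posCone H :=
  mem_posCone_iff.2 (add_nonneg (mem_posCone_iff.1 hA) (mem_posCone_iff.1 hB))

theorem smul_mem_posCone {c : ℝ} (hc : 0 ≤ c) {A : TraceClass H} (hA : A ∈ posCone H) :
    c • A ∈ posCone H :=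
  mem_posCone_iff.2 (real_smul_nonneg hc (mem_posCone_iff.1 hA))

theorem sum_mem_posCone {ι : Type*} {s : Finset ι} {A : ι → TraceClass H}
    (hA : ∀ i ∈ s, A i ∈ posCone H) : ∑ i ∈ s, A i ∈ posCone H := by
  rw [mem_posCone_iff, op_sum]
  exact Finset.sum_nonneg fun i hi => mem_posCone_iff.1 (hA i hi)

/-- The remainders are positive, so their trace norms are their traces, which tend to zero. -/
theorem hasSum_traceClass {ι : Type*} {B : ι → TraceClass H} {A : TraceClass H}
    (hA : A ∈ posCone H) (hB : ∀ i, B i ∈ posCone H)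
    (hle : ∀ s : Finset ι, ∑ i ∈ s, (B i).op ≤ A.op)
    (htr : posTrace A.op = ∑' i, posTrace (B i).op) : HasSum B A := by
  have h := tendsto_posTrace_sub_sum (posTrace_op_ne_top hA)
    (fun i => mem_posCone_iff.1 (hB i)) hle htr
  rw [HasSum, tendsto_iff_norm_sub_tendsto_zero]
  have h2 := (ENNReal.tendsto_toReal ENNReal.zero_ne_top).comp h
  refine h2.congr fun s => ?_
  have hpos : A - ∑ i ∈ s, B i ∈ posCone H := by
    rw [mem_posCone_iff, op_sub, op_sum]; exact sub_nonneg.2 (hle s)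
  rw [← norm_neg, neg_sub, ← toReal_posTrace_op hpos, op_sub, op_sum]
  rfl

theorem max_sub_max_neg (x : ℝ) : max x 0 - max (-x) 0 = x := by
  rcases le_total 0 x with h | h
  · simp [h]
  · simp [h]

/-- The point is to avoid `∞ - ∞`. If `Tr A ≥ 1`, the negative part of `η(A)` has trace at most `Tr
A log Tr A`, which is finite; if `Tr A < 1` (or `A = 0` is excluded from the first case's needs by
`log 0 = 0`), all terms have a definite sign. In both cases an additive identity of traces is proved
first and the subtraction is done last. -/
theorem entropy_eq_opEntropy {A : TraceClass H} (hA : A ∈ posCone H) :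
    entropy A = opEntropy A.op := by
  have hpos := mem_posCone_iff.1 hA
  have hfin := posTrace_op_ne_top hA
  have hsp := spectrum_subset_posTrace hpos hfin
  rw [entropy, traceEta]
  set t := (posTrace A.op).toReal with ht
  have ht0 : 0 ≤ t := ENNReal.toReal_nonneg
  have hc1 : Continuous fun x => max (Real.negMulLog x) 0 :=
    Real.continuous_negMulLog.max continuous_const
  have hc2 : Continuous fun x => max (-Real.negMulLog x) 0 :=
    Real.continuous_negMulLog.neg.max continuous_const
  have hPn : 0 ≤ cfc (fun x => max (Real.negMulLog x) 0) A.op :=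
    cfc_nonneg fun _ _ => le_max_right _ _
  have hQn : 0 ≤ cfc (fun x => max (-Real.negMulLog x) 0) A.op :=
    cfc_nonneg fun _ _ => le_max_right _ _
  have hSn := cfc_scaledEta_nonneg hsp
  set P := posTrace (cfc (fun x => max (Real.negMulLog x) 0) A.op) with hP
  set Q := posTrace (cfc (fun x => max (-Real.negMulLog x) 0) A.op) with hQ
  have hS : opEntropy A.op = posTrace (cfc (scaledEta t) A.op) := rfl
  have htr : posTrace A.op = ENNReal.ofReal t := (ENNReal.ofReal_toReal hfin).symm
  rcases le_or_gt 0 (Real.log t) with hl | hl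
  · have heq : opEntropy A.op + Q = P + ENNReal.ofReal (Real.log t * t) := by
      rw [hS, hQ, hP, ← posTrace_add hSn hQn, ENNReal.ofReal_mul hl, ← htr, ← posTrace_smul hl,
        ← posTrace_add hPn (real_smul_nonneg hl hpos),
        ← cfc_add A.op _ _ (continuous_scaledEta t).continuousOn hc2.continuousOn,
        ← cfc_const_mul_id _ A.op hpos.isSelfAdjoint,
        ← cfc_add A.op _ _ hc1.continuousOn (by fun_prop)]
      congr 1
      refine cfc_congr fun x _ => ?_
      have := max_sub_max_neg (Real.negMulLog x)
      simp only [scaledEta]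
      linarith
    have hQf : Q ≤ ENNReal.ofReal (Real.log t * t) := by
      rw [ENNReal.ofReal_mul hl, ← htr, ← posTrace_smul hl,
        ← cfc_const_mul_id _ A.op hpos.isSelfAdjoint]
      refine posTrace_mono (cfc_mono (fun x hx => ?_) hc2.continuousOn (by fun_prop))
      obtain ⟨hx0, hxt⟩ := hsp hx
      refine max_le ?_ (mul_nonneg hl hx0)
      have := scaledEta_nonneg hx0 hxt
      simp only [scaledEta] at this
      linarith
    have hQ' : Q ≠ ∞ := (hQf.trans_lt ENNReal.ofReal_lt_top).ne
    have hr : Real.negMulLog t = -(Real.log t * t) := by simp [Real.negMulLog, mul_comm]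
    have hmul : 0 ≤ Real.log t * t := mul_nonneg hl ht0
    rw [hr]
    by_cases hPf : P = ∞
    · rw [hPf, top_add, ENNReal.add_eq_top, or_iff_left hQ'] at heq
      rw [hPf, heq]
      rw [← ENNReal.coe_toNNReal hQ']
      rfl
    · have hSf : opEntropy A.op ≠ ∞ := fun h => by
        rw [h, top_add] at heq
        exact ENNReal.add_ne_top.2 ⟨hPf, ENNReal.ofReal_ne_top⟩ heq.symm
      have h2 := congrArg ENNReal.toReal heq
      rw [ENNReal.toReal_add hSf hQ', ENNReal.toReal_add hPf ENNReal.ofReal_ne_top,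
        ENNReal.toReal_ofReal hmul] at h2
      rw [← EReal.coe_ennreal_toReal hPf, ← EReal.coe_ennreal_toReal hQ', ← EReal.coe_sub,
        ← EReal.coe_sub, ← ENNReal.ofReal_toReal hSf]
      rw [show P.toReal - Q.toReal - -(Real.log t * t) = (opEntropy A.op).toReal by linarith]
      rfl
  · have heq : P = opEntropy A.op + ENNReal.ofReal (-Real.log t * t) := by
      have hl' : 0 ≤ -Real.log t := by linarith
      rw [hS, hP, ENNReal.ofReal_mul hl', ← htr, ← posTrace_smul hl',
        ← posTrace_add hSn (real_smul_nonneg hl' hpos),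
        ← cfc_const_mul_id _ A.op hpos.isSelfAdjoint,
        ← cfc_add A.op _ _ (continuous_scaledEta t).continuousOn (by fun_prop)]
      congr 1
      refine cfc_congr fun x hx => ?_
      obtain ⟨hx0, hxt⟩ := hsp hx
      have h1 : x ≤ 1 := hxt.trans (le_of_not_gt fun h => by linarith [Real.log_pos h])
      rw [max_eq_left (Real.negMulLog_nonneg hx0 h1)]
      simp only [scaledEta]
      ring
    have hQ0 : Q = 0 := by
      rw [hQ, cfc_congr (g := fun _ => (0 : ℝ)), cfc_const_zero, posTrace_zero]
      intro x hx
      obtain ⟨hx0, hxt⟩ := hsp hx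
      have h1 : x ≤ 1 := hxt.trans (le_of_not_gt fun h => by linarith [Real.log_pos h])
      exact max_eq_right (by linarith [Real.negMulLog_nonneg hx0 h1])
    have hr : Real.negMulLog t = -Real.log t * t := by simp [Real.negMulLog, mul_comm]
    have hmul : 0 ≤ -Real.log t * t := mul_nonneg (by linarith) ht0
    rw [hr, heq, hQ0]
    by_cases hSf : opEntropy A.op = ∞
    · rw [hSf, top_add]; rfl
    · rw [← EReal.coe_ennreal_toReal (ENNReal.add_ne_top.2 ⟨hSf, ENNReal.ofReal_ne_top⟩),
        ENNReal.toReal_add hSf ENNReal.ofReal_ne_top, ENNReal.toReal_ofReal hmul,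
        EReal.coe_ennreal_zero, sub_zero, ← EReal.coe_sub, add_sub_cancel_right]
      conv_rhs => rw [← ENNReal.ofReal_toReal hSf]
      rfl

end PosTraceClass

/-! ### Rank-one trace-class operators. -/

section Kets

variable {H : Type*} [NormedAddCommGroup H] [InnerProductSpace ℂ H] [CompleteSpace H]

theorem posTrace_ketBra_ne_top (v : H) : posTrace (ketBra v) ≠ ∞ := by
  rw [posTrace_ketBra]; simp

/-- The rank-one operator `|v⟩⟨v|` as a trace-class operator. -/
def TraceClass.ket (v : H) : TraceClass H :=
  TraceClass.ofPos (ketBra v) (ketBra_nonneg v) (posTrace_ketBra_ne_top v)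

open TraceClass

theorem op_ket (v : H) : (ket v).op = ketBra v := rfl

theorem ket_mem_posCone (v : H) : ket v ∈ posCone H := mem_posCone_iff.2 (ketBra_nonneg v)

theorem ket_smul (c : ℂ) (v : H) : ket (c • v) = (‖c‖ ^ 2 : ℝ) • ket v :=
  op_injective (ketBra_smul c v)

theorem ket_zero : ket (0 : H) = 0 := op_injective ketBra_zero

theorem op_sum_ket {ι : Type*} (s : Finset ι) (v : ι → H) :
    (∑ i ∈ s, ket (v i)).op = ∑ i ∈ s, ketBra (v i) := op_sum s _

theorem sum_ket_mem_posCone {ι : Type*} (s : Finset ι) (v : ι → H) :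
    ∑ i ∈ s, ket (v i) ∈ posCone H := sum_mem_posCone fun _ _ => ket_mem_posCone _

theorem posTrace_sum_ket {ι : Type*} (s : Finset ι) (v : ι → H) :
    posTrace (∑ i ∈ s, ket (v i)).op = ∑ i ∈ s, ‖v i‖ₑ ^ 2 := by
  rw [op_sum_ket, posTrace_sum_ketBra]

theorem norm_ket (v : H) : ‖ket v‖ = ‖v‖ ^ 2 := by
  rw [← toReal_posTrace_op (ket_mem_posCone v), op_ket, posTrace_ketBra]; simp

theorem hasSum_ket_sqrt {ι : Type*} {A : TraceClass H} (hA : A ∈ posCone H)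
    (e : HilbertBasis ι ℂ H) : HasSum (fun i => ket (CFC.sqrt A.op (e i))) A :=
  hasSum_traceClass hA (fun _ => ket_mem_posCone _)
    (fun s => sum_ketBra_sqrt_le (mem_posCone_iff.1 hA) e.orthonormal s)
    (posTrace_eq_tsum_ketBra_sqrt (mem_posCone_iff.1 hA) e)

end Kets

/-! ### Estimates for the output entropy. -/

section OutputEntropy

open TraceClass

variable {H : Type*} [NormedAddCommGroup H] [InnerProductSpace ℂ H] [CompleteSpace H]
  {K : Type*} [NormedAddCommGroup K] [InnerProductSpace ℂ K] [CompleteSpace K]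
  {Φ : TraceClass H →ₗ[ℂ] TraceClass K}

theorem map_real_smul_traceClass (Φ : TraceClass H →ₗ[ℂ] TraceClass K) (c : ℝ)
    (A : TraceClass H) : Φ (c • A) = c • Φ A :=
  Φ.map_smul_of_tower c A

namespace IsPositiveTraceNonincreasing

theorem outputEntropy_eq (hΦ : IsPositiveTraceNonincreasing Φ) {A : TraceClass H}
    (hA : A ∈ posCone H) : outputEntropy Φ A = opEntropy (Φ A).op :=
  entropy_eq_opEntropy (hΦ.map_pos A hA)

theorem outputEntropy_zero (hΦ : IsPositiveTraceNonincreasing Φ) : outputEntropy Φ 0 = 0 := by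
  rw [hΦ.outputEntropy_eq zero_mem_posCone, map_zero, op_zero, opEntropy_zero]

theorem outputEntropy_smul (hΦ : IsPositiveTraceNonincreasing Φ) {c : ℝ} (hc : 0 ≤ c)
    {A : TraceClass H} (hA : A ∈ posCone H) :
    outputEntropy Φ (c • A) = ENNReal.ofReal c * outputEntropy Φ A := by
  have hA' := hΦ.map_pos A hA
  rw [hΦ.outputEntropy_eq hA, hΦ.outputEntropy_eq (smul_mem_posCone hc hA),
    map_real_smul_traceClass, op_real_smul,
    opEntropy_smul hc (mem_posCone_iff.1 hA') (posTrace_op_ne_top hA')]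

theorem map_le (hΦ : IsPositiveTraceNonincreasing Φ) {A B : TraceClass H} (h : A.op ≤ B.op) :
    (Φ A).op ≤ (Φ B).op := by
  have h1 : B - A ∈ posCone H := by rw [mem_posCone_iff, op_sub]; exact sub_nonneg.2 h
  have h2 := mem_posCone_iff.1 (hΦ.map_pos _ h1)
  rw [map_sub, op_sub] at h2
  exact sub_nonneg.1 h2

theorem outputEntropy_add_sub_le (hΦ : IsPositiveTraceNonincreasing Φ) {A B : TraceClass H}
    (hA : A ∈ posCone H) (hB : B ∈ posCone H) (h : A.op ≤ B.op) :
    outputEntropy Φ A + outputEntropy Φ (B - A) ≤ outputEntropy Φ B := by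
  have h1 : B - A ∈ posCone H := by rw [mem_posCone_iff, op_sub]; exact sub_nonneg.2 h
  rw [hΦ.outputEntropy_eq hA, hΦ.outputEntropy_eq hB, hΦ.outputEntropy_eq h1, map_sub, op_sub]
  exact opEntropy_add_sub_le (mem_posCone_iff.1 (hΦ.map_pos A hA)) (hΦ.map_le h)
    (posTrace_op_ne_top (hΦ.map_pos B hB))

theorem outputEntropy_mono (hΦ : IsPositiveTraceNonincreasing Φ) {A B : TraceClass H}
    (hA : A ∈ posCone H) (hB : B ∈ posCone H) (h : A.op ≤ B.op) :
    outputEntropy Φ A ≤ outputEntropy Φ B :=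
  le_self_add.trans (hΦ.outputEntropy_add_sub_le hA hB h)

theorem outputEntropy_add_le (hΦ : IsPositiveTraceNonincreasing Φ) {A B : TraceClass H}
    (hA : A ∈ posCone H) (hB : B ∈ posCone H) {s : ℝ} (hs : 0 < s) (hs1 : s ≤ 1) :
    outputEntropy Φ (A + B) ≤ outputEntropy Φ A + outputEntropy Φ B +
      (ENNReal.ofReal s * (posTrace A.op + posTrace B.op) +
        ENNReal.ofReal (Real.log (1 / s)) * posTrace B.op) := by
  have hA' := hΦ.map_pos A hA
  have hB' := hΦ.map_pos B hB
  rw [hΦ.outputEntropy_eq hA, hΦ.outputEntropy_eq hB, hΦ.outputEntropy_eq (add_mem_posCone hA hB),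
    map_add, op_add]
  refine (opEntropy_add_le (mem_posCone_iff.1 hA') (mem_posCone_iff.1 hB')
    (posTrace_op_ne_top hA') (posTrace_op_ne_top hB') hs hs1).trans ?_
  have h1 := hΦ.trace_le A hA
  have h2 := hΦ.trace_le B hB
  gcongr

/-- With `s = 1` the correction in `outputEntropy_add_le` is the total trace, so each additional
vector raises the constant by one. -/
theorem outputEntropy_sum_ket_le (hΦ : IsPositiveTraceNonincreasing Φ) {C : ℝ≥0∞}
    (hC : ∀ v : H, outputEntropy Φ (ket v) ≤ C * ‖v‖ₑ ^ 2) {ι : Type*} (s : Finset ι)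
    (w : ι → H) :
    outputEntropy Φ (∑ i ∈ s, ket (w i)) ≤ (C + s.card) * ∑ i ∈ s, ‖w i‖ₑ ^ 2 := by
  classical
  induction s using Finset.induction_on with
  | empty => simp [hΦ.outputEntropy_zero]
  | insert a s ha ih =>
    rw [Finset.sum_insert ha, Finset.sum_insert ha, Finset.card_insert_of_notMem ha]
    refine (hΦ.outputEntropy_add_le (ket_mem_posCone _) (sum_ket_mem_posCone s w) one_pos
      le_rfl).trans ?_
    rw [posTrace_sum_ket, op_ket, posTrace_ketBra]
    simp only [ne_eq, one_ne_zero, not_false_eq_true, div_self, Real.log_one, ENNReal.ofReal_zero,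
      zero_mul, add_zero, ENNReal.ofReal_one, one_mul]
    push_cast
    calc _ ≤ C * ‖w a‖ₑ ^ 2 + (C + s.card) * ∑ i ∈ s, ‖w i‖ₑ ^ 2 +
          (‖w a‖ₑ ^ 2 + ∑ i ∈ s, ‖w i‖ₑ ^ 2) := by gcongr; exact hC _
      _ ≤ C * ‖w a‖ₑ ^ 2 + (C + s.card) * ∑ i ∈ s, ‖w i‖ₑ ^ 2 +
          (‖w a‖ₑ ^ 2 + ∑ i ∈ s, ‖w i‖ₑ ^ 2) + s.card * ‖w a‖ₑ ^ 2 := le_self_add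
      _ = (C + (s.card + 1)) * (‖w a‖ₑ ^ 2 + ∑ i ∈ s, ‖w i‖ₑ ^ 2) := by ring

/-- Quantitative continuity of the output entropy on sums of finitely many rank-one operators. -/
theorem outputEntropy_sum_ket_le_add (hΦ : IsPositiveTraceNonincreasing Φ) {C : ℝ≥0∞}
    (hC : ∀ v : H, outputEntropy Φ (ket v) ≤ C * ‖v‖ₑ ^ 2) {ι : Type*} (s : Finset ι)
    (v w : ι → H) {δ : ℝ} (hδ : 0 < δ) (hδ1 : δ ≤ 1) :
    outputEntropy Φ (∑ i ∈ s, ket (v i)) ≤ outputEntropy Φ (∑ i ∈ s, ket (w i)) +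
      (ENNReal.ofReal δ * (C + s.card + 2) * ∑ i ∈ s, ‖w i‖ₑ ^ 2 +
        ENNReal.ofReal (1 + δ⁻¹) * (C + s.card + 1 + ENNReal.ofReal (Real.log (1 / δ))) *
          ∑ i ∈ s, ‖v i - w i‖ₑ ^ 2) := by
  have hW := sum_ket_mem_posCone s w
  have hD := sum_ket_mem_posCone s (fun i => v i - w i)
  have h1 : (0 : ℝ) ≤ 1 + δ := by positivity
  have h2 : (0 : ℝ) ≤ 1 + δ⁻¹ := by positivity
  have hle : (∑ i ∈ s, ket (v i)).op ≤
      ((1 + δ) • ∑ i ∈ s, ket (w i) + (1 + δ⁻¹) • ∑ i ∈ s, ket (v i - w i)).op := by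
    rw [op_add, op_real_smul, op_real_smul, op_sum_ket, op_sum_ket, op_sum_ket, Finset.smul_sum,
      Finset.smul_sum, ← Finset.sum_add_distrib]
    refine Finset.sum_le_sum fun i _ => ?_
    have := ketBra_add_le hδ (w i) (v i - w i)
    rwa [add_sub_cancel] at this
  have h3 := hΦ.outputEntropy_mono (sum_ket_mem_posCone s v)
    (add_mem_posCone (smul_mem_posCone h1 hW) (smul_mem_posCone h2 hD)) hle
  -- The same `δ` serves as the weight in Young's inequality and as the parameter `s` of the binary
  -- entropy bound.
  have h4 := hΦ.outputEntropy_add_le (smul_mem_posCone h1 hW) (smul_mem_posCone h2 hD) hδ hδ1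
  rw [hΦ.outputEntropy_smul h1 hW, hΦ.outputEntropy_smul h2 hD, op_real_smul, op_real_smul,
    posTrace_smul h1, posTrace_smul h2, posTrace_sum_ket, posTrace_sum_ket] at h4
  have h5 := hΦ.outputEntropy_sum_ket_le hC s w
  have h6 := hΦ.outputEntropy_sum_ket_le hC s (fun i => v i - w i)
  refine h3.trans (h4.trans ?_)
  set X := outputEntropy Φ (∑ i ∈ s, ket (w i))
  set Y := outputEntropy Φ (∑ i ∈ s, ket (v i - w i))
  set x := ∑ i ∈ s, ‖w i‖ₑ ^ 2
  set y := ∑ i ∈ s, ‖v i - w i‖ₑ ^ 2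
  set L := ENNReal.ofReal (Real.log (1 / δ))
  set d := ENNReal.ofReal δ with hd
  set D := ENNReal.ofReal (1 + δ⁻¹)
  have hd1 : d ≤ 1 := by rw [hd]; exact ENNReal.ofReal_le_one.2 hδ1
  rw [ENNReal.ofReal_add zero_le_one hδ.le, ENNReal.ofReal_one, ← hd]
  calc (1 + d) * X + D * Y + (d * ((1 + d) * x + D * y) + L * (D * y))
      = X + d * X + D * Y + (d * ((1 + d) * x) + d * (D * y) + L * (D * y)) := by ring
    _ ≤ X + d * ((C + s.card) * x) + D * ((C + s.card) * y) +
        (d * ((1 + 1) * x) + 1 * (D * y) + L * (D * y)) := by gcongr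
    _ = _ := by ring

/-- On positive remainders `Φ` does not increase the trace, hence not the trace norm, so convergence
is inherited without a general continuity statement for `Φ`. -/
theorem hasSum_map (hΦ : IsPositiveTraceNonincreasing Φ) {ι : Type*} {B : ι → TraceClass H}
    {A : TraceClass H} (h : HasSum B A) (hle : ∀ s : Finset ι, (∑ i ∈ s, B i).op ≤ A.op) :
    HasSum (fun i => Φ (B i)) (Φ A) := by
  rw [HasSum, tendsto_iff_norm_sub_tendsto_zero] at h ⊢
  refine tendsto_of_tendsto_of_tendsto_of_le_of_le tendsto_const_nhds h
    (fun _ => norm_nonneg _) fun s => ?_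
  have hpos : A - ∑ i ∈ s, B i ∈ posCone H := by
    rw [mem_posCone_iff, op_sub]; exact sub_nonneg.2 (hle s)
  have hpos' := hΦ.map_pos _ hpos
  simp only
  rw [← norm_neg, neg_sub, ← norm_neg (∑ i ∈ s, B i - A), neg_sub, ← map_sum, ← map_sub,
    ← toReal_posTrace_op hpos, ← toReal_posTrace_op hpos']
  exact ENNReal.toReal_mono (posTrace_op_ne_top hpos) (hΦ.trace_le _ hpos)

/-- Decompose `A` into its rank-one spectral parts and apply subadditivity to their images at a
common scale `θ`. A part with eigenvalue `a` contributes at most `C a + a log (θ / a)`, and these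
sum to the right-hand side. Finite partial sums suffice by lower semicontinuity. -/
theorem outputEntropy_le_entropy_add (hΦ : IsPositiveTraceNonincreasing Φ) {C : ℝ≥0∞}
    (hC : ∀ v : H, outputEntropy Φ (ket v) ≤ C * ‖v‖ₑ ^ 2) {A : TraceClass H}
    (hA : A ∈ posCone H) :
    outputEntropy Φ A ≤ entropy A + (C + 1) * posTrace A.op := by
  have hpos := mem_posCone_iff.1 hA
  have hfin := posTrace_op_ne_top hA
  rcases eq_or_ne (posTrace A.op) 0 with h0 | h0
  · have : A = 0 := op_injective (eq_zero_of_posTrace_eq_zero hpos h0)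
    rw [this, hΦ.outputEntropy_zero]; exact bot_le
  obtain ⟨ι, e, a, ha⟩ := exists_hilbertBasis_eigenvectors hpos hfin
  set t := (posTrace A.op).toReal with ht
  have ht0 : 0 < t := ENNReal.toReal_pos h0 hfin
  -- The factor `e` puts all eigenvalues in the range where `scaledEta θ` increases, so image traces
  -- may be replaced by eigenvalues; it also gives `scaledEta θ t = t`, the source of the `1` in `C
  -- + 1`.
  set θ := Real.exp 1 * t with hθ
  have hθ0 : 0 < θ := by positivity
  have htθ : t ≤ θ := by
    rw [hθ]; nlinarith [Real.add_one_le_exp 1]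
  have htr : posTrace A.op = ENNReal.ofReal t := (ENNReal.ofReal_toReal hfin).symm
  let B : ι → TraceClass H := fun i => ket (CFC.sqrt A.op (e i))
  have hB : ∀ i, B i ∈ posCone H := fun i => ket_mem_posCone _
  have hle : ∀ s : Finset ι, (∑ i ∈ s, B i).op ≤ A.op := fun s => by
    rw [op_sum_ket]; exact sum_ketBra_sqrt_le hpos e.orthonormal s
  have hBtr : ∀ i, posTrace (B i).op = ENNReal.ofReal (a i) := fun i => by
    rw [op_ket, posTrace_ketBra, ← ofReal_re_inner hpos,
      re_inner_eigenvector (e.orthonormal.1 i) (ha i)]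
  have hat : ∀ i, 0 ≤ a i ∧ a i ≤ t := fun i =>
    ⟨eigenvalue_nonneg hpos (e.orthonormal.1 i) (ha i), by
      rw [← re_inner_eigenvector (e.orthonormal.1 i) (ha i)]
      exact re_inner_le_posTrace hpos hfin (e.orthonormal.1 i)⟩
  have hterm : ∀ i, scaledEntropy θ (Φ (B i)).op ≤
      C * ENNReal.ofReal (a i) + ENNReal.ofReal (scaledEta θ (a i)) := by
    intro i
    have hBi := hΦ.map_pos _ (hB i)
    have h1 : posTrace (Φ (B i)).op ≤ ENNReal.ofReal (a i) := by
      rw [← hBtr i]; exact hΦ.trace_le _ (hB i)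
    have h2 : (posTrace (Φ (B i)).op).toReal ≤ a i := ENNReal.toReal_le_of_le_ofReal (hat i).1 h1
    rw [scaledEntropy_eq_opEntropy_add (mem_posCone_iff.1 hBi) (posTrace_op_ne_top hBi)
      (h2.trans ((hat i).2.trans htθ)), ← hΦ.outputEntropy_eq (hB i)]
    refine add_le_add ?_ (ENNReal.ofReal_le_ofReal ?_)
    · refine (hC _).trans (le_of_eq ?_)
      rw [← posTrace_ketBra, ← hBtr i]; rfl
    · refine scaledEta_mono ENNReal.toReal_nonneg h2 ?_
      rw [hθ]; gcongr; exact (hat i).2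
  have hsum : ∑' i, (C * ENNReal.ofReal (a i) + ENNReal.ofReal (scaledEta θ (a i))) =
      entropy A + (C + 1) * posTrace A.op := by
    rw [ENNReal.tsum_add, ENNReal.tsum_mul_left, ← scaledEntropy_eq_tsum_eigenvalues hpos
      (spectrum_subset_Icc hpos hθ0.le (htr.le.trans (ENNReal.ofReal_le_ofReal htθ))) e ha,
      scaledEntropy_eq_opEntropy_add hpos hfin htθ, ← ht, entropy_eq_opEntropy hA]
    have h1 : ∑' i, ENNReal.ofReal (a i) = posTrace A.op := by
      rw [posTrace_eq_tsum_ketBra_sqrt hpos e]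
      exact tsum_congr fun i => (hBtr i).symm
    have h2 : ENNReal.ofReal (scaledEta θ t) = posTrace A.op := by
      rw [htr, scaledEta_eq, hθ, Real.log_mul (Real.exp_pos 1).ne' ht0.ne', Real.log_exp]
      congr 1; ring
    rw [h1, h2]; ring
  have hlim := hasSum_op (hΦ.hasSum_map (hasSum_ket_sqrt hA e) hle)
  have hAp := hΦ.map_pos A hA
  have htΦ : posTrace (Φ A).op ≤ ENNReal.ofReal t := htr ▸ hΦ.trace_le A hA
  rw [hΦ.outputEntropy_eq hA]
  refine (opEntropy_le_scaledEntropy (mem_posCone_iff.1 hAp) (posTrace_op_ne_top hAp)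
    ((ENNReal.toReal_le_of_le_ofReal ht0.le htΦ).trans htθ)).trans ?_
  refine scaledEntropy_le_of_tendsto hlim
    (fun s => Finset.sum_nonneg fun i _ => mem_posCone_iff.1 (hΦ.map_pos _ (hB i)))
    (mem_posCone_iff.1 hAp) hθ0.ne' (.of_forall fun s => ?_)
  refine (scaledEntropy_sum_le s (fun i => mem_posCone_iff.1 (hΦ.map_pos _ (hB i))) hθ0.le
    ?_).trans ?_
  · rw [← op_sum s (fun i => Φ (B i)), ← map_sum]
    refine (posTrace_mono (hΦ.map_le (hle s))).trans (htΦ.trans (ENNReal.ofReal_le_ofReal htθ))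
  · rw [← hsum]
    exact (Finset.sum_le_sum fun i _ => hterm i).trans (ENNReal.sum_le_tsum s)

end IsPositiveTraceNonincreasing

theorem isPositiveTraceNonincreasing_id :
    IsPositiveTraceNonincreasing (LinearMap.id : TraceClass H →ₗ[ℂ] TraceClass H) :=
  ⟨fun _ h => h, fun _ _ => le_rfl⟩

theorem outputEntropy_id (A : TraceClass H) :
    outputEntropy (LinearMap.id : TraceClass H →ₗ[ℂ] TraceClass H) A = entropy A := rfl

theorem entropy_ket (v : H) : entropy (ket v) = 0 := by
  rw [entropy_eq_opEntropy (ket_mem_posCone v), op_ket, opEntropy_ketBra]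

end OutputEntropy

/-! ### Limits of extended nonnegative reals by two-sided additive estimates. -/

section ENNRealLimits

theorem ENNReal.eventually_close {α : Type*} {l : Filter α} {f : α → ℝ≥0∞} {a : ℝ≥0∞}
    (h : Tendsto f l (𝓝 a)) (ha : a ≠ ∞) {ε : ℝ≥0∞} (hε : ε ≠ 0) :
    ∀ᶠ x in l, f x ≤ a + ε ∧ a ≤ f x + ε := by
  filter_upwards [(ENNReal.tendsto_nhds ha).1 h ε (pos_iff_ne_zero.2 hε)] with x hx
  exact ⟨hx.2, tsub_le_iff_right.1 hx.1⟩

theorem ENNReal.tendsto_of_eventually_close {α : Type*} {l : Filter α} {f : α → ℝ≥0∞} {a : ℝ≥0∞}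
    (ha : a ≠ ∞) (h : ∀ ε : ℝ≥0∞, ε ≠ 0 → ∀ᶠ x in l, f x ≤ a + ε ∧ a ≤ f x + ε) :
    Tendsto f l (𝓝 a) := by
  refine (ENNReal.tendsto_nhds ha).2 fun ε hε => ?_
  filter_upwards [h ε hε.ne'] with x hx
  exact ⟨tsub_le_iff_right.2 hx.2, hx.1⟩

theorem ENNReal.exists_ofReal_mul_le {M : ℝ≥0∞} (hM : M ≠ ∞) {ε : ℝ≥0∞} (hε : ε ≠ 0) :
    ∃ δ : ℝ, 0 < δ ∧ δ ≤ 1 ∧ ENNReal.ofReal δ * M ≤ ε := by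
  have h : Tendsto (fun δ : ℝ => ENNReal.ofReal δ * M) (𝓝[>] 0) (𝓝 0) := by
    have h1 : Tendsto (fun δ : ℝ => ENNReal.ofReal δ) (𝓝[>] 0) (𝓝 0) := by
      have h2 := (ENNReal.continuous_ofReal.tendsto 0).mono_left (nhdsWithin_le_nhds (s := Set.Ioi 0))
      rwa [ENNReal.ofReal_zero] at h2
    simpa using ENNReal.Tendsto.mul_const h1 (Or.inr hM)
  have h3 : ∀ᶠ δ : ℝ in 𝓝[>] 0, ENNReal.ofReal δ * M ≤ ε :=
    (h.eventually (eventually_le_nhds (pos_iff_ne_zero.2 hε)))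
  have h4 : ∀ᶠ δ : ℝ in 𝓝[>] 0, δ ∈ Set.Ioc (0 : ℝ) 1 := Ioc_mem_nhdsGT one_pos
  obtain ⟨δ, h5, h6⟩ := (h3.and h4).exists
  exact ⟨δ, h6.1, h6.2, h5⟩

theorem ENNReal.exists_mul_le {c : ℝ≥0∞} (hc : c ≠ ∞) {ε : ℝ≥0∞} (hε : ε ≠ 0) :
    ∃ η : ℝ≥0∞, η ≠ 0 ∧ c * η ≤ ε := by
  obtain ⟨δ, h1, -, h2⟩ := ENNReal.exists_ofReal_mul_le hc hε
  exact ⟨ENNReal.ofReal δ, by simpa using h1, by rwa [mul_comm]⟩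

end ENNRealLimits

/-! ### Continuity of the square root of an operator. -/

section SquareRoots

open TraceClass

variable {H : Type*} [NormedAddCommGroup H] [InnerProductSpace ℂ H] [CompleteSpace H]
  {α : Type*} {l : Filter α} {A : α → TraceClass H} {S : TraceClass H}

theorem tendsto_posTrace_op (h : Tendsto A l (𝓝 S)) (hA : ∀ᶠ y in l, A y ∈ posCone H)
    (hS : S ∈ posCone H) : Tendsto (fun y => posTrace (A y).op) l (𝓝 (posTrace S.op)) := by
  rw [posTrace_op_eq hS]
  refine (ENNReal.tendsto_ofReal h.norm).congr' ?_
  filter_upwards [hA] with y hy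
  exact (posTrace_op_eq hy).symm

theorem tendsto_sqrt_op (h : Tendsto A l (𝓝 S)) (hA : ∀ᶠ y in l, A y ∈ posCone H)
    (hS : S ∈ posCone H) : Tendsto (fun y => CFC.sqrt (A y).op) l (𝓝 (CFC.sqrt S.op)) := by
  have h1 := (CFC.continuousOn_sqrt (A := H →L[ℂ] H)).continuousWithinAt (mem_posCone_iff.1 hS)
  refine h1.tendsto.comp (tendsto_nhdsWithin_iff.2 ⟨(continuous_op.tendsto S).comp h, ?_⟩)
  filter_upwards [hA] with y hy
  exact mem_posCone_iff.1 hy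

theorem tendsto_sqrt_op_apply (h : Tendsto A l (𝓝 S)) (hA : ∀ᶠ y in l, A y ∈ posCone H)
    (hS : S ∈ posCone H) (x : H) :
    Tendsto (fun y => CFC.sqrt (A y).op x) l (𝓝 (CFC.sqrt S.op x)) :=
  ((ContinuousLinearMap.apply ℂ H x).continuous.tendsto _).comp (tendsto_sqrt_op h hA hS)

theorem tendsto_sum_enorm_sq {ι : Type*} (s : Finset ι) {v : α → ι → H} {w : ι → H}
    (h : ∀ i, Tendsto (fun y => v y i) l (𝓝 (w i))) :
    Tendsto (fun y => ∑ i ∈ s, ‖v y i‖ₑ ^ 2) l (𝓝 (∑ i ∈ s, ‖w i‖ₑ ^ 2)) :=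
  tendsto_finsetSum s fun i _ => ENNReal.Tendsto.pow ((continuous_enorm.tendsto _).comp (h i))

theorem tendsto_sum_enorm_sub_sq {ι : Type*} (s : Finset ι) {v : α → ι → H} {w : ι → H}
    (h : ∀ i, Tendsto (fun y => v y i) l (𝓝 (w i))) :
    Tendsto (fun y => ∑ i ∈ s, ‖v y i - w i‖ₑ ^ 2) l (𝓝 0) := by
  have := tendsto_sum_enorm_sq s (v := fun y i => v y i - w i) (w := 0)
    (fun i => by simpa using (h i).sub_const (w i))
  simpa using this

theorem enorm_sub_sq_le {E : Type*} [SeminormedAddCommGroup E] (a b : E) :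
    ‖a - b‖ₑ ^ 2 ≤ 2 * (‖a‖ₑ ^ 2 + ‖b‖ₑ ^ 2) := by
  have h : ‖a - b‖ ^ 2 ≤ 2 * (‖a‖ ^ 2 + ‖b‖ ^ 2) := by
    have h1 := norm_add_sq_le_weighted one_pos a (-b)
    rw [norm_neg, ← sub_eq_add_neg] at h1
    norm_num at h1
    linarith
  have h2 := ENNReal.ofReal_le_ofReal h
  rw [ENNReal.ofReal_mul (by norm_num), ENNReal.ofReal_add (by positivity) (by positivity),
    ENNReal.ofReal_pow (norm_nonneg _), ENNReal.ofReal_pow (norm_nonneg _),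
    ENNReal.ofReal_pow (norm_nonneg _)] at h2
  simpa only [ofReal_norm, ENNReal.ofReal_ofNat] using h2

/-- The square root is continuous from the trace norm to the Hilbert–Schmidt norm. -/
theorem tendsto_posTrace_sqrt_sub (h : Tendsto A l (𝓝 S)) (hA : ∀ᶠ y in l, A y ∈ posCone H)
    (hS : S ∈ posCone H) :
    Tendsto (fun y => posTrace (star (CFC.sqrt (A y).op - CFC.sqrt S.op) *
      (CFC.sqrt (A y).op - CFC.sqrt S.op))) l (𝓝 0) := by
  obtain ⟨ι, e, -⟩ := exists_hilbertBasis ℂ H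
  have hpos := mem_posCone_iff.1 hS
  have hfin := posTrace_op_ne_top hS
  refine ENNReal.tendsto_of_eventually_close ENNReal.zero_ne_top fun ε hε => ?_
  -- `9 = 1 + 2 (3 + 1)`: the finite block `F`, then twice the sum of the tails of `A y` and `S`.
  obtain ⟨η, hη, hηε⟩ := ENNReal.exists_mul_le (c := 9) (by norm_num) hε
  have hsum : Tendsto (fun s : Finset ι => ∑ i ∈ s, ‖CFC.sqrt S.op (e i)‖ₑ ^ 2) atTop
      (𝓝 (posTrace S.op)) := by
    rw [posTrace_eq_tsum_sqrt hpos e]; exact ENNReal.summable.hasSum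
  -- `F` carries almost all of the trace of `S`. Convergence of the total trace and of the block
  -- over `F` then forces the tails of nearby `A y` to be small.
  obtain ⟨F, hF⟩ := (ENNReal.eventually_close hsum hfin hη).exists
  have hv := fun i => tendsto_sqrt_op_apply h hA hS (e i)
  have hFs : ∑ i ∈ F, ‖CFC.sqrt S.op (e i)‖ₑ ^ 2 ≤ posTrace S.op := by
    rw [posTrace_eq_tsum_sqrt hpos e]; exact ENNReal.sum_le_tsum F
  filter_upwards [hA, ENNReal.eventually_close (tendsto_sum_enorm_sq F hv)
      (hFs.trans_lt hfin.lt_top).ne hη,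
    ENNReal.eventually_close (tendsto_sum_enorm_sub_sq F hv) ENNReal.zero_ne_top hη,
    ENNReal.eventually_close (tendsto_posTrace_op h hA hS) hfin hη] with y hy h1 h2 h3
  refine ⟨?_, bot_le⟩
  have hypos := mem_posCone_iff.1 hy
  rw [posTrace_star_mul_self _ e, zero_add, ← ENNReal.sum_add_tsum_compl F]
  have htail : ∀ T : H →L[ℂ] H, 0 ≤ T → posTrace T ≠ ∞ → ∀ c : ℝ≥0∞,
      posTrace T ≤ ∑ i ∈ F, ‖CFC.sqrt T (e i)‖ₑ ^ 2 + c →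
        ∑' i : ((F : Set ι)ᶜ : Set ι), ‖CFC.sqrt T (e i)‖ₑ ^ 2 ≤ c := by
    intro T hT hTf c hc
    have hsplit := posTrace_eq_tsum_sqrt hT e
    rw [← ENNReal.sum_add_tsum_compl F] at hsplit
    rw [hsplit] at hc hTf
    exact (ENNReal.add_le_add_iff_left (ENNReal.add_ne_top.1 hTf).1).1 hc
  have hS_tail := htail S.op hpos hfin η hF.2
  have hA_tail := htail (A y).op hypos (posTrace_op_ne_top hy) (3 * η) (by
    calc posTrace (A y).op ≤ posTrace S.op + η := h3.1
      _ ≤ (∑ i ∈ F, ‖CFC.sqrt S.op (e i)‖ₑ ^ 2 + η) + η := by gcongr; exact hF.2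
      _ ≤ ((∑ i ∈ F, ‖CFC.sqrt (A y).op (e i)‖ₑ ^ 2 + η) + η) + η := by gcongr; exact h1.2
      _ = _ := by ring)
  calc _ ≤ η + ∑' i : ((F : Set ι)ᶜ : Set ι),
        2 * (‖CFC.sqrt (A y).op (e i)‖ₑ ^ 2 + ‖CFC.sqrt S.op (e i)‖ₑ ^ 2) := by
        refine add_le_add ?_ (ENNReal.tsum_le_tsum fun i => ?_)
        · simpa using h2.1
        · rw [_root_.sub_apply]; exact enorm_sub_sq_le _ _
    _ ≤ η + 2 * (3 * η + η) := by
        rw [ENNReal.tsum_mul_left, ENNReal.tsum_add]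
        gcongr
    _ = 9 * η := by ring
    _ ≤ ε := hηε

end SquareRoots

/-! ### Finite-rank truncations and continuity where the entropy is continuous. -/

section Truncation

open TraceClass

variable {H : Type*} [NormedAddCommGroup H] [InnerProductSpace ℂ H] [CompleteSpace H]
  {K : Type*} [NormedAddCommGroup K] [InnerProductSpace ℂ K] [CompleteSpace K]
  {Φ : TraceClass H →ₗ[ℂ] TraceClass K}

/-- The part `√A P √A` of a positive operator `A`, where `P` projects on finitely many vectors of
an orthonormal basis. -/
def truncation {ι : Type*} (e : ι → H) (s : Finset ι) (A : TraceClass H) : TraceClass H :=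
  ∑ i ∈ s, ket (CFC.sqrt A.op (e i))

theorem truncation_mem_posCone {ι : Type*} (e : ι → H) (s : Finset ι) (A : TraceClass H) :
    truncation e s A ∈ posCone H := sum_ket_mem_posCone _ _

theorem op_truncation_le {ι : Type*} {e : ι → H} (he : Orthonormal ℂ e) (s : Finset ι)
    {A : TraceClass H} (hA : A ∈ posCone H) : (truncation e s A).op ≤ A.op := by
  rw [truncation, op_sum_ket]; exact sum_ketBra_sqrt_le (mem_posCone_iff.1 hA) he s

theorem sub_truncation_mem_posCone {ι : Type*} {e : ι → H} (he : Orthonormal ℂ e) (s : Finset ι)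
    {A : TraceClass H} (hA : A ∈ posCone H) : A - truncation e s A ∈ posCone H := by
  rw [mem_posCone_iff, op_sub]; exact sub_nonneg.2 (op_truncation_le he s hA)

theorem posTrace_truncation_add {ι : Type*} {e : ι → H} (he : Orthonormal ℂ e) (s : Finset ι)
    {A : TraceClass H} (hA : A ∈ posCone H) :
    posTrace (truncation e s A).op + posTrace (A - truncation e s A).op = posTrace A.op := by
  rw [← posTrace_add (mem_posCone_iff.1 (truncation_mem_posCone e s A))
    (mem_posCone_iff.1 (sub_truncation_mem_posCone he s hA)), op_sub, add_sub_cancel]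

theorem tendsto_truncation {ι : Type*} (e : HilbertBasis ι ℂ H) {A : TraceClass H}
    (hA : A ∈ posCone H) : Tendsto (fun s => truncation e s A) atTop (𝓝 A) :=
  hasSum_ket_sqrt hA e

theorem entropy_truncation_add_le {ι : Type*} {e : ι → H} (he : Orthonormal ℂ e) (s : Finset ι)
    {A : TraceClass H} (hA : A ∈ posCone H) :
    entropy (truncation e s A) + entropy (A - truncation e s A) ≤ entropy A :=
  isPositiveTraceNonincreasing_id.outputEntropy_add_sub_le (truncation_mem_posCone e s A) hA
    (op_truncation_le he s hA)

/-- The entropies increase with `s` by superadditivity, and lower semicontinuity identifies their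
supremum. -/
theorem tendsto_entropy_truncation {ι : Type*} (e : HilbertBasis ι ℂ H) {A : TraceClass H}
    (hA : A ∈ posCone H) :
    Tendsto (fun s => entropy (truncation e s A)) atTop (𝓝 (entropy A)) := by
  have hmono : Monotone fun s => entropy (truncation e s A) := by
    intro s t hst
    refine isPositiveTraceNonincreasing_id.outputEntropy_mono (truncation_mem_posCone _ _ _)
      (truncation_mem_posCone _ _ _) ?_
    change (∑ i ∈ s, ket (CFC.sqrt A.op (e i))).op ≤ (∑ i ∈ t, ket (CFC.sqrt A.op (e i))).op
    rw [op_sum_ket, op_sum_ket]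
    exact Finset.sum_le_sum_of_subset_of_nonneg hst fun i _ _ => ketBra_nonneg _
  have hsup : ⨆ s, entropy (truncation e s A) = entropy A := by
    refine le_antisymm (iSup_le fun s => le_self_add.trans
      (entropy_truncation_add_le e.orthonormal s hA)) ?_
    have h := tendsto_truncation e hA
    rw [entropy_eq_opEntropy hA]
    refine opEntropy_le_of_tendsto ((continuous_op.tendsto A).comp h)
      (fun s => mem_posCone_iff.1 (truncation_mem_posCone e s A)) (mem_posCone_iff.1 hA)
      (posTrace_op_ne_top hA)
      (tendsto_posTrace_op h (.of_forall fun s => truncation_mem_posCone e s A) hA)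
      (.of_forall fun s => ?_)
    rw [Function.comp_apply, ← entropy_eq_opEntropy (truncation_mem_posCone e s A)]
    exact le_iSup (fun s => entropy (truncation e s A)) s
  rw [← hsup]
  exact tendsto_atTop_iSup hmono

namespace IsPositiveTraceNonincreasing

theorem outputEntropy_sum_ket_ne_top (hΦ : IsPositiveTraceNonincreasing Φ) {C : ℝ≥0∞}
    (hCtop : C ≠ ∞) (hC : ∀ v : H, outputEntropy Φ (ket v) ≤ C * ‖v‖ₑ ^ 2) {ι : Type*}
    (s : Finset ι) (w : ι → H) : outputEntropy Φ (∑ i ∈ s, ket (w i)) ≠ ∞ := by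
  refine ((hΦ.outputEntropy_sum_ket_le hC s w).trans_lt (ENNReal.mul_lt_top ?_ ?_)).ne
  · exact ENNReal.add_lt_top.2 ⟨hCtop.lt_top, ENNReal.natCast_lt_top _⟩
  · exact ENNReal.sum_lt_top.2 fun i _ => by simp

theorem tendsto_outputEntropy_sum_ket (hΦ : IsPositiveTraceNonincreasing Φ) {C : ℝ≥0∞}
    (hCtop : C ≠ ∞) (hC : ∀ v : H, outputEntropy Φ (ket v) ≤ C * ‖v‖ₑ ^ 2) {ι : Type*}
    (s : Finset ι) {α : Type*} {l : Filter α} {v : α → ι → H} {w : ι → H}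
    (h : ∀ i, Tendsto (fun y => v y i) l (𝓝 (w i))) :
    Tendsto (fun y => outputEntropy Φ (∑ i ∈ s, ket (v y i))) l
      (𝓝 (outputEntropy Φ (∑ i ∈ s, ket (w i)))) := by
  refine ENNReal.tendsto_of_eventually_close (hΦ.outputEntropy_sum_ket_ne_top hCtop hC s w)
    fun ε hε => ?_
  have hx : ∑ i ∈ s, ‖w i‖ₑ ^ 2 ≠ ∞ := (ENNReal.sum_lt_top.2 fun i _ => by simp).ne
  -- The estimate is used in both directions; the `+ 1` lets the same `δ` serve with the sum of the
  -- nearby `‖v y i‖ₑ ^ 2` in place of that of `w`.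
  set M := (C + s.card + 2) * (∑ i ∈ s, ‖w i‖ₑ ^ 2 + 1) with hM
  have hMtop : M ≠ ∞ := by
    rw [hM]; finiteness
  obtain ⟨δ, hδ, hδ1, hδM⟩ := ENNReal.exists_ofReal_mul_le hMtop (ENNReal.half_pos hε).ne'
  obtain ⟨η, hη, hηε⟩ := ENNReal.exists_mul_le (c := ENNReal.ofReal (1 + δ⁻¹) *
    (C + s.card + 1 + ENNReal.ofReal (Real.log (1 / δ)))) (by finiteness)
    (ENNReal.half_pos hε).ne'
  filter_upwards [ENNReal.eventually_close (tendsto_sum_enorm_sq s h) hx one_ne_zero,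
    ENNReal.eventually_close (tendsto_sum_enorm_sub_sq s h) ENNReal.zero_ne_top hη] with y h1 h2
  have h3 : ∑ i ∈ s, ‖v y i - w i‖ₑ ^ 2 ≤ η := by simpa using h2.1
  have h4 : ∑ i ∈ s, ‖w i - v y i‖ₑ ^ 2 ≤ η := by
    refine le_trans (le_of_eq (Finset.sum_congr rfl fun i _ => ?_)) h3
    rw [← enorm_neg, neg_sub]
  constructor
  · refine (hΦ.outputEntropy_sum_ket_le_add hC s (v y) w hδ hδ1).trans ?_
    refine add_le_add le_rfl ?_
    rw [← ENNReal.add_halves ε]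
    refine add_le_add (le_trans ?_ hδM) (le_trans ?_ hηε)
    · rw [hM, mul_assoc]; gcongr; exact le_self_add
    · gcongr
  · refine (hΦ.outputEntropy_sum_ket_le_add hC s w (v y) hδ hδ1).trans ?_
    refine add_le_add le_rfl ?_
    rw [← ENNReal.add_halves ε]
    refine add_le_add (le_trans ?_ hδM) (le_trans ?_ hηε)
    · rw [hM, mul_assoc]; gcongr; exact h1.1
    · gcongr

theorem outputEntropy_le_truncation_add (hΦ : IsPositiveTraceNonincreasing Φ) {C : ℝ≥0∞}
    (hC : ∀ v : H, outputEntropy Φ (ket v) ≤ C * ‖v‖ₑ ^ 2) {ι : Type*} {e : ι → H}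
    (he : Orthonormal ℂ e) (s : Finset ι) {A : TraceClass H} (hA : A ∈ posCone H) {δ : ℝ}
    (hδ : 0 < δ) (hδ1 : δ ≤ 1) :
    outputEntropy Φ A ≤ outputEntropy Φ (truncation e s A) +
      (ENNReal.ofReal δ * posTrace A.op + entropy (A - truncation e s A) +
        (ENNReal.ofReal (Real.log (1 / δ)) + C + 1) * posTrace (A - truncation e s A).op) := by
  have hT := truncation_mem_posCone e s A
  have hR := sub_truncation_mem_posCone he s hA
  have h1 := hΦ.outputEntropy_add_le hT hR hδ hδ1
  rw [add_sub_cancel, posTrace_truncation_add he s hA] at h1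
  refine h1.trans ?_
  calc _ ≤ outputEntropy Φ (truncation e s A) +
        (entropy (A - truncation e s A) + (C + 1) * posTrace (A - truncation e s A).op) +
        (ENNReal.ofReal δ * posTrace A.op +
          ENNReal.ofReal (Real.log (1 / δ)) * posTrace (A - truncation e s A).op) := by
        gcongr; exact hΦ.outputEntropy_le_entropy_add hC hR
    _ = _ := by ring

/-- An output entropy that is bounded on pure states is continuous wherever the entropy is. -/
theorem finiteContinuousOn_of_entropy (hΦ : IsPositiveTraceNonincreasing Φ) {C : ℝ≥0∞}
    (hCtop : C ≠ ∞) (hC : ∀ v : H, outputEntropy Φ (ket v) ≤ C * ‖v‖ₑ ^ 2)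
    {𝒜 : Set (TraceClass H)} (h𝒜 : 𝒜 ⊆ posCone H) (hent : FiniteContinuousOn entropy 𝒜) :
    FiniteContinuousOn (outputEntropy Φ) 𝒜 := by
  have hfin : ∀ A ∈ 𝒜, outputEntropy Φ A < ∞ := fun A hA => by
    refine (hΦ.outputEntropy_le_entropy_add hC (h𝒜 hA)).trans_lt ?_
    have h1 := (hent.1 A hA).ne
    have h2 := posTrace_op_ne_top (h𝒜 hA)
    finiteness
  refine ⟨hfin, fun A hA => ?_⟩
  obtain ⟨ι, e, -⟩ := exists_hilbertBasis ℂ H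
  have he := e.orthonormal
  have hAp := h𝒜 hA
  have hAtr := posTrace_op_ne_top hAp
  have hAent := (hent.1 A hA).ne
  have hl : Tendsto (fun B => B) (𝓝[𝒜] A) (𝓝 A) := nhdsWithin_le_nhds
  have hmem : ∀ᶠ B in 𝓝[𝒜] A, B ∈ posCone H :=
    eventually_nhdsWithin_of_forall fun B hB => h𝒜 hB
  refine ENNReal.tendsto_of_eventually_close (hfin A hA).ne fun ε hε => ?_
  have hε4 : ε / 4 ≠ 0 := (ENNReal.div_pos hε (by norm_num)).ne'
  have hM : posTrace A.op + 1 ≠ ∞ := by finiteness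
  obtain ⟨δ, hδ, hδ1, hδM⟩ := ENNReal.exists_ofReal_mul_le hM hε4
  set c := ENNReal.ofReal (Real.log (1 / δ)) + C + 1 with hc
  obtain ⟨η, hη, hηε⟩ := ENNReal.exists_mul_le (c := 3 + c * 3) (by rw [hc]; finiteness) hε4
  obtain ⟨s, hs1, hs2⟩ := ((ENNReal.eventually_close (tendsto_entropy_truncation e hAp) hAent
    hη).and (ENNReal.eventually_close (tendsto_posTrace_op (tendsto_truncation e hAp)
      (.of_forall fun s => truncation_mem_posCone e s A) hAp) hAtr hη)).exists
  have hv := fun i => tendsto_sqrt_op_apply hl hmem hAp (e i)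
  -- The identity map satisfies the basic bound with `C = 0`, so the results on output entropies
  -- apply to the entropy itself.
  have hCid : ∀ v : H, outputEntropy (LinearMap.id : TraceClass H →ₗ[ℂ] TraceClass H) (ket v) ≤
      0 * ‖v‖ₑ ^ 2 := fun v => by rw [outputEntropy_id, entropy_ket]; exact bot_le
  have hE : Tendsto (fun B => entropy (truncation e s B)) (𝓝[𝒜] A)
      (𝓝 (entropy (truncation e s A))) :=
    isPositiveTraceNonincreasing_id.tendsto_outputEntropy_sum_ket ENNReal.zero_ne_top hCid s hv
  have hO : Tendsto (fun B => outputEntropy Φ (truncation e s B)) (𝓝[𝒜] A)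
      (𝓝 (outputEntropy Φ (truncation e s A))) :=
    hΦ.tendsto_outputEntropy_sum_ket hCtop hC s hv
  have hT : Tendsto (fun B => posTrace (truncation e s B).op) (𝓝[𝒜] A)
      (𝓝 (posTrace (truncation e s A).op)) := by
    simp_rw [truncation, posTrace_sum_ket]
    exact tendsto_sum_enorm_sq s hv
  have hEfin : entropy (truncation e s A) ≠ ∞ :=
    isPositiveTraceNonincreasing_id.outputEntropy_sum_ket_ne_top ENNReal.zero_ne_top hCid s _
  have hOfin : outputEntropy Φ (truncation e s A) ≠ ∞ :=
    hΦ.outputEntropy_sum_ket_ne_top hCtop hC s _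
  -- Superadditivity turns these hypotheses into bounds on the entropy and trace of the remainder.
  -- The three `η` are spent going from `B` to `A`, from `A` to its truncation, and from that to the
  -- truncation of `B`.
  have hbound : ∀ B ∈ 𝒜, posTrace B.op ≤ posTrace A.op + 1 →
      entropy B ≤ entropy (truncation e s B) + 3 * η →
      posTrace B.op ≤ posTrace (truncation e s B).op + 3 * η →
      outputEntropy Φ B ≤ outputEntropy Φ (truncation e s B) + ε / 2 := by
    intro B hB h1 h2 h3
    have hBp := h𝒜 hB
    have h4 : entropy (B - truncation e s B) ≤ 3 * η := by
      have h := entropy_truncation_add_le he s hBp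
      exact (ENNReal.add_le_add_iff_left ((le_self_add.trans h).trans_lt (hent.1 B hB)).ne).1
        (h.trans h2)
    have h5 : posTrace (B - truncation e s B).op ≤ 3 * η := by
      have h := posTrace_truncation_add he s hBp
      rw [← h] at h3
      exact (ENNReal.add_le_add_iff_left
        (posTrace_op_ne_top (truncation_mem_posCone e s B))).1 h3
    refine (hΦ.outputEntropy_le_truncation_add hC he s hBp hδ hδ1).trans ?_
    refine add_le_add le_rfl ?_
    calc _ ≤ ENNReal.ofReal δ * (posTrace A.op + 1) + 3 * η + c * (3 * η) := by gcongr
      _ = ENNReal.ofReal δ * (posTrace A.op + 1) + (3 + c * 3) * η := by ring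
      _ ≤ ε / 4 + ε / 4 := add_le_add hδM hηε
      _ = ε / 2 := by
        rw [ENNReal.div_add_div_same, ← two_mul, ENNReal.div_eq_inv_mul, ENNReal.div_eq_inv_mul,
          show (4 : ℝ≥0∞) = 2 * 2 by norm_num,
          ENNReal.mul_inv (Or.inl (by norm_num)) (Or.inl (by norm_num)), ← mul_assoc,
          mul_assoc (2⁻¹ : ℝ≥0∞), ENNReal.inv_mul_cancel (by norm_num) (by norm_num), mul_one]
  have h3η : η ≤ 3 * η := le_mul_of_one_le_left bot_le (by norm_num)
  have hA1 := hbound A hA le_self_add (hs1.2.trans (by gcongr)) (hs2.2.trans (by gcongr))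
  have hε2 : ε / 2 ≠ 0 := (ENNReal.half_pos hε).ne'
  have htrunc : ∀ B ∈ 𝒜, outputEntropy Φ (truncation e s B) ≤ outputEntropy Φ B := fun B hB =>
    hΦ.outputEntropy_mono (truncation_mem_posCone e s B) (h𝒜 hB)
      (op_truncation_le he s (h𝒜 hB))
  filter_upwards [self_mem_nhdsWithin, ENNReal.eventually_close (hent.2 A hA) hAent hη,
    ENNReal.eventually_close (tendsto_posTrace_op hl hmem hAp) hAtr hη,
    ENNReal.eventually_close (tendsto_posTrace_op hl hmem hAp) hAtr one_ne_zero,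
    ENNReal.eventually_close hE hEfin hη, ENNReal.eventually_close hO hOfin hε2,
    ENNReal.eventually_close hT (posTrace_op_ne_top (truncation_mem_posCone e s A)) hη]
    with B hB h1 h2 h3 h4 h5 h6
  have hB1 := hbound B hB h3.1 (by
    calc entropy B ≤ entropy A + η := h1.1
      _ ≤ (entropy (truncation e s A) + η) + η := by gcongr; exact hs1.2
      _ ≤ ((entropy (truncation e s B) + η) + η) + η := by gcongr; exact h4.2
      _ = _ := by ring) (by
    calc posTrace B.op ≤ posTrace A.op + η := h2.1
      _ ≤ (posTrace (truncation e s A).op + η) + η := by gcongr; exact hs2.2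
      _ ≤ ((posTrace (truncation e s B).op + η) + η) + η := by gcongr; exact h6.2
      _ = _ := by ring)
  constructor
  · calc outputEntropy Φ B ≤ outputEntropy Φ (truncation e s B) + ε / 2 := hB1
      _ ≤ (outputEntropy Φ (truncation e s A) + ε / 2) + ε / 2 := by gcongr; exact h5.1
      _ ≤ outputEntropy Φ A + ε := by
        rw [add_assoc, ENNReal.add_halves]; gcongr; exact htrunc A hA
  · calc outputEntropy Φ A ≤ outputEntropy Φ (truncation e s A) + ε / 2 := hA1
      _ ≤ (outputEntropy Φ (truncation e s B) + ε / 2) + ε / 2 := by gcongr; exact h5.2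
      _ ≤ outputEntropy Φ B + ε := by
        rw [add_assoc, ENNReal.add_halves]; gcongr; exact htrunc B hB

end IsPositiveTraceNonincreasing

end Truncation

/-- Distinct members lie at distance `√2`, so the balls of radius `1/2` about them are disjoint. -/
theorem Orthonormal.countable {𝕜 E ι : Type*} [RCLike 𝕜] [NormedAddCommGroup E]
    [InnerProductSpace 𝕜 E] [TopologicalSpace.SeparableSpace E] {e : ι → E}
    (he : Orthonormal 𝕜 e) : Countable ι := by
  refine Pairwise.countable_of_isOpen_disjoint (s := fun i => Metric.ball (e i) (1 / 2))
    (fun i j hij => ?_) (fun _ => Metric.isOpen_ball)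
    (fun i => ⟨e i, Metric.mem_ball_self (by norm_num)⟩)
  refine Metric.ball_disjoint_ball ?_
  have h := norm_sub_sq (𝕜 := 𝕜) (e i) (e j)
  rw [he.1 i, he.1 j, he.2 hij, map_zero] at h
  rw [dist_eq_norm]
  nlinarith [norm_nonneg (e i - e j)]

/-! ### Factorization of vectors through the square root of an operator. -/

section Factorization

variable {H : Type*} [NormedAddCommGroup H] [InnerProductSpace ℂ H] [CompleteSpace H]

/-- A family of vectors is Bessel (with bound one) if `∑ |c i⟩⟨c i| ≤ 1`. -/
def IsBessel {ι : Type*} (c : ι → H) : Prop :=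
  ∀ (s : Finset ι) (x : H), ∑ i ∈ s, ‖⟪c i, x⟫_ℂ‖ ^ 2 ≤ ‖x‖ ^ 2

/-- The hypothesis says that `√T x ↦ ⟪b, x⟫` is a well-defined contraction on the range of `√T`.
Extend it to the closure and let `c` be its Riesz vector; self-adjointness of `√T` gives `√T c = b`.
-/
theorem exists_sqrt_apply_eq {T : H →L[ℂ] H} {b : H}
    (hb : ∀ x, ‖⟪b, x⟫_ℂ‖ ≤ ‖CFC.sqrt T x‖) :
    ∃ c ∈ (LinearMap.range (CFC.sqrt T).toLinearMap).topologicalClosure, CFC.sqrt T c = b := by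
  set R := LinearMap.range (CFC.sqrt T).toLinearMap with hR
  let e : H →ₗ[ℂ] R.topologicalClosure :=
    (CFC.sqrt T).toLinearMap.codRestrict _ fun x =>
      R.le_topologicalClosure (LinearMap.mem_range_self _ x)
  have hdense : DenseRange e := by
    intro y
    have hy := y.2
    rw [← SetLike.mem_coe, Submodule.topologicalClosure_coe] at hy
    rw [Topology.IsInducing.subtypeVal.closure_eq_preimage_closure_image, Set.mem_preimage]
    convert hy using 2
    rw [← Set.range_comp]
    exact (LinearMap.coe_range (CFC.sqrt T).toLinearMap).symm
  have hnorm : ∃ C, ∀ x, ‖((innerSL ℂ b : H →L[ℂ] ℂ) : H →ₗ[ℂ] ℂ) x‖ ≤ C * ‖e x‖ :=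
    ⟨1, fun x => by rw [one_mul]; exact hb x⟩
  have : CompleteSpace R.topologicalClosure := R.isClosed_topologicalClosure.completeSpace_coe
  set φ : R.topologicalClosure →L[ℂ] ℂ :=
    ((innerSL ℂ b : H →L[ℂ] ℂ) : H →ₗ[ℂ] ℂ).extendOfNorm e with hφ
  let c := (InnerProductSpace.toDual ℂ R.topologicalClosure).symm φ
  refine ⟨c, c.2, ext_inner_right ℂ fun x => ?_⟩
  have h1 : ⟪c, e x⟫_ℂ = φ (e x) := InnerProductSpace.toDual_symm_apply
  rw [hφ, LinearMap.extendOfNorm_eq hdense hnorm, Submodule.coe_inner] at h1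
  have h2 := ContinuousLinearMap.adjoint_inner_right (CFC.sqrt T) x (c : H)
  rw [← ContinuousLinearMap.star_eq_adjoint, star_sqrt] at h2
  rw [← inner_conj_symm, h2, inner_conj_symm]
  exact h1

/-- Vectors `b i` with `∑ |b i⟩⟨b i| ≤ T` are the images of a Bessel family under `√T`. -/
theorem exists_isBessel_sqrt_apply_eq {ι : Type*} {T : H →L[ℂ] H} (hT : 0 ≤ T) {b : ι → H}
    (hb : ∀ s : Finset ι, ∑ i ∈ s, ketBra (b i) ≤ T) :
    ∃ c : ι → H, IsBessel c ∧ ∀ i, CFC.sqrt T (c i) = b i := by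
  have h1 : ∀ (s : Finset ι) (x : H), ∑ i ∈ s, ‖⟪b i, x⟫_ℂ‖ ^ 2 ≤ ‖CFC.sqrt T x‖ ^ 2 := by
    intro s x
    rw [← re_inner_sum_ketBra, ← re_inner_eq_norm_sqrt hT]
    exact re_inner_mono (hb s) x
  have h2 : ∀ i, ∃ c ∈ (LinearMap.range (CFC.sqrt T).toLinearMap).topologicalClosure,
      CFC.sqrt T c = b i := fun i => exists_sqrt_apply_eq fun x => by
    have := h1 {i} x
    rw [Finset.sum_singleton] at this
    exact (pow_le_pow_iff_left₀ (norm_nonneg _) (norm_nonneg _) two_ne_zero).1 this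
  choose c hcmem hc using h2
  refine ⟨c, fun s x => ?_, hc⟩
  set R := LinearMap.range (CFC.sqrt T).toLinearMap
  -- On the range this is the hypothesis on the `b i`; it passes to the closure, and then to all of
  -- `H` by projection, since the `c i` lie in the closure.
  have h3 : ∀ y ∈ R.topologicalClosure, ∑ i ∈ s, ‖⟪c i, y⟫_ℂ‖ ^ 2 ≤ ‖y‖ ^ 2 := by
    intro y hy
    have hclosed : IsClosed {y : H | ∑ i ∈ s, ‖⟪c i, y⟫_ℂ‖ ^ 2 ≤ ‖y‖ ^ 2} :=
      isClosed_le (by fun_prop) (by fun_prop)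
    refine closure_minimal ?_ hclosed (by
      rwa [← SetLike.mem_coe, Submodule.topologicalClosure_coe] at hy)
    rintro _ ⟨z, rfl⟩
    refine le_trans (le_of_eq (Finset.sum_congr rfl fun i _ => ?_)) (h1 s z)
    have h4 := ContinuousLinearMap.adjoint_inner_left (CFC.sqrt T) z (c i)
    rw [← ContinuousLinearMap.star_eq_adjoint, star_sqrt, hc] at h4
    rw [h4]; rfl
  have : CompleteSpace R.topologicalClosure := R.isClosed_topologicalClosure.completeSpace_coe
  have h5 : ∀ i, ⟪c i, x⟫_ℂ = ⟪c i, R.topologicalClosure.starProjection x⟫_ℂ := fun i => by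
    rw [← Submodule.inner_starProjection_left_eq_right R.topologicalClosure (c i) x,
      Submodule.starProjection_eq_self_iff.2 (hcmem i)]
  simp_rw [h5]
  refine (h3 _ (Submodule.starProjection_apply_mem _ _)).trans ?_
  gcongr
  exact Submodule.norm_starProjection_apply_le _ _

variable {ι : Type*} {c : ι → H}

theorem IsBessel.sum_ketBra_sqrt_le (hc : IsBessel c) {T : H →L[ℂ] H} (hT : 0 ≤ T)
    (s : Finset ι) : ∑ i ∈ s, ketBra (CFC.sqrt T (c i)) ≤ T := by
  refine le_of_re_inner_le (sum_ketBra_nonneg _ _).isSelfAdjoint hT.isSelfAdjoint fun x => ?_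
  rw [re_inner_sum_ketBra, re_inner_eq_norm_sqrt hT]
  refine le_trans (le_of_eq (Finset.sum_congr rfl fun i _ => ?_)) (hc s (CFC.sqrt T x))
  have h4 := ContinuousLinearMap.adjoint_inner_left (CFC.sqrt T) x (c i)
  rw [← ContinuousLinearMap.star_eq_adjoint, star_sqrt] at h4
  rw [h4]

/-- Move `X` to the other side of the inner product with a basis and apply the Bessel bound to `X* f
j`. With `X = √A - √B` this bounds the transport error independently of the family. -/
theorem IsBessel.sum_enorm_sq_apply_le (hc : IsBessel c) (X : H →L[ℂ] H) (s : Finset ι) :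
    ∑ i ∈ s, ‖X (c i)‖ₑ ^ 2 ≤ posTrace (star X * X) := by
  obtain ⟨w, f, -⟩ := exists_hilbertBasis ℂ H
  have h := posTrace_star_mul_self (star X) f
  rw [star_star, ← posTrace_star_mul_self_comm] at h
  rw [h]
  simp_rw [← f.tsum_enorm_inner_sq (X _)]
  rw [← Summable.tsum_finsetSum fun i _ => ENNReal.summable]
  refine ENNReal.tsum_le_tsum fun j => ?_
  have h2 := ENNReal.ofReal_le_ofReal (hc s (star X (f j)))
  rw [ENNReal.ofReal_sum_of_nonneg (fun i _ => by positivity)] at h2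
  simp only [ENNReal.ofReal_pow (norm_nonneg _), ofReal_norm] at h2
  refine le_trans (le_of_eq (Finset.sum_congr rfl fun i _ => ?_)) h2
  rw [ContinuousLinearMap.star_eq_adjoint, ContinuousLinearMap.adjoint_inner_right,
    ← inner_conj_symm, RCLike.enorm_conj]

end Factorization

/-! ### Operators of bounded rank and continuity of the approximators. -/

section BoundedRank

open TraceClass

variable {H : Type*} [NormedAddCommGroup H] [InnerProductSpace ℂ H] [CompleteSpace H]

theorem op_sum_le_of_hasSum {ι : Type*} {E : ι → TraceClass H} {A : TraceClass H}
    (hE : ∀ i, E i ∈ posCone H) (hA : A ∈ posCone H) (h : HasSum E A) (s : Finset ι) :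
    ∑ i ∈ s, (E i).op ≤ A.op := by
  refine le_of_re_inner_le ?_ (mem_posCone_iff.1 hA).isSelfAdjoint fun x => ?_
  · exact (Finset.sum_nonneg fun i _ => mem_posCone_iff.1 (hE i)).isSelfAdjoint
  · rw [_root_.sum_apply, inner_sum, map_sum]
    exact sum_le_hasSum s (fun i _ => re_inner_nonneg (mem_posCone_iff.1 (hE i)) x)
      (hasSum_re_inner (hasSum_op h) x)

theorem sum_ket_mem_posConeRank {ι : Type*} (s : Finset ι) (b : ι → H) {k : ℕ} (hs : s.card ≤ k) :
    ∑ i ∈ s, ket (b i) ∈ posConeRank H k := by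
  classical
  refine ⟨sum_ket_mem_posCone s b, ?_⟩
  have h1 : LinearMap.range ((∑ i ∈ s, ket (b i)).op : H →ₗ[ℂ] H) ≤
      Submodule.span ℂ ((s.image b : Finset H) : Set H) := by
    rintro _ ⟨x, rfl⟩
    rw [op_sum_ket, ContinuousLinearMap.coe_coe, _root_.sum_apply]
    refine Submodule.sum_mem _ fun i hi => ?_
    rw [ketBra_apply]
    exact Submodule.smul_mem _ _ (Submodule.subset_span (by simpa using ⟨i, hi, rfl⟩))
  refine (Submodule.rank_mono h1).trans ((rank_span_finset_le _).trans ?_)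
  exact_mod_cast Finset.card_image_le.trans hs

theorem ket_mem_posConeRank (v : H) {k : ℕ} (hk : 1 ≤ k) : ket v ∈ posConeRank H k := by
  have := sum_ket_mem_posConeRank (Finset.univ : Finset (Fin 1)) (fun _ => v) (k := k) (by simpa)
  simpa using this

theorem zero_mem_posConeRank (k : ℕ) : (0 : TraceClass H) ∈ posConeRank H k := by
  simpa using sum_ket_mem_posConeRank (∅ : Finset ℕ) (fun _ => (0 : H)) (Nat.zero_le k)

/-- Eigenvectors with nonzero eigenvalue lie in the range, so there are at most `k` of them; unused
indices receive the zero vector. -/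
theorem exists_eq_sum_ket {A : TraceClass H} {k : ℕ} (hA : A ∈ posConeRank H k) :
    ∃ b : Fin k → H, A = ∑ j, ket (b j) := by
  have hpos := mem_posCone_iff.1 hA.1
  obtain ⟨ι, e, a, ha⟩ := exists_hilbertBasis_eigenvectors hpos (posTrace_op_ne_top hA.1)
  have hmem : ∀ i : {i // a i ≠ 0}, e i ∈ LinearMap.range (A.op : H →ₗ[ℂ] H) := fun i =>
    ⟨(a i : ℂ)⁻¹ • e i, by
      rw [ContinuousLinearMap.coe_coe, map_smul, ha,
        inv_smul_smul₀ (by exact_mod_cast i.2)]⟩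
  have hli : LinearIndependent ℂ
      fun i : {i // a i ≠ 0} => (⟨e i, hmem i⟩ : LinearMap.range (A.op : H →ₗ[ℂ] H)) := by
    refine LinearIndependent.of_comp (Submodule.subtype _) ?_
    exact (e.orthonormal.comp _ Subtype.val_injective).linearIndependent
  have hcard := hli.cardinal_le_rank.trans hA.2
  have hfin : Finite {i // a i ≠ 0} :=
    Cardinal.lt_aleph0_iff_finite.1 (hcard.trans_lt (Cardinal.natCast_lt_aleph0))
  have := Fintype.ofFinite {i // a i ≠ 0}
  rw [Cardinal.mk_fintype, Nat.cast_le] at hcard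
  obtain ⟨g⟩ := Function.Embedding.nonempty_of_card_le
    (α := {i // a i ≠ 0}) (β := Fin k) (by simpa using hcard)
  refine ⟨Function.extend g (fun i => CFC.sqrt A.op (e i)) 0, ?_⟩
  have h1 : HasSum (fun i : {i // a i ≠ 0} => ket (CFC.sqrt A.op (e i))) A := by
    refine (hasSum_subtype_iff_of_support_subset (s := {i | a i ≠ 0}) ?_).2 (hasSum_ket_sqrt hA.1 e)
    intro i hi h0
    refine hi ?_
    have h2 := re_inner_eq_norm_sqrt hpos (e i)
    rw [re_inner_eigenvector (e.orthonormal.1 i) (ha i), h0] at h2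
    have h3 : CFC.sqrt A.op (e i) = 0 := by simpa using h2.symm
    simp only [h3, ket_zero]
  rw [← hasSum_extend_zero g.injective] at h1
  refine h1.unique ?_
  convert hasSum_fintype _ using 2 with j
  by_cases hj : ∃ i, g i = j
  · obtain ⟨i, rfl⟩ := hj
    rw [g.injective.extend_apply, g.injective.extend_apply]
  · rw [Function.extend_apply' _ _ _ hj, Function.extend_apply' _ _ _ hj]
    exact ket_zero

theorem real_smul_mem_posConeRank {c : ℝ} (hc : 0 ≤ c) {A : TraceClass H} {k : ℕ}
    (hA : A ∈ posConeRank H k) : c • A ∈ posConeRank H k := by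
  obtain ⟨b, rfl⟩ := exists_eq_sum_ket hA
  have h : c • ∑ j, ket (b j) = ∑ j, ket ((Real.sqrt c : ℂ) • b j) := by
    rw [Finset.smul_sum]
    refine Finset.sum_congr rfl fun j _ => ?_
    rw [ket_smul, Complex.norm_real, Real.norm_eq_abs, sq_abs, Real.sq_sqrt hc]
  rw [h]
  exact sum_ket_mem_posConeRank _ _ (by simp)

variable {K : Type*} [NormedAddCommGroup K] [InnerProductSpace ℂ K] [CompleteSpace K]
  {Φ : TraceClass H →ₗ[ℂ] TraceClass K}

namespace IsPositiveTraceNonincreasing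

/-- Homogeneity absorbs the weights into the operators, so plain series with sum `A` may replace
convex combinations. -/
theorem approximator_le (hΦ : IsPositiveTraceNonincreasing Φ) {k : ℕ} {A : TraceClass H}
    {M : ℝ≥0∞} (h : ∀ E : ℕ → TraceClass H, (∀ i, E i ∈ posConeRank H k) → HasSum E A →
      ∑' i, outputEntropy Φ (E i) ≤ M) : approximator Φ k A ≤ M := by
  refine iSup_le fun π => iSup_le fun D => iSup_le fun hD => ?_
  refine le_trans (le_of_eq ?_) (h (fun i => π i • D i)
    (fun i => real_smul_mem_posConeRank (hD.nonneg i) (hD.mem i)) hD.hasSum)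
  exact tsum_congr fun i => (hΦ.outputEntropy_smul (hD.nonneg i) (hD.mem i).1).symm

theorem tsum_le_approximator (hΦ : IsPositiveTraceNonincreasing Φ) {ι : Type*} [Countable ι]
    {k : ℕ} {A : TraceClass H} {E : ι → TraceClass H} (hE : ∀ i, E i ∈ posConeRank H k)
    (h : HasSum E A) : ∑' i, outputEntropy Φ (E i) ≤ approximator Φ k A := by
  obtain ⟨g, hg⟩ := exists_injective_nat ι
  set F : ℕ → TraceClass H := Function.extend g E 0 with hF
  have hFmem : ∀ n, F n ∈ posConeRank H k := by
    intro n
    by_cases hn : ∃ i, g i = n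
    · obtain ⟨i, rfl⟩ := hn
      rw [hF, hg.extend_apply]; exact hE i
    · rw [hF, Function.extend_apply' _ _ _ hn]; exact zero_mem_posConeRank k
  -- Any strictly positive weights of sum one would do; they are undone by rescaling the operators.
  let π : ℕ → ℝ := fun n => 1 / 2 / 2 ^ n
  have hπ : ∀ n, 0 < π n := fun n => by positivity
  have hD : IsDecomposition (posConeRank H k) A π fun n => (π n)⁻¹ • F n := by
    refine ⟨fun n => (hπ n).le, hasSum_geometric_two' 1, fun n =>
      real_smul_mem_posConeRank (inv_nonneg.2 (hπ n).le) (hFmem n), ?_⟩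
    simp_rw [smul_inv_smul₀ (hπ _).ne']
    exact (hasSum_extend_zero hg).2 h
  refine le_trans ?_ (le_iSup_of_le π <| le_iSup_of_le _ <| le_iSup_of_le hD le_rfl)
  have h1 : ∀ n, ENNReal.ofReal (π n) * outputEntropy Φ ((π n)⁻¹ • F n) = outputEntropy Φ (F n) :=
    fun n => by
      rw [← hΦ.outputEntropy_smul (hπ n).le
        (smul_mem_posCone (inv_nonneg.2 (hπ n).le) (hFmem n).1), smul_inv_smul₀ (hπ _).ne']
  simp_rw [h1]
  have h2 : ∀ i, outputEntropy Φ (E i) = outputEntropy Φ (F (g i)) := fun i => by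
    rw [hF, hg.extend_apply]
  simp_rw [h2]
  exact ENNReal.tsum_comp_le_tsum_of_injective hg _

theorem outputEntropy_le_approximator (hΦ : IsPositiveTraceNonincreasing Φ) {k : ℕ}
    {A : TraceClass H} (hA : A ∈ posConeRank H k) : outputEntropy Φ A ≤ approximator Φ k A := by
  have := hΦ.tsum_le_approximator (ι := Unit) (fun _ => hA) (hasSum_unique (fun _ : Unit => A))
  simpa using this

/-- A partial decomposition is completed by splitting the positive remainder into rank-one operators
along a basis, which separability makes countable. -/
theorem sum_le_approximator [TopologicalSpace.SeparableSpace H]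
    (hΦ : IsPositiveTraceNonincreasing Φ) {k : ℕ} (hk : 1 ≤ k) {B : TraceClass H}
    {ι : Type*} (s : Finset ι) {V : ι → TraceClass H}
    (hV : ∀ i, V i ∈ posConeRank H k) (hle : ∑ i ∈ s, (V i).op ≤ B.op) :
    ∑ i ∈ s, outputEntropy Φ (V i) ≤ approximator Φ k B := by
  obtain ⟨w, e, -⟩ := exists_hilbertBasis ℂ H
  have hw : Countable w := Orthonormal.countable e.orthonormal
  have hR : B - ∑ i ∈ s, V i ∈ posCone H := by
    rw [mem_posCone_iff, op_sub, op_sum]; exact sub_nonneg.2 hle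
  have h1 : HasSum (fun i : s => V i) (∑ i ∈ s, V i) := s.hasSum V
  have h2 := HasSum.sum (f := Sum.elim (fun i : s => V i)
    fun n => ket (CFC.sqrt (B - ∑ i ∈ s, V i).op (e n))) (by simpa using h1)
    (by simpa using hasSum_ket_sqrt hR e)
  rw [add_sub_cancel] at h2
  refine le_trans ?_ (hΦ.tsum_le_approximator ?_ h2)
  · rw [Summable.tsum_sum ENNReal.summable ENNReal.summable]
    refine le_trans (le_of_eq ?_) le_self_add
    simp only [Sum.elim_inl]
    exact (Finset.tsum_subtype s fun i => outputEntropy Φ (V i)).symm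
  · rintro (i | n)
    · exact hV i
    · exact ket_mem_posConeRank _ hk

variable {C : ℝ≥0∞}

theorem approximator_le_mul_posTrace (hΦ : IsPositiveTraceNonincreasing Φ)
    (hC : ∀ v : H, outputEntropy Φ (ket v) ≤ C * ‖v‖ₑ ^ 2) {k : ℕ} {A : TraceClass H} :
    approximator Φ k A ≤ (C + k) * posTrace A.op := by
  refine hΦ.approximator_le fun E hE h => ?_
  rw [posTrace_hasSum (fun i => mem_posCone_iff.1 (hE i).1) (hasSum_op h), ← ENNReal.tsum_mul_left]
  refine ENNReal.tsum_le_tsum fun i => ?_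
  obtain ⟨b, hb⟩ := exists_eq_sum_ket (hE i)
  rw [hb, posTrace_sum_ket]
  simpa using hΦ.outputEntropy_sum_ket_le hC Finset.univ b

/-- Write the vectors of a decomposition of `A` as `√A c` with `c` Bessel. The vectors `√B c` give a
partial decomposition of `B` with the same rank bound, and `outputEntropy_sum_ket_le_add` compares
the groups one by one. The Bessel property sums the errors to multiples of `Tr B` and of the squared
Hilbert–Schmidt distance of the square roots. -/
theorem approximator_le_add [TopologicalSpace.SeparableSpace H]
    (hΦ : IsPositiveTraceNonincreasing Φ)
    (hC : ∀ v : H, outputEntropy Φ (ket v) ≤ C * ‖v‖ₑ ^ 2) {k : ℕ} (hk : 1 ≤ k)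
    {A B : TraceClass H} (hA : A ∈ posCone H) (hB : B ∈ posCone H) {δ : ℝ} (hδ : 0 < δ)
    (hδ1 : δ ≤ 1) :
    approximator Φ k A ≤ approximator Φ k B + (ENNReal.ofReal δ * (C + k + 2) * posTrace B.op +
      ENNReal.ofReal (1 + δ⁻¹) * (C + k + 1 + ENNReal.ofReal (Real.log (1 / δ))) *
        posTrace (star (CFC.sqrt A.op - CFC.sqrt B.op) * (CFC.sqrt A.op - CFC.sqrt B.op))) := by
  classical
  refine hΦ.approximator_le fun E hE h => ?_
  choose b hb using fun i => exists_eq_sum_ket (hE i)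
  have hle : ∀ s : Finset (ℕ × Fin k), ∑ p ∈ s, ketBra (b p.1 p.2) ≤ A.op := by
    intro s
    have hsub : s ⊆ (s.image Prod.fst) ×ˢ Finset.univ := fun p hp => by
      simpa using ⟨p.2, hp⟩
    refine (Finset.sum_le_sum_of_subset_of_nonneg hsub fun p _ _ => ketBra_nonneg _).trans ?_
    rw [Finset.sum_product]
    refine le_trans (le_of_eq (Finset.sum_congr rfl fun i _ => ?_))
      (op_sum_le_of_hasSum (fun i => (hE i).1) hA h (s.image Prod.fst))
    rw [hb i, op_sum_ket]
  obtain ⟨c, hc, hcb⟩ := exists_isBessel_sqrt_apply_eq (mem_posCone_iff.1 hA) hle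
  let V : ℕ → TraceClass H := fun i => ∑ j, ket (CFC.sqrt B.op (c (i, j)))
  rw [ENNReal.tsum_eq_iSup_sum]
  refine iSup_le fun t => ?_
  have hV : ∑ i ∈ t, outputEntropy Φ (V i) ≤ approximator Φ k B := by
    refine hΦ.sum_le_approximator hk t (fun i => sum_ket_mem_posConeRank _ _ (by simp)) ?_
    simp_rw [V, op_sum_ket]
    rw [← Finset.sum_product' t Finset.univ fun i j => ketBra (CFC.sqrt B.op (c (i, j)))]
    exact hc.sum_ketBra_sqrt_le (mem_posCone_iff.1 hB) _
  set X := CFC.sqrt A.op - CFC.sqrt B.op with hX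
  have h1 : ∑ i ∈ t, ∑ j, ‖CFC.sqrt B.op (c (i, j))‖ₑ ^ 2 ≤ posTrace B.op := by
    rw [← Finset.sum_product' t Finset.univ fun i j => ‖CFC.sqrt B.op (c (i, j))‖ₑ ^ 2]
    refine (hc.sum_enorm_sq_apply_le (CFC.sqrt B.op) _).trans (le_of_eq ?_)
    rw [star_sqrt_mul_sqrt (mem_posCone_iff.1 hB)]
  have h2 : ∑ i ∈ t, ∑ j, ‖X (c (i, j))‖ₑ ^ 2 ≤ posTrace (star X * X) := by
    rw [← Finset.sum_product' t Finset.univ fun i j => ‖X (c (i, j))‖ₑ ^ 2]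
    exact hc.sum_enorm_sq_apply_le X _
  set u := ENNReal.ofReal δ * (C + k + 2)
  set v := ENNReal.ofReal (1 + δ⁻¹) * (C + k + 1 + ENNReal.ofReal (Real.log (1 / δ)))
  have h4 : ∀ i ∈ t, outputEntropy Φ (E i) ≤ outputEntropy Φ (V i) +
      (u * ∑ j, ‖CFC.sqrt B.op (c (i, j))‖ₑ ^ 2 + v * ∑ j, ‖X (c (i, j))‖ₑ ^ 2) := by
    intro i _
    have h3 := hΦ.outputEntropy_sum_ket_le_add hC Finset.univ (b i)
      (fun j => CFC.sqrt B.op (c (i, j))) hδ hδ1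
    rw [Finset.card_univ, Fintype.card_fin] at h3
    rw [hb i]
    convert h3 using 6 with j
    rw [hX, _root_.sub_apply, hcb]
  refine (Finset.sum_le_sum h4).trans ?_
  rw [Finset.sum_add_distrib, Finset.sum_add_distrib, ← Finset.mul_sum, ← Finset.mul_sum]
  gcongr

/-- If the output entropy is bounded on pure states, its approximators are continuous. -/
theorem finiteContinuousOn_approximator [TopologicalSpace.SeparableSpace H]
    (hΦ : IsPositiveTraceNonincreasing Φ) (hCtop : C ≠ ∞)
    (hC : ∀ v : H, outputEntropy Φ (ket v) ≤ C * ‖v‖ₑ ^ 2) {k : ℕ} (hk : 1 ≤ k) :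
    FiniteContinuousOn (approximator Φ k) (posCone H) := by
  have hfin : ∀ A ∈ posCone H, approximator Φ k A < ∞ := fun A hA => by
    refine (hΦ.approximator_le_mul_posTrace hC).trans_lt ?_
    have := posTrace_op_ne_top hA
    finiteness
  refine ⟨hfin, fun A hA => ?_⟩
  have hl : Tendsto (fun B => B) (𝓝[posCone H] A) (𝓝 A) := nhdsWithin_le_nhds
  have hmem : ∀ᶠ B in 𝓝[posCone H] A, B ∈ posCone H := self_mem_nhdsWithin
  have hAtr := posTrace_op_ne_top hA
  refine ENNReal.tendsto_of_eventually_close (hfin A hA).ne fun ε hε => ?_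
  set M := (C + k + 2) * (posTrace A.op + 1) with hM
  obtain ⟨δ, hδ, hδ1, hδM⟩ := ENNReal.exists_ofReal_mul_le (M := M) (by rw [hM]; finiteness)
    (ENNReal.half_pos hε).ne'
  obtain ⟨η, hη, hηε⟩ := ENNReal.exists_mul_le (c := ENNReal.ofReal (1 + δ⁻¹) *
    (C + k + 1 + ENNReal.ofReal (Real.log (1 / δ)))) (by finiteness)
    (ENNReal.half_pos hε).ne'
  filter_upwards [hmem,
    ENNReal.eventually_close (tendsto_posTrace_op hl hmem hA) hAtr one_ne_zero,
    ENNReal.eventually_close (tendsto_posTrace_sqrt_sub hl hmem hA) ENNReal.zero_ne_top hη]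
    with B hB h1 h2
  have h3 : posTrace (star (CFC.sqrt B.op - CFC.sqrt A.op) *
      (CFC.sqrt B.op - CFC.sqrt A.op)) ≤ η := by simpa using h2.1
  have h4 : posTrace (star (CFC.sqrt A.op - CFC.sqrt B.op) *
      (CFC.sqrt A.op - CFC.sqrt B.op)) ≤ η := by
    rwa [← neg_sub (CFC.sqrt B.op), star_neg, neg_mul_neg]
  constructor
  · refine (hΦ.approximator_le_add hC hk hB hA hδ hδ1).trans (add_le_add le_rfl ?_)
    rw [← ENNReal.add_halves ε]
    refine add_le_add (le_trans ?_ hδM) (le_trans ?_ hηε)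
    · rw [hM, mul_assoc]; gcongr; exact le_self_add
    · gcongr
  · refine (hΦ.approximator_le_add hC hk hA hB hδ hδ1).trans (add_le_add le_rfl ?_)
    rw [← ENNReal.add_halves ε]
    refine add_le_add (le_trans ?_ hδM) (le_trans ?_ hηε)
    · rw [hM, mul_assoc]; gcongr; exact h1.1
    · gcongr

end IsPositiveTraceNonincreasing

end BoundedRank

/-! ### Relative entropy and the UA-property. -/

section RelativeEntropy

open TraceClass

variable {H : Type*} [NormedAddCommGroup H] [InnerProductSpace ℂ H] [CompleteSpace H]

theorem sqrt_apply_of_eigenvector {T : H →L[ℂ] H} (hT : 0 ≤ T) {f : H} {b : ℝ}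
    (h : T f = (b : ℂ) • f) : CFC.sqrt T f = (Real.sqrt b : ℂ) • f := by
  rw [CFC.sqrt_eq_real_sqrt T hT, cfcₙ_eq_cfc]
  exact cfc_apply_of_eigenvector hT.isSelfAdjoint h Real.continuous_sqrt

/-- Expanding `‖√D R (f j)‖²` in the eigenbasis of `D` puts a regularized `Tr D log (θ / A)` in the
double-series form of the relative entropy. -/
theorem posTrace_sqrtRegLog_conj_eq_tsum {D A : TraceClass H} (hD : D ∈ posCone H)
    (hA : A ∈ posCone H) {ι κ : Type*} {e : HilbertBasis ι ℂ H} {a : ι → ℝ}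
    (he : IsEigenbasis D e a) {f : HilbertBasis κ ℂ H} {b : κ → ℝ} (hf : IsEigenbasis A f b)
    {θ ε : ℝ} (hε : 0 < ε) (hb : ∀ j, 0 ≤ regLog θ ε (b j)) :
    posTrace (sqrtRegLog θ ε A.op * D.op * sqrtRegLog θ ε A.op) =
      ∑' i, ∑' j, ENNReal.ofReal (‖⟪f j, e i⟫_ℂ‖ ^ 2 * (a i * regLog θ ε (b j))) := by
  have hDp := mem_posCone_iff.1 hD
  have hstar : sqrtRegLog θ ε A.op * D.op * sqrtRegLog θ ε A.op =
      star (CFC.sqrt D.op * sqrtRegLog θ ε A.op) * (CFC.sqrt D.op * sqrtRegLog θ ε A.op) := by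
    rw [star_mul, star_sqrt, star_sqrtRegLog]
    conv_lhs => rw [← CFC.sqrt_mul_sqrt_self D.op hDp]
    simp only [mul_assoc]
  rw [hstar, posTrace_star_mul_self _ f, ENNReal.tsum_comm]
  refine tsum_congr fun j => ?_
  rw [← e.tsum_enorm_inner_sq]
  refine tsum_congr fun i => ?_
  have h1 : sqrtRegLog θ ε A.op (f j) = (Real.sqrt (regLog θ ε (b j)) : ℂ) • f j :=
    cfc_apply_of_eigenvector (mem_posCone_iff.1 hA).isSelfAdjoint (hf j)
      (continuous_sqrt_regLog θ hε)
  have ha : 0 ≤ a i := eigenvalue_nonneg hDp (e.orthonormal.1 i) (he i)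
  have h2 := ContinuousLinearMap.adjoint_inner_left (CFC.sqrt D.op) (f j) (e i)
  rw [← ContinuousLinearMap.star_eq_adjoint, star_sqrt, sqrt_apply_of_eigenvector hDp (he i),
    inner_smul_left] at h2
  rw [mul_apply_eq_comp, h1, map_smul, inner_smul_right, ← h2, ← ofReal_norm,
    ← ENNReal.ofReal_pow (norm_nonneg _)]
  congr 1
  rw [norm_mul, norm_mul, mul_pow, mul_pow, RCLike.norm_conj, Complex.norm_real, Complex.norm_real,
    Real.norm_eq_abs, Real.norm_eq_abs, sq_abs, sq_abs, Real.sq_sqrt ha, Real.sq_sqrt (hb j),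
    norm_inner_symm]
  ring

theorem regLog_one_le {ε b : ℝ} (hε : 0 < ε) (hb : 0 < b) (hb1 : b ≤ 1) :
    regLog 1 ε b ≤ -Real.log b := by
  have h : Real.log (b * (1 + ε)) ≤ Real.log (b + ε) :=
    Real.log_le_log (by positivity) (by nlinarith)
  rw [Real.log_mul hb.ne' (by positivity)] at h
  rw [regLog, max_eq_left hb.le]
  linarith

/-- Inclusion of supports means `ker A ⊆ ker D`. It removes the terms with eigenvalue `0` of `A`,
for which the value of `Real.log` carries no meaning. -/
theorem eigenvalue_mul_inner_eq_zero {D A : TraceClass H} (hD : D ∈ posCone H)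
    (hsupp : supp D ≤ supp A) {e f : H} {a : ℝ} (he : D.op e = (a : ℂ) • e) (hf : A.op f = 0) :
    (a : ℂ) * ⟪f, e⟫_ℂ = 0 := by
  have h1 : LinearMap.ker (A.op : H →ₗ[ℂ] H) ≤ LinearMap.ker (D.op : H →ₗ[ℂ] H) := by
    have hc : IsClosed ((LinearMap.ker (D.op : H →ₗ[ℂ] H) : Submodule ℂ H) : Set H) :=
      D.op.isClosed_ker
    have : CompleteSpace (LinearMap.ker (D.op : H →ₗ[ℂ] H)) := hc.completeSpace_coe
    rw [← Submodule.orthogonal_orthogonal (LinearMap.ker (D.op : H →ₗ[ℂ] H))]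
    exact (Submodule.le_orthogonal_orthogonal _).trans (Submodule.orthogonal_le hsupp)
  have h2 : D.op f = 0 := h1 (show f ∈ LinearMap.ker (A.op : H →ₗ[ℂ] H) from hf)
  rw [← inner_smul_right, ← he]
  have h3 := ContinuousLinearMap.adjoint_inner_left D.op e f
  rw [← ContinuousLinearMap.star_eq_adjoint, (mem_posCone_iff.1 hD).isSelfAdjoint.star_eq, h2,
    inner_zero_left] at h3
  exact h3.symm

theorem mul_max_neg_log_le_one {t : ℝ} (ht : 0 ≤ t) : t * max (-Real.log t) 0 ≤ 1 := by
  have h := mul_log_div_le ht one_pos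
  rw [Real.log_one, zero_sub] at h
  rcases max_cases (-Real.log t) 0 with ⟨h1, _⟩ | ⟨h1, _⟩ <;> rw [h1] <;> linarith

/-- From `-a log b` split off the relative entropy summand, drop `-b`, and rewrite `-a log a` as
`scaledEta t a - a log t`. -/
theorem mul_regLog_le {ε a b t : ℝ} (hε : 0 < ε) (ha : 0 ≤ a) (hb : 0 < b) (hb1 : b ≤ 1) :
    a * regLog 1 ε b ≤ (a * Real.log a - a * Real.log b + b - a) +
      (scaledEta t a + a * (1 + max (-Real.log t) 0)) := by
  have h1 := mul_le_mul_of_nonneg_left (regLog_one_le hε hb hb1) ha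
  have h2 := mul_le_mul_of_nonneg_left (le_max_left (-Real.log t) 0) ha
  rw [scaledEta_eq]
  linarith

/-- A regularized form of `Tr D log (1 / A) ≤ H(D‖A) + H(D) + Tr D + 1`, proved term by term in the
two eigenbases. The last `1` bounds `t log (1 / t)` for `t = Tr D`. -/
theorem posTrace_sqrtRegLog_conj_le_relEntropy {D A : TraceClass H} (hD : D ∈ posCone H)
    (hA : A ∈ posCone H) (hA1 : posTrace A.op ≤ 1) {ε : ℝ} (hε : 0 < ε) :
    posTrace (sqrtRegLog 1 ε A.op * D.op * sqrtRegLog 1 ε A.op) ≤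
      relEntropy D A + (entropy D + posTrace D.op + 1) := by
  classical
  rw [relEntropy]
  split_ifs with hsupp
  swap
  · simp
  rw [← tsub_le_iff_right]
  refine le_iInf fun u => le_iInf fun e => le_iInf fun a => le_iInf fun he => le_iInf fun v =>
    le_iInf fun f => le_iInf fun b => le_iInf fun hf => ?_
  rw [tsub_le_iff_right]
  have hDp := mem_posCone_iff.1 hD
  have hAp := mem_posCone_iff.1 hA
  have hDfin := posTrace_op_ne_top hD
  have hb : ∀ j, 0 ≤ b j ∧ b j ≤ 1 := fun j =>
    ⟨eigenvalue_nonneg hAp (f.orthonormal.1 j) (hf j), by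
      rw [← re_inner_eigenvector (f.orthonormal.1 j) (hf j)]
      refine (re_inner_le_posTrace hAp (posTrace_op_ne_top hA) (f.orthonormal.1 j)).trans ?_
      exact ENNReal.toReal_le_of_le_ofReal zero_le_one (by simpa using hA1)⟩
  have ha : ∀ i, 0 ≤ a i := fun i => eigenvalue_nonneg hDp (e.orthonormal.1 i) (he i)
  set t := (posTrace D.op).toReal with ht
  have hat : ∀ i, a i ≤ t := fun i => by
    rw [← re_inner_eigenvector (e.orthonormal.1 i) (he i)]
    exact re_inner_le_posTrace hDp hDfin (e.orthonormal.1 i)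
  set m := max (-Real.log t) 0 with hm
  have hm0 : 0 ≤ m := le_max_right _ _
  rw [posTrace_sqrtRegLog_conj_eq_tsum hD hA he hf hε
    fun j => regLog_nonneg hε zero_le_one (hb j).2]
  set q : u → ℝ := fun i => scaledEta t (a i) + a i * (1 + m) with hq
  have hq0 : ∀ i, 0 ≤ q i := fun i =>
    add_nonneg (scaledEta_nonneg (ha i) (hat i)) (mul_nonneg (ha i) (by linarith))
  have hterm : ∀ i j, ENNReal.ofReal (‖⟪f j, e i⟫_ℂ‖ ^ 2 * (a i * regLog 1 ε (b j))) ≤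
      ENNReal.ofReal (‖⟪f j, e i⟫_ℂ‖ ^ 2 *
        (a i * Real.log (a i) - a i * Real.log (b j) + b j - a i)) +
      ENNReal.ofReal (q i) * ‖⟪f j, e i⟫_ℂ‖ₑ ^ 2 := by
    intro i j
    rcases (hb j).1.eq_or_lt with h0 | h0
    · have h1 := eigenvalue_mul_inner_eq_zero hD hsupp (he i)
        (show A.op (f j) = 0 by rw [hf j, ← h0]; simp)
      have h2 : ‖⟪f j, e i⟫_ℂ‖ ^ 2 * (a i * regLog 1 ε (b j)) = 0 := by
        rcases mul_eq_zero.1 h1 with h | h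
        · rw [Complex.ofReal_eq_zero.1 h]; simp
        · rw [h]; simp
      rw [h2]; simp
    · rw [← ofReal_norm, ← ENNReal.ofReal_pow (norm_nonneg _), ← ENNReal.ofReal_mul (hq0 i),
        mul_comm (q i)]
      refine le_trans (ENNReal.ofReal_le_ofReal ?_) ENNReal.ofReal_add_le
      rw [← mul_add]
      exact mul_le_mul_of_nonneg_left (mul_regLog_le hε (ha i) h0 (hb j).2) (by positivity)
  refine (ENNReal.tsum_le_tsum fun i => ENNReal.tsum_le_tsum fun j => hterm i j).trans ?_
  simp_rw [ENNReal.tsum_add, ENNReal.tsum_mul_left, f.tsum_enorm_inner_sq]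
  refine add_le_add le_rfl ?_
  have hone : ∀ i, ‖e i‖ₑ ^ 2 = 1 := fun i => by
    rw [← ofReal_norm, e.orthonormal.1 i]; simp
  simp_rw [hone, mul_one]
  have hsplit : ∀ i, ENNReal.ofReal (q i) =
      ENNReal.ofReal (scaledEta t (a i)) + ENNReal.ofReal (a i) * ENNReal.ofReal (1 + m) :=
    fun i => by
      rw [hq, ENNReal.ofReal_add (scaledEta_nonneg (ha i) (hat i))
        (mul_nonneg (ha i) (by linarith)), ENNReal.ofReal_mul (ha i)]
  simp_rw [hsplit]
  have htr : ∑' i, ENNReal.ofReal (a i) = posTrace D.op := by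
    rw [posTrace_eq_tsum hDp e]
    exact tsum_congr fun i => by rw [re_inner_eigenvector (e.orthonormal.1 i) (he i)]
  rw [ENNReal.tsum_add, ENNReal.tsum_mul_right, htr, ← scaledEntropy_eq_tsum_eigenvalues hDp
    (spectrum_subset_posTrace hDp hDfin) e he, entropy_eq_opEntropy hD, opEntropy, add_assoc]
  refine add_le_add le_rfl ?_
  rw [ENNReal.ofReal_add zero_le_one hm0, ENNReal.ofReal_one, mul_add, mul_one]
  refine add_le_add le_rfl ?_
  rw [← ENNReal.ofReal_toReal hDfin, ← ht, ← ENNReal.ofReal_mul ENNReal.toReal_nonneg]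
  exact ENNReal.ofReal_le_one.2 (mul_max_neg_log_le_one ENNReal.toReal_nonneg)

/-- This is the rank-one sum estimate for the identity map, for which `C = 0`. -/
theorem entropy_le_of_mem_posConeRank {D : TraceClass H} {k : ℕ} (hD : D ∈ posConeRank H k) :
    entropy D ≤ k * posTrace D.op := by
  obtain ⟨b, rfl⟩ := exists_eq_sum_ket hD
  have h := isPositiveTraceNonincreasing_id.outputEntropy_sum_ket_le (C := 0)
    (fun v : H => by rw [outputEntropy_id, entropy_ket]; exact bot_le) Finset.univ b
  rw [posTrace_sum_ket]
  simpa [outputEntropy_id] using h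

/-- `Tr A log (1 / A)` is linear in the first `A`, so it splits along a decomposition into terms `π
i Tr (D i) log (1 / A)`. Each is bounded by relative entropy plus `(k + 1) Tr (D i) + 1`; averaging
with `Tr A ≤ 1` gives `k + 2`. -/
theorem entropy_le_approxGap_add {A : TraceClass H} (hA : A ∈ posCone H)
    (hA1 : posTrace A.op ≤ 1) (k : ℕ) : entropy A ≤ approxGap k A + (k + 2) := by
  rw [← tsub_le_iff_right]
  refine le_iInf fun π => le_iInf fun D => le_iInf fun hdec => ?_
  rw [tsub_le_iff_right]
  have hAp := mem_posCone_iff.1 hA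
  have hsp : spectrum ℝ A.op ⊆ Set.Icc 0 1 := spectrum_subset_Icc hAp zero_le_one (by simpa)
  rw [entropy_eq_opEntropy hA]
  refine (opEntropy_le_scaledEntropy hAp (posTrace_op_ne_top hA)
    (ENNReal.toReal_le_of_le_ofReal zero_le_one (by simpa using hA1))).trans ?_
  refine scaledEntropy_le_of_regLog hsp fun ε hε => ?_
  rw [← sqrtRegLog_conj_self hAp zero_le_one hε hsp]
  set R := sqrtRegLog 1 ε A.op with hR
  have hDp : ∀ i, 0 ≤ (D i).op := fun i => mem_posCone_iff.1 (hdec.mem i).1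
  have hop := hasSum_op hdec.hasSum
  simp_rw [op_real_smul] at hop
  have hsum : HasSum (fun i => R * (π i • (D i).op) * R) (R * A.op * R) :=
    (hop.mul_left R).mul_right R
  have hconj : ∀ i, R * (π i • (D i).op) * R = π i • (R * (D i).op * R) := fun i => by
    rw [mul_smul_comm, smul_mul_assoc]
  have hnonneg : ∀ i, 0 ≤ R * (D i).op * R := fun i => by
    have h := star_left_conjugate_nonneg (hDp i) R
    rwa [hR, star_sqrtRegLog] at h
  simp_rw [hconj] at hsum
  rw [posTrace_hasSum (fun i => real_smul_nonneg (hdec.nonneg i) (hnonneg i)) hsum]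
  simp_rw [posTrace_smul (hdec.nonneg _)]
  have htr : ∑' i, ENNReal.ofReal (π i) * posTrace (D i).op = posTrace A.op := by
    rw [posTrace_hasSum (fun i => real_smul_nonneg (hdec.nonneg i) (hDp i)) hop]
    simp_rw [posTrace_smul (hdec.nonneg _)]
  have hπ : ∑' i, ENNReal.ofReal (π i) = 1 := by
    rw [← ENNReal.ofReal_tsum_of_nonneg hdec.nonneg hdec.hasSum_one.summable,
      hdec.hasSum_one.tsum_eq, ENNReal.ofReal_one]
  calc _ ≤ ∑' i, (ENNReal.ofReal (π i) * relEntropy (D i) A +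
        ((k + 1) * (ENNReal.ofReal (π i) * posTrace (D i).op) + ENNReal.ofReal (π i))) := by
        refine ENNReal.tsum_le_tsum fun i => ?_
        refine (mul_le_mul_right (posTrace_sqrtRegLog_conj_le_relEntropy (hdec.mem i).1 hA hA1 hε)
          (ENNReal.ofReal (π i))).trans ?_
        calc _ ≤ ENNReal.ofReal (π i) * (relEntropy (D i) A +
              (k * posTrace (D i).op + posTrace (D i).op + 1)) := by
              gcongr; exact entropy_le_of_mem_posConeRank (hdec.mem i)
          _ = _ := by ring
    _ = ∑' i, ENNReal.ofReal (π i) * relEntropy (D i) A + ((k + 1) * posTrace A.op + 1) := by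
        rw [ENNReal.tsum_add, ENNReal.tsum_add, ENNReal.tsum_mul_left, htr, hπ]
    _ ≤ ∑' i, ENNReal.ofReal (π i) * relEntropy (D i) A + ((k + 1) * 1 + 1) := by gcongr
    _ = _ := by ring

end RelativeEntropy

/-! ### Pure states as rank-one projections. -/

section PureStates

open TraceClass

variable {H : Type*} [NormedAddCommGroup H] [InnerProductSpace ℂ H] [CompleteSpace H]

theorem posTrace_op_ket (v : H) : posTrace (ket v).op = ‖v‖ₑ ^ 2 := by
  rw [op_ket, posTrace_ketBra]

theorem ket_mem_states {v : H} (hv : ‖v‖ = 1) : ket v ∈ states H :=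
  ⟨ket_mem_posCone v, by rw [posTrace_op_ket, ← ofReal_norm, hv]; simp⟩

/-- A positive operator below a multiple of a rank-one projection is a multiple of it. -/
theorem eq_smul_ket_of_le {v : H} (hv : ‖v‖ = 1) {A : TraceClass H} (hA : A ∈ posCone H) {c : ℝ}
    (h : A.op ≤ c • ketBra v) : A = (‖CFC.sqrt A.op v‖ ^ 2 : ℝ) • ket v := by
  have hpos := mem_posCone_iff.1 hA
  -- Domination by a multiple of `|v⟩⟨v|` makes `√A` vanish on the orthogonal complement of `v`, so
  -- `√A` is determined by its value at `v`.
  have hker : ∀ w : H, ⟪v, w⟫_ℂ = 0 → CFC.sqrt A.op w = 0 := by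
    intro w hw
    have h1 := re_inner_mono h w
    rw [re_inner_eq_norm_sqrt hpos, _root_.smul_apply, ketBra_apply, hw] at h1
    simp only [zero_smul, smul_zero, inner_zero_right, map_zero] at h1
    have h2 : ‖CFC.sqrt A.op w‖ ^ 2 = 0 := le_antisymm h1 (by positivity)
    simpa using h2
  have hvv : ⟪v, v⟫_ℂ = 1 := by rw [inner_self_eq_norm_sq_to_K, hv]; simp
  have hsqrt : ∀ x : H, CFC.sqrt A.op x = ⟪v, x⟫_ℂ • CFC.sqrt A.op v := by
    intro x
    have h1 := hker (x - ⟪v, x⟫_ℂ • v) (by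
      rw [inner_sub_right, inner_smul_right, hvv, mul_one, sub_self])
    rwa [map_sub, map_smul, sub_eq_zero] at h1
  have hc : 0 ≤ (‖CFC.sqrt A.op v‖ ^ 2 : ℝ) • ketBra v :=
    real_smul_nonneg (by positivity) (ketBra_nonneg v)
  have hre : ∀ x, RCLike.re ⟪x, A.op x⟫_ℂ =
      RCLike.re ⟪x, ((‖CFC.sqrt A.op v‖ ^ 2 : ℝ) • ketBra v) x⟫_ℂ := by
    intro x
    rw [re_inner_eq_norm_sqrt hpos, hsqrt x, _root_.smul_apply, inner_smul_right_eq_smul,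
      RCLike.smul_re, re_inner_ketBra, norm_smul, mul_pow, mul_comm]
  refine op_injective (le_antisymm ?_ ?_)
  · exact le_of_re_inner_le hpos.isSelfAdjoint hc.isSelfAdjoint fun x => (hre x).le
  · exact le_of_re_inner_le hc.isSelfAdjoint hpos.isSelfAdjoint fun x => (hre x).ge

theorem ket_mem_pureStates {v : H} (hv : ‖v‖ = 1) : ket v ∈ pureStates H := by
  refine ⟨ket_mem_states hv, ?_⟩
  rintro x hx y hy ⟨a, b, ha, hb, -, hab⟩
  have hle : x.op ≤ a⁻¹ • ketBra v := by
    rw [← op_ket, ← hab, op_add, op_real_smul, op_real_smul, smul_add, inv_smul_smul₀ ha.ne']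
    exact le_add_of_nonneg_right (real_smul_nonneg (inv_nonneg.2 ha.le)
      (real_smul_nonneg hb.le (mem_posCone_iff.1 hy.1)))
  have h := eq_smul_ket_of_le hv hx.1 hle
  have h1 := hx.2
  rw [h, op_real_smul, posTrace_smul (by positivity), (ket_mem_states hv).2, mul_one,
    ENNReal.ofReal_eq_one] at h1
  rw [h, h1, one_smul]

/-- Some `√ρ (e i)` is nonzero, and its rank-one operator lies below `ρ`. Unless the remainder
vanishes, `ρ` is a proper convex combination of two normalized pieces, and extremality makes `ρ`
equal to the rank-one piece. -/
theorem exists_ket_of_mem_pureStates {ρ : TraceClass H} (hρ : ρ ∈ pureStates H) :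
    ∃ v : H, ‖v‖ = 1 ∧ ρ = ket v := by
  obtain ⟨⟨hpos, htr⟩, hext⟩ := hρ
  have hp := mem_posCone_iff.1 hpos
  obtain ⟨ι, e, -⟩ := exists_hilbertBasis ℂ H
  obtain ⟨i, hi⟩ : ∃ i, CFC.sqrt ρ.op (e i) ≠ 0 := by
    by_contra! h0
    rw [posTrace_eq_tsum_sqrt hp e] at htr
    simp [h0] at htr
  set w := CFC.sqrt ρ.op (e i) with hw
  have hw0 : 0 < ‖w‖ := norm_pos_iff.2 hi
  have hle : (ket w).op ≤ ρ.op := by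
    have := sum_ketBra_sqrt_le hp e.orthonormal {i}
    rwa [Finset.sum_singleton] at this
  have hdiff : ρ - ket w ∈ posCone H := by
    rw [mem_posCone_iff, op_sub]; exact sub_nonneg.2 hle
  have hadd : posTrace (ket w).op + posTrace (ρ - ket w).op = 1 := by
    rw [← posTrace_add (mem_posCone_iff.1 (ket_mem_posCone w)) (mem_posCone_iff.1 hdiff), op_sub,
      add_sub_cancel, htr]
  have hunit : ‖((‖w‖⁻¹ : ℝ) : ℂ) • w‖ = 1 := by
    rw [norm_smul, Complex.norm_real, Real.norm_eq_abs, abs_inv, abs_norm,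
      inv_mul_cancel₀ hw0.ne']
  have hket : ket w = (‖w‖ ^ 2) • ket (((‖w‖⁻¹ : ℝ) : ℂ) • w) := by
    rw [ket_smul, smul_smul, Complex.norm_real, Real.norm_eq_abs, sq_abs, inv_pow,
      mul_inv_cancel₀ (by positivity), one_smul]
  refine ⟨_, hunit, ?_⟩
  rw [posTrace_op_ket] at hadd
  set r := (posTrace (ρ - ket w).op).toReal with hr
  have hrtop := posTrace_op_ne_top hdiff
  have hsum : ‖w‖ ^ 2 + r = 1 := by
    have := congrArg ENNReal.toReal hadd
    rwa [ENNReal.toReal_add (by simp) hrtop, ENNReal.toReal_pow, toReal_enorm,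
      ENNReal.toReal_one] at this
  rcases (ENNReal.toReal_nonneg (a := posTrace (ρ - ket w).op)).eq_or_lt with h0 | h0
  · rw [← hr] at h0
    have h1 : posTrace (ρ - ket w).op = 0 :=
      ((ENNReal.toReal_eq_zero_iff _).1 (hr.symm.trans h0.symm)).resolve_right hrtop
    have h2 : ρ - ket w = 0 :=
      op_injective (eq_zero_of_posTrace_eq_zero (mem_posCone_iff.1 hdiff) h1)
    have h3 : ‖w‖ ^ 2 = 1 := by linarith
    rw [h3, one_smul] at hket
    rw [← hket]; exact sub_eq_zero.1 h2
  · rw [← hr] at h0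
    refine (hext (ket_mem_states hunit) (x₂ := r⁻¹ • (ρ - ket w)) ⟨?_, ?_⟩
      ⟨‖w‖ ^ 2, r, by positivity, h0, hsum, ?_⟩).symm
    · exact smul_mem_posCone (inv_nonneg.2 h0.le) hdiff
    · rw [op_real_smul, posTrace_smul (inv_nonneg.2 h0.le), ← ENNReal.ofReal_toReal hrtop, ← hr,
        ← ENNReal.ofReal_mul (inv_nonneg.2 h0.le), inv_mul_cancel₀ h0.ne', ENNReal.ofReal_one]
    · rw [← hket, smul_inv_smul₀ h0.ne', add_sub_cancel]

theorem pureStates_subset : pureStates H ⊆ posConeRank H 1 := fun ρ hρ => by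
  obtain ⟨v, -, rfl⟩ := exists_ket_of_mem_pureStates hρ
  exact ket_mem_posConeRank v le_rfl

/-- The entropy vanishes identically here, which makes property (i) an instance of property (iii).
-/
theorem finiteContinuousOn_entropy_posConeRank_one :
    FiniteContinuousOn entropy (posConeRank H 1) := by
  have h : ∀ A ∈ posConeRank H 1, entropy A = 0 := fun A hA => by
    obtain ⟨b, rfl⟩ := exists_eq_sum_ket hA
    rw [Fin.sum_univ_one, entropy_ket]
  exact ⟨fun A hA => by rw [h A hA]; exact ENNReal.zero_lt_top, continuousOn_const.congr h⟩

end PureStates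

/-! ### The uniform bound on rank-one operators and its consequences. -/

section Equivalence

open TraceClass

variable {H : Type*} [NormedAddCommGroup H] [InnerProductSpace ℂ H] [CompleteSpace H]
  {K : Type*} [NormedAddCommGroup K] [InnerProductSpace ℂ K] [CompleteSpace K]
  {Φ : TraceClass H →ₗ[ℂ] TraceClass K}

namespace IsPositiveTraceNonincreasing

/-- By homogeneity, a bound on the rank-one operators of small norm extends to all of them. -/
theorem exists_bound_of_finiteContinuousOn (hΦ : IsPositiveTraceNonincreasing Φ)
    {f : TraceClass H → ℝ≥0∞} {𝒮 : Set (TraceClass H)} (hf : FiniteContinuousOn f 𝒮)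
    (hket : ∀ v, ket v ∈ 𝒮) (hle : ∀ v, outputEntropy Φ (ket v) ≤ f (ket v)) :
    ∃ C : ℝ≥0∞, C ≠ ∞ ∧ ∀ v : H, outputEntropy Φ (ket v) ≤ C * ‖v‖ₑ ^ 2 := by
  have h0 : (0 : TraceClass H) ∈ 𝒮 := ket_zero (H := H) ▸ hket 0
  have hfin := (hf.1 0 h0).ne
  have hev : ∀ᶠ A in 𝓝[𝒮] (0 : TraceClass H), f A ≤ f 0 + 1 := by
    filter_upwards [ENNReal.eventually_close (hf.2 0 h0) hfin one_ne_zero] with A hA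
    exact hA.1
  obtain ⟨δ, hδ, hball⟩ := Metric.mem_nhdsWithin_iff.1 hev
  refine ⟨(f 0 + 1) * ENNReal.ofReal (2 / δ), by finiteness, fun v => ?_⟩
  rcases eq_or_ne v 0 with rfl | hv
  · rw [ket_zero, hΦ.outputEntropy_zero]; exact bot_le
  have hv0 : 0 < ‖v‖ := norm_pos_iff.2 hv
  -- Rescaling by `c` gives the rank-one operator trace norm `δ / 2`, inside the ball where `f ≤ f 0
  -- + 1`.
  set c : ℝ := Real.sqrt (δ / 2) / ‖v‖ with hc
  have hc2 : c ^ 2 * ‖v‖ ^ 2 = δ / 2 := by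
    rw [hc, div_pow, Real.sq_sqrt (by positivity), div_mul_cancel₀ _ (by positivity)]
  have hcpos : 0 < c ^ 2 := by rw [hc]; positivity
  have hsmul : ket ((c : ℂ) • v) = (c ^ 2) • ket v := by
    rw [ket_smul, Complex.norm_real, Real.norm_eq_abs, sq_abs]
  have hmem : ket ((c : ℂ) • v) ∈ Metric.ball (0 : TraceClass H) δ ∩ 𝒮 := by
    refine ⟨?_, hket _⟩
    rw [mem_ball_zero_iff, hsmul, norm_smul, norm_ket, Real.norm_eq_abs, abs_of_pos hcpos, hc2]
    linarith
  have h1 : outputEntropy Φ (ket ((c : ℂ) • v)) ≤ f 0 + 1 := (hle _).trans (hball hmem)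
  have h2 : ket v = (c ^ 2)⁻¹ • ket ((c : ℂ) • v) := by rw [hsmul, inv_smul_smul₀ hcpos.ne']
  have h3 : (c ^ 2)⁻¹ = 2 / δ * ‖v‖ ^ 2 := by
    rw [inv_eq_iff_eq_inv, mul_inv, inv_div, ← hc2, mul_assoc,
      mul_inv_cancel₀ (by positivity), mul_one]
  rw [h2, hΦ.outputEntropy_smul (inv_nonneg.2 hcpos.le) (ket_mem_posCone _), h3,
    ENNReal.ofReal_mul (by positivity), ENNReal.ofReal_pow (norm_nonneg _), ofReal_norm]
  calc _ ≤ ENNReal.ofReal (2 / δ) * ‖v‖ₑ ^ 2 * (f 0 + 1) := by gcongr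
    _ = _ := by ring

theorem outputEntropy_ket_le_of_unit (hΦ : IsPositiveTraceNonincreasing Φ) {C : ℝ≥0∞}
    (hC : ∀ v : H, ‖v‖ = 1 → outputEntropy Φ (ket v) ≤ C) (v : H) :
    outputEntropy Φ (ket v) ≤ C * ‖v‖ₑ ^ 2 := by
  rcases eq_or_ne v 0 with rfl | hv
  · rw [ket_zero, hΦ.outputEntropy_zero]; exact bot_le
  have hv0 : 0 < ‖v‖ := norm_pos_iff.2 hv
  have hunit : ‖((‖v‖⁻¹ : ℝ) : ℂ) • v‖ = 1 := by
    rw [norm_smul, Complex.norm_real, Real.norm_eq_abs, abs_inv, abs_norm,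
      inv_mul_cancel₀ hv0.ne']
  have hket : ket v = (‖v‖ ^ 2) • ket (((‖v‖⁻¹ : ℝ) : ℂ) • v) := by
    rw [ket_smul, smul_smul, Complex.norm_real, Real.norm_eq_abs, sq_abs, inv_pow,
      mul_inv_cancel₀ (by positivity), one_smul]
  rw [hket, hΦ.outputEntropy_smul (by positivity) (ket_mem_posCone _),
    ENNReal.ofReal_pow (norm_nonneg _), ofReal_norm, mul_comm C]
  gcongr
  exact hC _ hunit

theorem finiteContinuousOn_posConeRank_one (hΦ : IsPositiveTraceNonincreasing Φ) {C : ℝ≥0∞}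
    (hCtop : C ≠ ∞) (hC : ∀ v : H, outputEntropy Φ (ket v) ≤ C * ‖v‖ₑ ^ 2) :
    FiniteContinuousOn (outputEntropy Φ) (posConeRank H 1) :=
  hΦ.finiteContinuousOn_of_entropy hCtop hC (fun _ hA => hA.1)
    finiteContinuousOn_entropy_posConeRank_one

/-- A single `k` with `Δ_k ≤ 1` on the images of pure states is enough; `C = 1 + (k + 2)` then comes
from `entropy_le_approxGap_add`. -/
theorem exists_bound_of_hasUAProperty (hΦ : IsPositiveTraceNonincreasing Φ)
    (h : HasUAProperty (Φ '' pureStates H)) :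
    ∃ C : ℝ≥0∞, C ≠ ∞ ∧ ∀ v : H, outputEntropy Φ (ket v) ≤ C * ‖v‖ₑ ^ 2 := by
  obtain ⟨k, hk⟩ := (h.eventually (eventually_le_nhds one_pos)).exists
  refine ⟨1 + (k + 2), by finiteness, hΦ.outputEntropy_ket_le_of_unit fun v hv => ?_⟩
  have hpos := ket_mem_posCone v
  have htr : posTrace (Φ (ket v)).op ≤ 1 :=
    (hΦ.trace_le _ hpos).trans (ket_mem_states hv).2.le
  refine (entropy_le_approxGap_add (hΦ.map_pos _ hpos) htr k).trans ?_
  gcongr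
  exact (le_iSup₂_of_le (Φ (ket v)) ⟨ket v, ket_mem_pureStates hv, rfl⟩ le_rfl).trans hk

end IsPositiveTraceNonincreasing

theorem FiniteContinuousOn.mono {X : Type*} [TopologicalSpace X] {f : X → ℝ≥0∞} {S T : Set X}
    (h : FiniteContinuousOn f T) (hST : S ⊆ T) : FiniteContinuousOn f S :=
  ⟨fun x hx => h.1 x (hST hx), h.2.mono hST⟩

end Equivalence

end

theorem theorem2 {H K : Type*}
    [NormedAddCommGroup H] [InnerProductSpace ℂ H] [CompleteSpace H]
    [TopologicalSpace.SeparableSpace H]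
    [NormedAddCommGroup K] [InnerProductSpace ℂ K] [CompleteSpace K]
    [TopologicalSpace.SeparableSpace K]
    (Φ : TraceClass H →ₗ[ℂ] TraceClass K) (hΦ : IsPositiveTraceNonincreasing Φ) :
    List.TFAE [
      FiniteContinuousOn (outputEntropy Φ) (posConeRank H 1),
      ∀ k : ℕ, 1 ≤ k → FiniteContinuousOn (approximator Φ k) (posCone H),
      ∀ 𝒜 : Set (TraceClass H), 𝒜 ⊆ posCone H →
        FiniteContinuousOn entropy 𝒜 → FiniteContinuousOn (outputEntropy Φ) 𝒜] ∧
    (FiniteContinuousOn (outputEntropy Φ) (posConeRank H 1) ↔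
      FiniteContinuousOn (outputEntropy Φ) (pureStates H) ∧
        ∃ C : ℝ, ∀ ρ ∈ pureStates H, outputEntropy Φ ρ ≤ ENNReal.ofReal C) ∧
    (HasUAProperty (Φ '' pureStates H) →
      FiniteContinuousOn (outputEntropy Φ) (posConeRank H 1)) := by
  have hbound : FiniteContinuousOn (outputEntropy Φ) (posConeRank H 1) →
      ∃ C : ℝ≥0∞, C ≠ ∞ ∧ ∀ v : H, outputEntropy Φ (TraceClass.ket v) ≤ C * ‖v‖ₑ ^ 2 := fun h =>
    hΦ.exists_bound_of_finiteContinuousOn h (fun v => ket_mem_posConeRank v le_rfl)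
      fun _ => le_rfl
  refine ⟨?_, ⟨fun h => ⟨h.mono pureStates_subset, ?_⟩, ?_⟩, fun h => ?_⟩
  · tfae_have 1 → 3 := fun h 𝒜 h𝒜 hent => by
      obtain ⟨C, hCtop, hC⟩ := hbound h
      exact hΦ.finiteContinuousOn_of_entropy hCtop hC h𝒜 hent
    tfae_have 3 → 1 := fun h =>
      h _ (fun _ hA => hA.1) finiteContinuousOn_entropy_posConeRank_one
    tfae_have 1 → 2 := fun h k hk => by
      obtain ⟨C, hCtop, hC⟩ := hbound h
      exact hΦ.finiteContinuousOn_approximator hCtop hC hk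
    -- Only `k = 1` is needed: `H_Φ^1` dominates `H_Φ` on rank-one operators, so its continuity at
    -- `0` yields the uniform bound.
    tfae_have 2 → 1 := fun h => by
      obtain ⟨C, hCtop, hC⟩ := hΦ.exists_bound_of_finiteContinuousOn (h 1 le_rfl)
        ket_mem_posCone fun v => hΦ.outputEntropy_le_approximator (ket_mem_posConeRank v le_rfl)
      exact hΦ.finiteContinuousOn_posConeRank_one hCtop hC
    tfae_finish
  · obtain ⟨C, hCtop, hC⟩ := hbound h
    refine ⟨C.toReal, fun ρ hρ => ?_⟩
    obtain ⟨v, hv, rfl⟩ := exists_ket_of_mem_pureStates hρ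
    refine (hC v).trans (le_of_eq ?_)
    rw [ENNReal.ofReal_toReal hCtop, ← ofReal_norm, hv, ENNReal.ofReal_one, one_pow, mul_one]
  · rintro ⟨-, C, hC⟩
    exact hΦ.finiteContinuousOn_posConeRank_one ENNReal.ofReal_ne_top
      (hΦ.outputEntropy_ket_le_of_unit fun v hv => hC _ (ket_mem_pureStates hv))
  · obtain ⟨C, hCtop, hC⟩ := hΦ.exists_bound_of_hasUAProperty h
    exact hΦ.finiteContinuousOn_posConeRank_one hCtop hC
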